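/- Let $m_0\ge 1$ be an integer. Write $L^2_r$ for the space of square integrable functions on $(0,\infty)$ with respect to $r\,dr$, $\Delta_m=\partial_r^2+r^{-1}\partial_r-m^2r^{-2}$, and $e_{m_0,0}(r)=\sqrt{2/m_0!}\;r^{m_0}e^{-r^2/2}$. For an angular mode $m\in\mathbb Z$, a function $u$ on $(0,\infty)$ is said to be in $H^k_r$, respectively $H^2_r\cap L^{2,2}_r$, if $u(r)e^{im\theta}$ belongs to $H^k(\mathbb R^2)$, respectively to $H^2(\mathbb R^2)$ with $r^2u\in L^2_r$. A primary branch of radially symmetric vortices of charge $m_0$, parameterized by the amplitude $a>0$, is a family of real functions $\psi(\cdot;a)\in H^2_r\cap L^{2,2}_r$ (for the mode $m_0$) and real numbers $\omega(a)$ such that, for all sufficiently small $a>0$, $$-\Delta_{m_0}\psi+r^2\psi+\psi^3-\omega\psi=0,\qquad \psi(\cdot;a)=a\,e_{m_0,0}+\mathcal O_{H^1_r}(a^3).$$ For $m\in\mathbb Z$ and $\Omega\in\mathbb R$, the block $H_m(a,\Omega)$ of the Hessian at $\psi=\psi(\cdot;a)$, $\omega=\omega(a)$, is the operator in $L^2_r\times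 L^2_r$ (complex valued functions) $$H_m(a,\Omega)=\begin{pmatrix}-\Delta_m+r^2-\omega+2\psi^2-\Omega(m-m_0)&\psi^2\\ \psi^2&-\Delta_{m-2m_0}+r^2-\omega+2\psi^2+\Omega(m-m_0)\end{pmatrix}$$ whose domain is the set of pairs of functions in $H^2_r\cap L^{2,2}_r$ for the modes $m$ and $m-2m_0$. Then a primary branch exists, and for every primary branch there are $a_0>0$, $C$ and a function $\Omega_{m_0+1,0}:(0,a_0)\to(-\infty,2)$ such that, for every $0<a<a_0$, zero is a simple eigenvalue of $H_{m_0+1}(a,\Omega_{m_0+1,0}(a))$ and $$\left|\Omega_{m_0+1,0}(a)-2+\frac{(2m_0)!}{4^{m_0}\,m_0!\,(m_0+1)!}\,a^2\right|\le C a^4 .$$ -/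

import Mathlib

open MeasureTheory Set

namespace VortexGP

/-- The measure `r dr` on `(0, ∞)`; `L²_r(ℝ⁺)` is the `L²` space of this measure. -/
noncomputable def radialMeasure : Measure ℝ :=
  (volume.restrict (Ioi (0 : ℝ))).withDensity (fun r => ENNReal.ofReal r)

section Sobolev

variable {𝕜 : Type*} [RCLike 𝕜]

/-- `u'` is the weak derivative of `u` on the open half-line `(0, ∞)`. -/
def HasWeakDeriv (u u' : ℝ → 𝕜) : Prop :=
  LocallyIntegrableOn u (Ioi (0 : ℝ)) ∧ LocallyIntegrableOn u' (Ioi (0 : ℝ)) ∧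
    ∀ φ : ℝ → ℝ, ContDiff ℝ (⊤ : ℕ∞) φ → HasCompactSupport φ → tsupport φ ⊆ Ioi (0 : ℝ) →
      ∫ r in Ioi (0 : ℝ), deriv φ r • u r = -∫ r in Ioi (0 : ℝ), φ r • u' r

/-- Membership in `L²_r(ℝ⁺)`. -/
def MemL2r (u : ℝ → 𝕜) : Prop := MemLp u 2 radialMeasure

/-- `u ∈ H²_r(ℝ⁺) ∩ L^{2,2}_r(ℝ⁺)` as the radial profile of an angular mode `u(r) e^{imθ}`, with
first and second weak derivatives `u₁`, `u₂`. In the orthonormal polar frame the gradient of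
`u(r) e^{imθ}` has the components `u'`, `i m u / r` and its Hessian has the components `u''`,
`i m (u' / r - u / r²)`, `u' / r - m² u / r²` (up to the factor `e^{imθ}`), so the conditions say
that `u(r) e^{imθ}` belongs to `H²(ℝ²)` and that `r² u` is square integrable. -/
structure IsModeJet (m : ℤ) (u u₁ u₂ : ℝ → 𝕜) : Prop where
  weak_deriv : HasWeakDeriv u u₁
  weak_deriv_two : HasWeakDeriv u₁ u₂
  mem_zero : MemL2r u
  mem_grad_r : MemL2r u₁
  mem_grad_theta : MemL2r (fun r => ((m : ℝ) / r) • u r)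
  mem_hess_rr : MemL2r u₂
  mem_hess_rtheta : MemL2r (fun r => (m : ℝ) • ((1 / r) • u₁ r - (1 / r ^ 2) • u r))
  mem_hess_thetatheta : MemL2r (fun r => (1 / r) • u₁ r - ((m : ℝ) ^ 2 / r ^ 2) • u r)
  mem_weight : MemL2r (fun r => (r ^ 2) • u r)

/-- `u ∈ H²_r(ℝ⁺) ∩ L^{2,2}_r(ℝ⁺)` (for the angular mode `m`) and
`g = Δ_m u = u'' + u' / r - m² u / r²`. -/
def IsModeLaplacian (m : ℤ) (u g : ℝ → 𝕜) : Prop :=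
  ∃ u₁ u₂ : ℝ → 𝕜, IsModeJet m u u₁ u₂ ∧
    ∀ᵐ r ∂radialMeasure, g r = u₂ r + (1 / r) • u₁ r - ((m : ℝ) ^ 2 / r ^ 2) • u r

/-- `u ∈ H¹_r(ℝ⁺)` (for the angular mode `m`) and `‖u‖_{H¹_r} ≤ B`, where
`‖u‖²_{H¹_r} = ‖u‖² + ‖u'‖² + ‖m u / r‖²` with the norms of `L²_r(ℝ⁺)`. -/
def ModeH1NormLE (m : ℤ) (u : ℝ → 𝕜) (B : ℝ) : Prop :=
  ∃ u₁ : ℝ → 𝕜, HasWeakDeriv u u₁ ∧ MemL2r u ∧ MemL2r u₁ ∧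
    MemL2r (fun r => ((m : ℝ) / r) • u r) ∧
    eLpNorm u 2 radialMeasure ^ 2 + eLpNorm u₁ 2 radialMeasure ^ 2
      + eLpNorm (fun r => ((m : ℝ) / r) • u r) 2 radialMeasure ^ 2 ≤ ENNReal.ofReal B ^ 2

end Sobolev

/-- The normalized eigenfunction `e_{m,0}(r) = √2 / √(m!) r^m e^{-r²/2}` of `-Δ_m + r²`. -/
noncomputable def groundMode (m : ℕ) (r : ℝ) : ℝ :=
  √2 / √(m.factorial : ℝ) * r ^ m * Real.exp (-r ^ 2 / 2)

/-- `u ∈ H²_r ∩ L^{2,2}_r` satisfies `-Δ_{m₀} u + r² u + u³ - ω u = 0`, that is,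
`e^{i m₀ θ} u(r)` is a stationary radially symmetric vortex of charge `m₀`, with
`ω = μ + m₀ Ω`. -/
def IsVortexProfile (m₀ : ℕ) (u : ℝ → ℝ) (ω : ℝ) : Prop :=
  ∃ g : ℝ → ℝ, IsModeLaplacian (m₀ : ℤ) u g ∧
    ∀ᵐ r ∂radialMeasure, -g r + r ^ 2 * u r + u r ^ 3 - ω * u r = 0

/-- `a ↦ (ψ a, ω a)` is the primary branch of radially symmetric vortices of charge `m₀`,
parameterized by the amplitude `a > 0` near `0`: `ψ a = a e_{m₀,0} + O(a³)` in `H¹_r`. -/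
def IsPrimaryBranch (m₀ : ℕ) (ψ : ℝ → ℝ → ℝ) (ω : ℝ → ℝ) : Prop :=
  ∃ a₁ > 0, ∃ C : ℝ, ∀ a : ℝ, 0 < a → a < a₁ →
    IsVortexProfile m₀ (ψ a) (ω a) ∧
    ModeH1NormLE (m₀ : ℤ) (fun r => ψ a r - a * groundMode m₀ r) (C * a ^ 3)

/-- The graph of the block `H_m = K_m - Ω (m - m₀) R` of the Hessian, on complex valued pairs
`v = (V_m, W_{m-2m₀})`, at the vortex with profile `ψ` and parameter `ω`: `v` belongs to the
domain `H²_r ∩ L^{2,2}_r` of `H_m`, and `H_m v = f`. -/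
def HessianBlock (m₀ : ℕ) (m : ℤ) (ψ : ℝ → ℝ) (ω Ω : ℝ) (v f : ℝ → ℂ × ℂ) : Prop :=
  ∃ g h : ℝ → ℂ,
    IsModeLaplacian m (fun r => (v r).1) g ∧
    IsModeLaplacian (m - 2 * (m₀ : ℤ)) (fun r => (v r).2) h ∧
    ∀ᵐ r ∂radialMeasure,
      (f r).1 = -g r + (r ^ 2 - ω + 2 * ψ r ^ 2) • (v r).1 + (ψ r ^ 2) • (v r).2
        - (Ω * ((m : ℝ) - m₀)) • (v r).1 ∧
      (f r).2 = (ψ r ^ 2) • (v r).1 + (-h r + (r ^ 2 - ω + 2 * ψ r ^ 2) • (v r).2)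
        + (Ω * ((m : ℝ) - m₀)) • (v r).2

/-- Zero is a simple eigenvalue of the linear operator with graph `T` in the space
`L²_r × L²_r` of classes of pairs of functions: the kernel is spanned by one nonzero vector `v`
(geometric multiplicity one), and `v` is not in the range (algebraic multiplicity one). -/
def HasSimpleZeroEigenvalue (T : (ℝ → ℂ × ℂ) → (ℝ → ℂ × ℂ) → Prop) : Prop :=
  ∃ v : ℝ → ℂ × ℂ, T v 0 ∧ (¬ v =ᵐ[radialMeasure] 0) ∧
    (∀ w : ℝ → ℂ × ℂ, T w 0 → ∃ c : ℂ, w =ᵐ[radialMeasure] c • v) ∧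
    ¬ ∃ w : ℝ → ℂ × ℂ, T w v

end VortexGP

/-! The lowest eigenvalue of `-Δ_m + r²` is `2(|m| + 1)`, with eigenfunction `e_{|m|,0}`. At `a = 0`
one has `ω = 2(m₀ + 1)`, and at `Ω = 2` the two rows of the block in the modes `m₀ + 1` and `1 - m₀`
decouple into operators annihilating `e_{m₀+1,0}` and `e_{m₀-1,0}`. The kernel is thus two
dimensional, and the question is how it splits for small `a`.

Put `ε = a²`, `w = ∫ e_{m₀,0}⁴ r dr` (`quarticWeight`) and `Ω = 2 - ε s`. Along the branch `ψ² = ε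
e_{m₀,0}² + O(ε²)` uniformly and `ω = 2(m₀ + 1) + ε w + O(ε²)` (`branch_expansion`). Hence the block
is a fixed symmetric operator plus `ε` times a bounded one, and Lyapunov–Schmidt reduction leaves
the matrix with rows `(α + s, β)` and `(β, γ - s)`, up to `O(ε)`. Gaussian integrals give `α = w
m₀/(m₀+1)`, `β = w √(m₀/(m₀+1))`, `γ = w`. Since `αγ = β²`, the limiting determinant is `s (γ - α -
s)`. Its root `s = γ - α = w/(m₀+1)` is simple, so it survives with error `O(ε)` by the intermediate
value theorem (`exists_det_eq_zero`); this gives the coefficient of `a²`. As `β ≠ 0`, the singular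
matrix has rank one and the kernel is a line; as the operator is symmetric, a kernel vector cannot
lie in the range (`kernel_of_reduced_matrix`, `exists_singular_parameter`).

Unbounded operators appear only as graphs. The analytic input is that `-Δ_m + r² - 2(|m| + 1)` is
symmetric and maps onto the orthogonal complement of its ground mode. Symmetry is integration by
parts. Surjectivity (`exists_isModeLaplacian`) comes from factoring the operator into first order
ones, solved by explicit integrals and controlled by one weighted estimate
(`memL2r_of_first_order`).

The branch itself is obtained from a contraction for the equation with truncated cubic term. In a
mode `m ≠ 0` the `H¹_r` norm dominates the supremum (`HasWeakDeriv.sq_le`), so for small `a` the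
truncation is inactive. -/

open Filter Topology

namespace VortexGP

/-! ### The measure `r dr` -/

theorem measurable_radialDensity : Measurable fun r : ℝ => ENNReal.ofReal r :=
  ENNReal.measurable_ofReal

theorem ae_radialMeasure_iff {p : ℝ → Prop} :
    (∀ᵐ r ∂radialMeasure, p r) ↔ ∀ᵐ r ∂volume.restrict (Ioi (0 : ℝ)), p r := by
  rw [radialMeasure, ae_withDensity_iff measurable_radialDensity]
  constructor <;> intro h
  · filter_upwards [h, ae_restrict_mem measurableSet_Ioi] with r hr hr0
    exact hr (by simpa using hr0)
  · filter_upwards [h] with r hr _ using hr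

theorem ae_radialMeasure_pos : ∀ᵐ r ∂radialMeasure, 0 < r :=
  ae_radialMeasure_iff.2 (ae_restrict_mem measurableSet_Ioi)

theorem aestronglyMeasurable_radialMeasure_iff {E : Type*} [TopologicalSpace E] {u : ℝ → E} :
    AEStronglyMeasurable u radialMeasure ↔
      AEStronglyMeasurable u (volume.restrict (Ioi (0 : ℝ))) := by
  constructor <;> rintro ⟨v, hv, h⟩ <;> refine ⟨v, hv, ?_⟩
  · exact ae_radialMeasure_iff.1 h
  · exact ae_radialMeasure_iff.2 h

theorem integrable_radialMeasure_iff {f : ℝ → ℝ} :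
    Integrable f radialMeasure ↔ IntegrableOn (fun r => r * f r) (Ioi 0) := by
  rw [radialMeasure, integrable_withDensity_iff_integrable_smul' measurable_radialDensity
    (by simp)]
  refine integrable_congr ?_
  filter_upwards [ae_restrict_mem measurableSet_Ioi] with r hr
  simp [ENNReal.toReal_ofReal (le_of_lt hr)]

theorem integral_radialMeasure (f : ℝ → ℝ) :
    ∫ r, f r ∂radialMeasure = ∫ r in Ioi (0 : ℝ), r * f r := by
  rw [radialMeasure, integral_withDensity_eq_integral_toReal_smul measurable_radialDensity
    (by simp)]
  refine integral_congr_ae ?_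
  filter_upwards [ae_restrict_mem measurableSet_Ioi] with r hr
  simp [ENNReal.toReal_ofReal (le_of_lt hr)]

theorem memL2r_iff {u : ℝ → ℝ} :
    MemL2r u ↔ AEStronglyMeasurable u (volume.restrict (Ioi (0 : ℝ))) ∧
      IntegrableOn (fun r => r * u r ^ 2) (Ioi 0) := by
  rw [MemL2r]
  constructor
  · intro h
    exact ⟨aestronglyMeasurable_radialMeasure_iff.1 h.1,
      integrable_radialMeasure_iff.1 h.integrable_sq⟩
  · rintro ⟨h1, h2⟩
    rw [memLp_two_iff_integrable_sq (aestronglyMeasurable_radialMeasure_iff.2 h1)]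
    exact integrable_radialMeasure_iff.2 h2

/-! ### Absolutely continuous functions on `(0, ∞)` -/

/-- `u` is absolutely continuous on the compact subintervals of `(0, ∞)`, with derivative `u₁`
almost everywhere. -/
def HasACDeriv (u u₁ : ℝ → ℝ) : Prop :=
  (∀ x y : ℝ, 0 < x → 0 < y → AbsolutelyContinuousOnInterval u x y) ∧
    ∀ᵐ r ∂volume.restrict (Ioi (0 : ℝ)), HasDerivAt u (u₁ r) r

theorem uIcc_subset_Ioi {x y : ℝ} (hx : 0 < x) (hy : 0 < y) : uIcc x y ⊆ Ioi 0 := by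
  intro z hz
  exact lt_of_lt_of_le (lt_min hx hy) hz.1

namespace HasACDeriv

variable {u u₁ v w w₁ : ℝ → ℝ}

theorem congr (h : HasACDeriv u u₁)
    (hv : ∀ᵐ r ∂volume.restrict (Ioi (0 : ℝ)), u₁ r = v r) : HasACDeriv u v :=
  ⟨h.1, by filter_upwards [h.2, hv] with r h1 h2 using h2 ▸ h1⟩

theorem congr_pos (h : HasACDeriv u u₁) (hv : ∀ r, 0 < r → u₁ r = v r) : HasACDeriv u v :=
  h.congr ((ae_restrict_mem measurableSet_Ioi).mono fun r hr => hv r hr)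

theorem ae_eq_deriv (h : HasACDeriv u u₁) {x y : ℝ} (hx : 0 < x) (hy : 0 < y) :
    ∀ᵐ r ∂volume.restrict (uIoc x y), deriv u r = u₁ r := by
  have h1 : uIoc x y ⊆ Ioi 0 := uIoc_subset_uIcc.trans (uIcc_subset_Ioi hx hy)
  filter_upwards [ae_restrict_of_ae_restrict_of_subset h1 h.2] with r hr using hr.deriv

theorem intervalIntegrable (h : HasACDeriv u u₁) {x y : ℝ} (hx : 0 < x) (hy : 0 < y) :
    IntervalIntegrable u₁ volume x y :=
  (h.1 x y hx hy).intervalIntegrable_deriv.congr_ae (h.ae_eq_deriv hx hy)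

theorem integral_eq (h : HasACDeriv u u₁) {x y : ℝ} (hx : 0 < x) (hy : 0 < y) :
    ∫ r in x..y, u₁ r = u y - u x := by
  rw [← (h.1 x y hx hy).integral_deriv_eq_sub]
  exact intervalIntegral.integral_congr_ae_restrict
    ((h.ae_eq_deriv hx hy).mono fun r hr => hr.symm)

theorem continuousOn (h : HasACDeriv u u₁) : ContinuousOn u (Ioi 0) := by
  intro x hx
  have hx : 0 < x := hx
  have h1 : ContinuousOn u (uIcc (x / 2) (2 * x)) :=
    (h.1 (x / 2) (2 * x) (by linarith) (by linarith)).continuousOn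
  rw [uIcc_of_le (by linarith)] at h1
  exact (h1.continuousAt (Icc_mem_nhds (by linarith) (by linarith))).continuousWithinAt

theorem aestronglyMeasurable (h : HasACDeriv u u₁) :
    AEStronglyMeasurable u (volume.restrict (Ioi (0 : ℝ))) :=
  h.continuousOn.aestronglyMeasurable measurableSet_Ioi

theorem mul (hu : HasACDeriv u u₁) (hw : HasACDeriv w w₁) :
    HasACDeriv (fun r => u r * w r) (fun r => u₁ r * w r + u r * w₁ r) :=
  ⟨fun x y hx hy => (hu.1 x y hx hy).fun_mul (hw.1 x y hx hy), by
    filter_upwards [hu.2, hw.2] with r h1 h2 using h1.mul h2⟩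

theorem add (hu : HasACDeriv u u₁) (hw : HasACDeriv w w₁) :
    HasACDeriv (fun r => u r + w r) (fun r => u₁ r + w₁ r) :=
  ⟨fun x y hx hy => (hu.1 x y hx hy).fun_add (hw.1 x y hx hy), by
    filter_upwards [hu.2, hw.2] with r h1 h2 using h1.add h2⟩

theorem const_mul (c : ℝ) (hu : HasACDeriv u u₁) :
    HasACDeriv (fun r => c * u r) (fun r => c * u₁ r) :=
  ⟨fun x y hx hy => (hu.1 x y hx hy).const_mul c, by
    filter_upwards [hu.2] with r h1 using h1.const_mul c⟩

end HasACDeriv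

theorem locallyIntegrableOn_of_intervalIntegrable {f : ℝ → ℝ}
    (h : ∀ x y : ℝ, 0 < x → 0 < y → IntervalIntegrable f volume x y) :
    LocallyIntegrableOn f (Ioi (0 : ℝ)) := by
  intro x hx
  have hx : 0 < x := hx
  refine ⟨Ioc (x / 2) (2 * x), mem_nhdsWithin_of_mem_nhds
    (Ioc_mem_nhds (by linarith) (by linarith)), ?_⟩
  have := h (x / 2) (2 * x) (by linarith) (by linarith)
  rwa [intervalIntegrable_iff_integrableOn_Ioc_of_le (by linarith)] at this

theorem intervalIntegrable_of_locallyIntegrableOn {f : ℝ → ℝ}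
    (h : LocallyIntegrableOn f (Ioi (0 : ℝ))) {x y : ℝ} (hx : 0 < x) (hy : 0 < y) :
    IntervalIntegrable f volume x y :=
  (h.integrableOn_compact_subset (uIcc_subset_Ioi hx hy) isCompact_uIcc).intervalIntegrable

theorem hasACDeriv_integral {f : ℝ → ℝ}
    (h : ∀ x y : ℝ, 0 < x → 0 < y → IntervalIntegrable f volume x y) {c : ℝ} (hc : 0 < c) :
    HasACDeriv (fun x => ∫ r in c..x, f r) f := by
  constructor
  · intro x y hx hy
    have h1 := (h (min c (min x y)) (max c (max x y)) (by positivity)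
      (lt_max_of_lt_left hc)).absolutelyContinuousOnInterval_intervalIntegral (c := c)
        (by rw [uIcc_of_le (by simp)]; simp)
    refine h1.mono (uIcc_subset_uIcc ?_ ?_) <;> rw [uIcc_of_le (by simp)] <;> simp
  · rw [ae_restrict_iff' measurableSet_Ioi]
    -- Lebesgue differentiation is applied on a countable exhaustion of the half-line by compact
    -- intervals, all containing the base point `c`.
    have h1 : ∀ n : ℕ, ∀ᵐ r, r ∈ uIcc (min c (1 / (n + 1 : ℝ))) (max c (n + 1 : ℝ)) →
        HasDerivAt (fun x => ∫ r in c..x, f r) (f r) r := by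
      intro n
      have h2 := (h (min c (1 / (n + 1 : ℝ))) (max c (n + 1 : ℝ))
        (lt_min hc (by positivity)) (lt_max_of_lt_left hc)).ae_hasDerivAt_integral
      filter_upwards [h2] with r hr hr'
      exact hr hr' c (by
        rw [uIcc_of_le (le_trans (min_le_left _ _) (le_max_left _ _))]; simp)
    filter_upwards [ae_all_iff.2 h1] with r hr hr0
    have hr0 : 0 < r := hr0
    obtain ⟨n, hn⟩ := exists_nat_ge (max r (1 / r))
    refine hr n ?_
    have hn1 : r ≤ n := (le_max_left _ _).trans hn
    have hn2 : 1 / r ≤ n := (le_max_right _ _).trans hn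
    rw [uIcc_of_le (le_trans (min_le_left _ _) (le_max_left _ _))]
    refine ⟨(min_le_right _ _).trans ?_, le_trans (by linarith) (le_max_right _ _)⟩
    rw [div_le_iff₀ (by positivity)]
    rw [div_le_iff₀ hr0] at hn2
    nlinarith

theorem hasACDeriv_of_hasDerivAt {u u₁ : ℝ → ℝ} (h : ∀ r, 0 < r → HasDerivAt u (u₁ r) r)
    (hc : ContinuousOn u₁ (Ioi 0)) : HasACDeriv u u₁ := by
  have hi : ∀ x y : ℝ, 0 < x → 0 < y → IntervalIntegrable u₁ volume x y := fun x y hx hy =>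
    (hc.mono (uIcc_subset_Ioi hx hy)).intervalIntegrable
  refine ⟨fun x y hx hy => ?_, (ae_restrict_mem measurableSet_Ioi).mono fun r hr => h r hr⟩
  obtain ⟨C, hC⟩ := isCompact_uIcc.exists_bound_of_continuousOn (hc.mono (uIcc_subset_Ioi hx hy))
  have hl : LipschitzOnWith C.toNNReal u (uIcc x y) := by
    refine (convex_uIcc x y).lipschitzOnWith_of_nnnorm_hasDerivWithin_le
      (f' := u₁) (fun z hz => (h z (uIcc_subset_Ioi hx hy hz)).hasDerivWithinAt) ?_
    intro z hz
    rw [← NNReal.coe_le_coe, coe_nnnorm]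
    exact (hC z hz).trans (Real.le_coe_toNNReal C)
  exact hl.absolutelyContinuousOnInterval

/-! ### Weak derivatives and absolute continuity -/

theorem exists_tsupport_subset_Ioo {φ : ℝ → ℝ} (hc : HasCompactSupport φ)
    (hs : tsupport φ ⊆ Ioi (0 : ℝ)) : ∃ a b, 0 < a ∧ a < b ∧ tsupport φ ⊆ Ioo a b := by
  have hc' : IsCompact (tsupport φ) := hc
  rcases (tsupport φ).eq_empty_or_nonempty with h0 | h0
  · exact ⟨1, 2, by norm_num, by norm_num, by simp [h0]⟩
  obtain ⟨x, hx, hx'⟩ := hc'.exists_isLeast h0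
  obtain ⟨y, hy, hy'⟩ := hc'.exists_isGreatest h0
  have hx0 : 0 < x := hs hx
  have hxy : x ≤ y := hx' hy
  refine ⟨x / 2, y + 1, by linarith, by linarith, fun z hz => ⟨?_, ?_⟩⟩
  · have := hx' hz; linarith
  · have := hy' hz; linarith

theorem setIntegral_Ioi_eq_intervalIntegral {f : ℝ → ℝ} {a b : ℝ} (ha : 0 < a) (hab : a < b)
    (hf : ∀ r, r ∉ Ioo a b → f r = 0) : ∫ r in Ioi (0 : ℝ), f r = ∫ r in a..b, f r := by
  rw [intervalIntegral.integral_of_le hab.le]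
  refine setIntegral_eq_of_subset_of_forall_sdiff_eq_zero measurableSet_Ioi
    (fun r hr => ha.trans hr.1) ?_
  rintro r ⟨-, hr⟩
  exact hf r fun h => hr ⟨h.1, h.2.le⟩

theorem HasACDeriv.hasWeakDeriv {u u₁ : ℝ → ℝ} (h : HasACDeriv u u₁) : HasWeakDeriv u u₁ := by
  refine ⟨h.continuousOn.locallyIntegrableOn measurableSet_Ioi,
    locallyIntegrableOn_of_intervalIntegrable fun x y hx hy => h.intervalIntegrable hx hy, ?_⟩
  intro φ hφ hc hs
  obtain ⟨a, b, ha, hab, hsub⟩ := exists_tsupport_subset_Ioo hc hs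
  have hb : 0 < b := ha.trans hab
  have h0 : ∀ r, r ∉ Ioo a b → φ r = 0 := fun r hr =>
    image_eq_zero_of_notMem_tsupport fun h => hr (hsub h)
  have h0' : ∀ r, r ∉ Ioo a b → deriv φ r = 0 := fun r hr =>
    image_eq_zero_of_notMem_tsupport fun h => hr (hsub (tsupport_deriv_subset h))
  have hφc : Continuous (deriv φ) := hφ.continuous_deriv (by simp)
  have hφ' : HasACDeriv φ (deriv φ) := hasACDeriv_of_hasDerivAt
    (fun r _ => (hφ.differentiable (by simp) r).hasDerivAt) hφc.continuousOn
  have h1 := (hφ'.mul h).integral_eq ha hb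
  have hu : ContinuousOn u (uIcc a b) := h.continuousOn.mono (uIcc_subset_Ioi ha hb)
  rw [h0 a (by simp), h0 b (by simp), intervalIntegral.integral_add
    ((hφc.intervalIntegrable a b).mul_continuousOn hu)
    ((h.intervalIntegrable ha hb).continuousOn_mul hφ.continuous.continuousOn)] at h1
  simp only [smul_eq_mul]
  rw [setIntegral_Ioi_eq_intervalIntegral ha hab (by intro r hr; simp [h0' r hr]),
    setIntegral_Ioi_eq_intervalIntegral ha hab (by intro r hr; simp [h0 r hr])]
  linarith

/-- The primitive from the left end of the support is constant to the right of it, and that constant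
is the total integral, which vanishes. -/
theorem exists_primitive_of_integral_eq_zero {ψ : ℝ → ℝ} (hψ : ContDiff ℝ (⊤ : ℕ∞) ψ)
    (hc : HasCompactSupport ψ) (hs : tsupport ψ ⊆ Ioi (0 : ℝ))
    (h0 : ∫ r in Ioi (0 : ℝ), ψ r = 0) :
    ∃ φ : ℝ → ℝ, ContDiff ℝ (⊤ : ℕ∞) φ ∧ HasCompactSupport φ ∧ tsupport φ ⊆ Ioi (0 : ℝ) ∧
      deriv φ = ψ := by
  obtain ⟨a, b, ha, hab, hsub⟩ := exists_tsupport_subset_Ioo hc hs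
  have hz : ∀ r, r ∉ Ioo a b → ψ r = 0 := fun r hr =>
    image_eq_zero_of_notMem_tsupport fun h => hr (hsub h)
  rw [setIntegral_Ioi_eq_intervalIntegral ha hab hz] at h0
  have hd : ∀ x, HasDerivAt (fun x => ∫ r in a..x, ψ r) (ψ x) x := fun x =>
    intervalIntegral.integral_hasDerivAt_right (hψ.continuous.intervalIntegrable _ _)
      (hψ.continuous.stronglyMeasurableAtFilter _ _) hψ.continuous.continuousAt
  have hderiv : deriv (fun x => ∫ r in a..x, ψ r) = ψ := funext fun x => (hd x).deriv
  have hsupp : tsupport (fun x => ∫ r in a..x, ψ r) ⊆ Icc a b := by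
    refine closure_minimal ?_ isClosed_Icc
    intro x hx
    by_contra hx'
    refine hx ?_
    rcases lt_or_ge x a with h | h
    · change ∫ r in a..x, ψ r = 0
      rw [intervalIntegral.integral_symm, neg_eq_zero]
      refine intervalIntegral.integral_zero_ae (ae_of_all _ fun r hr => hz r ?_)
      rw [uIoc_of_le h.le] at hr
      exact fun h' => absurd h'.1 (not_lt.2 hr.2)
    · have hbx : b < x := by
        by_contra hb
        exact hx' ⟨h, not_lt.1 hb⟩
      change ∫ r in a..x, ψ r = 0
      rw [← intervalIntegral.integral_add_adjacent_intervals
        (hψ.continuous.intervalIntegrable a b) (hψ.continuous.intervalIntegrable b x), h0,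
        zero_add]
      refine intervalIntegral.integral_zero_ae (ae_of_all _ fun r hr => hz r ?_)
      rw [uIoc_of_le hbx.le] at hr
      exact fun h' => absurd h'.2 (not_lt.2 hr.1.le)
  refine ⟨fun x => ∫ r in a..x, ψ r, ?_, ?_, ?_, hderiv⟩
  · rw [contDiff_infty_iff_deriv, hderiv]
    exact ⟨fun x => (hd x).differentiableAt, hψ⟩
  · exact HasCompactSupport.of_support_subset_isCompact isCompact_Icc
      ((subset_tsupport _).trans hsupp)
  · exact hsupp.trans fun x hx => ha.trans_le hx.1

theorem integrableOn_smul_of_hasCompactSupport {E : Type*} [NormedAddCommGroup E]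
    [NormedSpace ℝ E] {φ : ℝ → ℝ} {w : ℝ → E}
    (hφ : Continuous φ) (hc : HasCompactSupport φ) (hs : tsupport φ ⊆ Ioi (0 : ℝ))
    (hw : LocallyIntegrableOn w (Ioi (0 : ℝ))) :
    IntegrableOn (fun r => φ r • w r) (Ioi (0 : ℝ)) := by
  have h1 : IntegrableOn (fun r => φ r • w r) (tsupport φ) :=
    (hw.integrableOn_compact_subset hs hc).continuousOn_smul hφ.continuousOn hc
  exact h1.of_forall_sdiff_eq_zero measurableSet_Ioi fun r hr => by
    simp [image_eq_zero_of_notMem_tsupport hr.2]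

theorem integrableOn_mul_of_hasCompactSupport {φ w : ℝ → ℝ} (hφ : Continuous φ)
    (hc : HasCompactSupport φ) (hs : tsupport φ ⊆ Ioi (0 : ℝ))
    (hw : LocallyIntegrableOn w (Ioi (0 : ℝ))) :
    IntegrableOn (fun r => φ r * w r) (Ioi (0 : ℝ)) :=
  integrableOn_smul_of_hasCompactSupport hφ hc hs hw

/-- Du Bois-Reymond: with a fixed bump `η` of mass one, every test function is `t η` plus the
derivative of a test function, so `w` acts on it as the constant `∫ η w`. -/
theorem exists_ae_eq_const_of_weakDeriv_zero {w : ℝ → ℝ} (hw : LocallyIntegrableOn w (Ioi (0 : ℝ)))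
    (h : ∀ φ : ℝ → ℝ, ContDiff ℝ (⊤ : ℕ∞) φ → HasCompactSupport φ → tsupport φ ⊆ Ioi (0 : ℝ) →
      ∫ r in Ioi (0 : ℝ), deriv φ r * w r = 0) :
    ∃ c, ∀ᵐ r ∂volume.restrict (Ioi (0 : ℝ)), w r = c := by
  let f : ContDiffBump (1 : ℝ) := ⟨1 / 4, 1 / 2, by norm_num, by norm_num⟩
  set η : ℝ → ℝ := f.normed volume with hη
  have hη1 : ContDiff ℝ (⊤ : ℕ∞) η := f.contDiff_normed
  have hη2 : HasCompactSupport η := f.hasCompactSupport_normed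
  have hη3 : tsupport η ⊆ Ioi (0 : ℝ) := by
    rw [hη, f.tsupport_normed_eq]
    intro x hx
    have : |x - 1| ≤ 1 / 2 := by rw [← Real.dist_eq]; exact hx
    have := (abs_le.1 this).1
    change 0 < x
    linarith
  have hη4 : ∫ r in Ioi (0 : ℝ), η r = 1 := by
    rw [← f.integral_normed (μ := volume)]
    refine setIntegral_eq_integral_of_forall_compl_eq_zero fun x hx => ?_
    exact image_eq_zero_of_notMem_tsupport fun h => hx (hη3 h)
  set c := ∫ r in Ioi (0 : ℝ), η r * w r with hcdef
  refine ⟨c, ?_⟩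
  have key := IsOpen.ae_eq_zero_of_integral_contDiff_smul_eq_zero (μ := volume)
    (f := fun r => w r - c) (isOpen_Ioi (a := (0 : ℝ)))
    (hw.sub (locallyIntegrableOn_const c)) ?_
  · rw [ae_restrict_iff' measurableSet_Ioi]
    filter_upwards [key] with r hr hr0
    exact sub_eq_zero.1 (hr hr0)
  intro g hg1 hg2 hg3
  have hgi : IntegrableOn g (Ioi (0 : ℝ)) := (hg1.continuous.integrable_of_hasCompactSupport hg2).integrableOn
  have hηi : IntegrableOn η (Ioi (0 : ℝ)) := (hη1.continuous.integrable_of_hasCompactSupport hη2).integrableOn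
  set t := ∫ r in Ioi (0 : ℝ), g r with ht
  obtain ⟨φ, hφ1, hφ2, hφ3, hφ4⟩ := exists_primitive_of_integral_eq_zero
    (ψ := fun r => g r - t * η r) (hg1.sub (contDiff_const.mul hη1))
    (hg2.sub (hη2.mul_left (f := fun _ => t)))
    ((tsupport_sub _ _).trans (union_subset hg3
      ((tsupport_mul_subset_right (f := fun _ : ℝ => t)).trans hη3)))
    (by
      rw [integral_sub hgi (hηi.const_mul t), integral_const_mul, hη4]
      simp [ht])
  have h1 := h φ hφ1 hφ2 hφ3
  rw [hφ4] at h1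
  have hgw := integrableOn_mul_of_hasCompactSupport hg1.continuous hg2 hg3 hw
  have hηw := integrableOn_mul_of_hasCompactSupport hη1.continuous hη2 hη3 hw
  have h2 : ∫ r in Ioi (0 : ℝ), (g r - t * η r) * w r =
      (∫ r in Ioi (0 : ℝ), g r * w r) - t * c := by
    rw [hcdef, ← integral_const_mul, ← integral_sub hgw (hηw.const_mul t)]
    congr 1
    ext r
    ring
  rw [h2] at h1
  have h3 : ∫ r, g r • (w r - c) = ∫ r in Ioi (0 : ℝ), g r * (w r - c) := by
    symm
    refine setIntegral_eq_integral_of_forall_compl_eq_zero fun x hx => ?_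
    simp [image_eq_zero_of_notMem_tsupport fun h => hx (hg3 h)]
  rw [h3]
  have h4 : ∫ r in Ioi (0 : ℝ), g r * (w r - c) = (∫ r in Ioi (0 : ℝ), g r * w r) - t * c := by
    rw [ht, mul_comm, ← integral_const_mul, ← integral_sub hgw (hgi.const_mul c)]
    congr 1
    ext r
    ring
  rw [h4, h1]

/-- A function with a weak derivative has an absolutely continuous representative. -/
theorem HasWeakDeriv.exists_hasACDeriv {u u₁ : ℝ → ℝ} (h : HasWeakDeriv u u₁) :
    ∃ v, HasACDeriv v u₁ ∧ ∀ᵐ r ∂volume.restrict (Ioi (0 : ℝ)), u r = v r := by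
  obtain ⟨hu, hu₁, hφ⟩ := h
  have hU := hasACDeriv_integral (f := u₁)
    (fun x y hx hy => intervalIntegrable_of_locallyIntegrableOn hu₁ hx hy) one_pos
  set U : ℝ → ℝ := fun x => ∫ r in (1 : ℝ)..x, u₁ r with hUdef
  obtain ⟨-, -, hφU⟩ := hU.hasWeakDeriv
  have hUl := hU.hasWeakDeriv.1
  obtain ⟨c, hc⟩ := exists_ae_eq_const_of_weakDeriv_zero (w := fun r => u r - U r)
    (hu.sub hUl) (by
      intro φ h1 h2 h3
      have hd : Continuous (deriv φ) := h1.continuous_deriv (by simp)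
      have hs : tsupport (deriv φ) ⊆ Ioi (0 : ℝ) := tsupport_deriv_subset.trans h3
      have e1 := hφ φ h1 h2 h3
      have e2 := hφU φ h1 h2 h3
      simp only [smul_eq_mul] at e1 e2
      have e3 := integral_sub (integrableOn_mul_of_hasCompactSupport hd h2.deriv hs hu)
        (integrableOn_mul_of_hasCompactSupport hd h2.deriv hs hUl)
      simp only [mul_sub]
      rw [e3, e1, e2, sub_self])
  have hcst : HasACDeriv (fun _ => c) (fun _ => 0) :=
    hasACDeriv_of_hasDerivAt (fun r _ => hasDerivAt_const r c) continuousOn_const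
  refine ⟨fun r => U r + c, (hU.add hcst).congr (by simp), ?_⟩
  filter_upwards [hc] with r hr
  linarith

theorem HasWeakDeriv.congr {u u₁ v v₁ : ℝ → ℝ} (h : HasWeakDeriv u u₁)
    (hu : ∀ᵐ r ∂volume.restrict (Ioi (0 : ℝ)), u r = v r)
    (hu₁ : ∀ᵐ r ∂volume.restrict (Ioi (0 : ℝ)), u₁ r = v₁ r) : HasWeakDeriv v v₁ := by
  obtain ⟨h1, h2, h3⟩ := h
  refine ⟨locallyIntegrableOn_of_intervalIntegrable fun x y hx hy => ?_,
    locallyIntegrableOn_of_intervalIntegrable fun x y hx hy => ?_, ?_⟩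
  · exact (intervalIntegrable_of_locallyIntegrableOn h1 hx hy).congr_ae
      (ae_restrict_of_ae_restrict_of_subset
        (uIoc_subset_uIcc.trans (uIcc_subset_Ioi hx hy)) hu)
  · exact (intervalIntegrable_of_locallyIntegrableOn h2 hx hy).congr_ae
      (ae_restrict_of_ae_restrict_of_subset
        (uIoc_subset_uIcc.trans (uIcc_subset_Ioi hx hy)) hu₁)
  · intro φ hφ hc hs
    have e1 : ∫ r in Ioi (0 : ℝ), deriv φ r • v r = ∫ r in Ioi (0 : ℝ), deriv φ r • u r :=
      integral_congr_ae (by filter_upwards [hu] with r hr; rw [hr])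
    have e2 : ∫ r in Ioi (0 : ℝ), φ r • v₁ r = ∫ r in Ioi (0 : ℝ), φ r • u₁ r :=
      integral_congr_ae (by filter_upwards [hu₁] with r hr; rw [hr])
    rw [e1, e2, h3 φ hφ hc hs]

/-! ### Boundary terms -/

/-- Integrability of `F₁` gives a limit at the origin; a nonzero limit would make `1/r` integrable
there, by comparison with `F/r`. Boundary terms thus vanish without pointwise information on `F`. -/
theorem HasACDeriv.tendsto_zero_at_zero {F F₁ : ℝ → ℝ} (h : HasACDeriv F F₁)
    (h1 : IntegrableOn F₁ (Ioc 0 1)) (h2 : IntegrableOn (fun r => F r / r) (Ioc 0 1)) :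
    Tendsto F (𝓝[>] 0) (𝓝 0) := by
  have hI : IntervalIntegrable F₁ volume 0 1 := by
    rwa [intervalIntegrable_iff_integrableOn_Ioc_of_le zero_le_one]
  have hlim : Tendsto F (𝓝[>] 0) (𝓝 (F 1 - ∫ r in (0 : ℝ)..1, F₁ r)) := by
    have hcont := intervalIntegral.continuousOn_primitive_interval' hI
      (left_mem_uIcc : (0 : ℝ) ∈ uIcc 0 1)
    have h3 : Tendsto (fun x => ∫ r in (0 : ℝ)..x, F₁ r) (𝓝[>] 0) (𝓝 0) := by
      have h4 := (hcont 0 left_mem_uIcc).tendsto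
      rw [intervalIntegral.integral_same] at h4
      refine h4.mono_left ?_
      rw [← nhdsWithin_Ioc_eq_nhdsGT (zero_lt_one' ℝ), uIcc_of_le zero_le_one]
      exact nhdsWithin_mono _ Ioc_subset_Icc_self
    have h5 : Tendsto (fun x => F 1 - ((∫ r in (0 : ℝ)..1, F₁ r) - ∫ r in (0 : ℝ)..x, F₁ r))
        (𝓝[>] 0) (𝓝 (F 1 - ((∫ r in (0 : ℝ)..1, F₁ r) - 0))) :=
      tendsto_const_nhds.sub (tendsto_const_nhds.sub h3)
    rw [sub_zero] at h5
    refine h5.congr' ?_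
    filter_upwards [Ioc_mem_nhdsGT (zero_lt_one' ℝ)] with x hx
    have h6 : IntervalIntegrable F₁ volume 0 x :=
      hI.mono_set (by rw [uIcc_of_le hx.1.le, uIcc_of_le zero_le_one]; exact Icc_subset_Icc_right hx.2)
    rw [intervalIntegral.integral_interval_sub_left hI h6, h.integral_eq hx.1 one_pos]
    ring
  set L := F 1 - ∫ r in (0 : ℝ)..1, F₁ r
  by_cases hL : L = 0
  · rwa [hL] at hlim
  exfalso
  have hL' : 0 < |L| := abs_pos.2 hL
  have hev := hlim.abs.eventually (lt_mem_nhds (half_lt_self hL'))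
  obtain ⟨ε, hε, hε'⟩ := mem_nhdsGT_iff_exists_Ioc_subset.1 hev
  have hε : (0 : ℝ) < ε := hε
  set δ := min ε 1
  have hδ : 0 < δ := lt_min hε one_pos
  have h7 : IntegrableOn (fun r : ℝ => r⁻¹) (Ioc 0 δ) := by
    refine Integrable.mono' (g := fun r => 2 / |L| * |F r / r|) ?_
      (measurable_inv.aestronglyMeasurable) ?_
    · exact ((h2.mono_set (Ioc_subset_Ioc_right (min_le_right _ _))).abs).const_mul _
    · filter_upwards [ae_restrict_mem measurableSet_Ioc] with r hr
      have h8 : |L| / 2 < |F r| := hε' ⟨hr.1, hr.2.trans (min_le_left _ _)⟩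
      rw [abs_div, abs_of_pos hr.1, Real.norm_of_nonneg (inv_nonneg.2 hr.1.le), ← mul_div_assoc,
        inv_eq_one_div]
      refine div_le_div_of_nonneg_right ?_ hr.1.le
      rw [div_mul_eq_mul_div, le_div_iff₀ hL']
      linarith
  have h9 : IntervalIntegrable (fun r : ℝ => r⁻¹) volume 0 δ := by
    rwa [intervalIntegrable_iff_integrableOn_Ioc_of_le hδ.le]
  rw [intervalIntegrable_inv_iff] at h9
  rcases h9 with h9 | h9
  · exact hδ.ne h9
  · exact h9 left_mem_uIcc

theorem HasACDeriv.tendsto_zero_atTop {F F₁ : ℝ → ℝ} (h : HasACDeriv F F₁)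
    (h1 : IntegrableOn F₁ (Ioi 1)) (h2 : IntegrableOn F (Ioi 1)) : Tendsto F atTop (𝓝 0) := by
  have hlim : Tendsto F atTop (𝓝 (F 1 + ∫ r in Ioi (1 : ℝ), F₁ r)) := by
    refine ((intervalIntegral_tendsto_integral_Ioi 1 h1 tendsto_id).const_add (F 1)).congr' ?_
    filter_upwards [eventually_gt_atTop 0] with x hx
    rw [id, h.integral_eq one_pos hx]
    ring
  set L := F 1 + ∫ r in Ioi (1 : ℝ), F₁ r
  by_cases hL : L = 0
  · rwa [hL] at hlim
  exfalso
  have hL' : 0 < |L| := abs_pos.2 hL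
  obtain ⟨R, hR⟩ := eventually_atTop.1 (hlim.abs.eventually (lt_mem_nhds (half_lt_self hL')))
  have h7 : IntegrableOn (fun _ : ℝ => |L| / 2) (Ioi (max R 1)) := by
    refine Integrable.mono' (g := fun r => |F r|)
      (h2.mono_set (Ioi_subset_Ioi (le_max_right _ _))).abs aestronglyMeasurable_const ?_
    filter_upwards [ae_restrict_mem measurableSet_Ioi] with r hr
    rw [Real.norm_of_nonneg (by positivity)]
    exact (hR r ((le_max_left _ _).trans (le_of_lt hr))).le
  rw [integrableOn_const_iff] at h7
  rcases h7 with h7 | h7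
  · rw [enorm_eq_zero] at h7
    linarith
  · simp at h7

theorem HasACDeriv.integral_Ioi_eq_zero {F F₁ : ℝ → ℝ} (h : HasACDeriv F F₁)
    (h1 : IntegrableOn F₁ (Ioi 0)) (h2 : IntegrableOn (fun r => F r / r) (Ioc 0 1))
    (h3 : IntegrableOn F (Ioi 1)) : ∫ r in Ioi (0 : ℝ), F₁ r = 0 := by
  have l0 := h.tendsto_zero_at_zero (h1.mono_set Ioc_subset_Ioi_self) h2
  have l1 := h.tendsto_zero_atTop (h1.mono_set (Ioi_subset_Ioi zero_le_one)) h3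
  have e1 : ∫ r in Ioi (1 : ℝ), F₁ r = - F 1 := by
    have := intervalIntegral_tendsto_integral_Ioi 1
      (h1.mono_set (Ioi_subset_Ioi zero_le_one)) tendsto_id
    refine tendsto_nhds_unique this ?_
    have h5 : Tendsto (fun x => F x - F 1) atTop (𝓝 (0 - F 1)) := l1.sub_const _
    rw [zero_sub] at h5
    refine h5.congr' ?_
    filter_upwards [eventually_gt_atTop 0] with x hx
    rw [id, h.integral_eq one_pos hx]
  have e0 : ∫ r in Ioc (0 : ℝ) 1, F₁ r = F 1 := by
    have hI : IntervalIntegrable F₁ volume 0 1 := by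
      rw [intervalIntegrable_iff_integrableOn_Ioc_of_le zero_le_one]
      exact h1.mono_set Ioc_subset_Ioi_self
    rw [← intervalIntegral.integral_of_le zero_le_one]
    have h5 : Tendsto (fun x => F 1 - F x) (𝓝[>] 0) (𝓝 (F 1 - 0)) := l0.const_sub _
    rw [sub_zero] at h5
    have hcont := intervalIntegral.continuousOn_primitive_interval' hI
      (right_mem_uIcc : (1 : ℝ) ∈ uIcc 0 1)
    have h4 : Tendsto (fun x => ∫ r in (1 : ℝ)..x, F₁ r) (𝓝[>] 0)
        (𝓝 (∫ r in (1 : ℝ)..0, F₁ r)) := by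
      refine ((hcont 0 left_mem_uIcc).tendsto).mono_left ?_
      rw [← nhdsWithin_Ioc_eq_nhdsGT (zero_lt_one' ℝ), uIcc_of_le zero_le_one]
      exact nhdsWithin_mono _ Ioc_subset_Icc_self
    have h6 : Tendsto (fun x => F 1 - F x) (𝓝[>] 0) (𝓝 (-∫ r in (1 : ℝ)..0, F₁ r)) := by
      refine h4.neg.congr' ?_
      filter_upwards [self_mem_nhdsWithin] with x hx
      rw [h.integral_eq one_pos hx]
      ring
    rw [intervalIntegral.integral_symm]
    exact tendsto_nhds_unique h6 h5
  rw [← Ioc_union_Ioi_eq_Ioi (zero_le_one' ℝ), setIntegral_union (Ioc_disjoint_Ioi le_rfl)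
    measurableSet_Ioi (h1.mono_set Ioc_subset_Ioi_self)
    (h1.mono_set (Ioi_subset_Ioi zero_le_one)), e0, e1]
  ring

/-! ### The energy identity and the pointwise bound -/

theorem MemL2r.integrableOn_mul {p q : ℝ → ℝ} (hp : MemL2r p) (hq : MemL2r q) :
    IntegrableOn (fun r => r * (p r * q r)) (Ioi 0) :=
  integrable_radialMeasure_iff.1 (MemLp.integrable_mul (p := 2) (q := 2) hp hq)

theorem MemL2r.congr {p q : ℝ → ℝ} (hp : MemL2r p)
    (h : ∀ᵐ r ∂volume.restrict (Ioi (0 : ℝ)), p r = q r) : MemL2r q :=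
  (memLp_congr_ae (ae_radialMeasure_iff.2 h)).1 hp

theorem MemL2r.congr_pos {p q : ℝ → ℝ} (hp : MemL2r p) (h : ∀ r, 0 < r → p r = q r) :
    MemL2r q :=
  hp.congr ((ae_restrict_mem measurableSet_Ioi).mono fun r hr => h r hr)

theorem hasACDeriv_id : HasACDeriv (fun r => r) (fun _ => 1) :=
  hasACDeriv_of_hasDerivAt (fun r _ => hasDerivAt_id r) continuousOn_const

theorem IsModeJet.memL2r_laplacian {m : ℤ} {u u₁ u₂ : ℝ → ℝ} (h : IsModeJet m u u₁ u₂) :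
    MemL2r (fun r => u₂ r + (1 / r) • u₁ r - ((m : ℝ) ^ 2 / r ^ 2) • u r) :=
  MemL2r.congr_pos (MemLp.add h.mem_hess_rr h.mem_hess_thetatheta) fun r _ => by
    simp only [Pi.add_apply]; ring

theorem IsModeJet.integral_laplacian_mul {m : ℤ} {u u₁ u₂ w w₁ w₂ : ℝ → ℝ}
    (hu : IsModeJet m u u₁ u₂) (hw : IsModeJet m w w₁ w₂) :
    ∫ r, (u₂ r + (1 / r) • u₁ r - ((m : ℝ) ^ 2 / r ^ 2) • u r) * w r ∂radialMeasure =
      -(∫ r, u₁ r * w₁ r ∂radialMeasure) -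
        ∫ r, (((m : ℝ) / r) • u r) * (((m : ℝ) / r) • w r) ∂radialMeasure := by
  obtain ⟨v₁, hv₁, euv⟩ := hu.weak_deriv_two.exists_hasACDeriv
  obtain ⟨z, hz, ewz⟩ := hw.weak_deriv.exists_hasACDeriv
  have i1 := hu.memL2r_laplacian.integrableOn_mul hw.mem_zero
  have i2 := hu.mem_grad_r.integrableOn_mul hw.mem_grad_r
  have i3 := hu.mem_grad_theta.integrableOn_mul hw.mem_grad_theta
  have hpos := ae_restrict_mem (μ := volume) (measurableSet_Ioi (a := (0 : ℝ)))
  -- The function integrated is `r u' w`; its derivative is `r` times `(Δ_m u) w + u' w' + m² u w /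
  -- r²`.
  have hF := ((hasACDeriv_id.mul hv₁).mul hz).congr
    (v := fun r => r * ((u₂ r + (1 / r) • u₁ r - ((m : ℝ) ^ 2 / r ^ 2) • u r) * w r) +
      r * (u₁ r * w₁ r) + r * ((((m : ℝ) / r) • u r) * (((m : ℝ) / r) • w r))) (by
    filter_upwards [euv, ewz, hpos] with r h1 h2 hr
    have hr : (0 : ℝ) < r := hr
    simp only [smul_eq_mul]
    rw [← h1, ← h2]
    field_simp
    ring)
  have hF₁ := (i1.add i2).add i3
  have h0 := hF.integral_Ioi_eq_zero hF₁ ?_ ?_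
  · have e1 := integral_add (i1.add i2) i3
    have e2 := integral_add i1 i2
    simp only [Pi.add_apply] at e1
    rw [e1, e2] at h0
    simp only [integral_radialMeasure]
    linarith
  -- Integrability of `u' w` near the origin has a different source in each case. For `m = 0` the
  -- angular Hessian component is `u'/r`; for `m ≠ 0` the function `w/r` is square integrable.
  · by_cases hm : m = 0
    · refine IntegrableOn.congr_fun_ae ((hu.mem_hess_thetatheta.integrableOn_mul
        hw.mem_zero).mono_set Ioc_subset_Ioi_self) ?_
      filter_upwards [ae_restrict_of_ae_restrict_of_subset Ioc_subset_Ioi_self euv,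
        ae_restrict_of_ae_restrict_of_subset Ioc_subset_Ioi_self ewz,
        ae_restrict_mem measurableSet_Ioc] with r h1 h2 hr
      have hr : (0 : ℝ) < r := hr.1
      simp only [smul_eq_mul, hm, Int.cast_zero]
      rw [← h1, ← h2]
      field_simp
      ring
    · have hm' : (m : ℝ) ≠ 0 := by exact_mod_cast hm
      refine IntegrableOn.congr_fun_ae (Integrable.const_mul ((hu.mem_grad_r.integrableOn_mul
        hw.mem_grad_theta).mono_set Ioc_subset_Ioi_self) ((m : ℝ)⁻¹)) ?_
      filter_upwards [ae_restrict_of_ae_restrict_of_subset Ioc_subset_Ioi_self euv,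
        ae_restrict_of_ae_restrict_of_subset Ioc_subset_Ioi_self ewz,
        ae_restrict_mem measurableSet_Ioc] with r h1 h2 hr
      have hr : (0 : ℝ) < r := hr.1
      simp only [smul_eq_mul]
      rw [← h1, ← h2]
      field_simp
  · refine ((hu.mem_grad_r.integrableOn_mul hw.mem_zero).mono_set
      (Ioi_subset_Ioi zero_le_one)).congr_fun_ae ?_
    filter_upwards [ae_restrict_of_ae_restrict_of_subset (Ioi_subset_Ioi zero_le_one) euv,
        ae_restrict_of_ae_restrict_of_subset (Ioi_subset_Ioi zero_le_one) ewz] with r h1 h2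
    rw [← h1, ← h2]
    ring

theorem IsModeLaplacian.memL2r {m : ℤ} {u g : ℝ → ℝ} (h : IsModeLaplacian m u g) : MemL2r g := by
  obtain ⟨u₁, u₂, hj, hg⟩ := h
  exact hj.memL2r_laplacian.congr (by
    filter_upwards [ae_radialMeasure_iff.1 hg] with r hr using hr.symm)

theorem IsModeLaplacian.symmetric {m : ℤ} {u g w h : ℝ → ℝ} (hu : IsModeLaplacian m u g)
    (hw : IsModeLaplacian m w h) :
    ∫ r, g r * w r ∂radialMeasure = ∫ r, u r * h r ∂radialMeasure := by
  obtain ⟨u₁, u₂, hj, hg⟩ := hu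
  obtain ⟨w₁, w₂, hk, hh⟩ := hw
  have e1 := hj.integral_laplacian_mul hk
  have e2 := hk.integral_laplacian_mul hj
  have e3 : ∫ r, g r * w r ∂radialMeasure =
      ∫ r, (u₂ r + (1 / r) • u₁ r - ((m : ℝ) ^ 2 / r ^ 2) • u r) * w r ∂radialMeasure :=
    integral_congr_ae (by filter_upwards [hg] with r hr; rw [hr])
  have e4 : ∫ r, u r * h r ∂radialMeasure =
      ∫ r, (w₂ r + (1 / r) • w₁ r - ((m : ℝ) ^ 2 / r ^ 2) • w r) * u r ∂radialMeasure :=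
    integral_congr_ae (by filter_upwards [hh] with r hr; rw [hr, mul_comm])
  rw [e3, e4, e1, e2]
  simp only [mul_comm]

/-- Integrate `(u²)' = 2 u u' ≤ r u'² + u²/r` from the origin, where `u²` tends to zero; `m² ≥ 1`
bounds `u²/r` by `r (m u/r)²`. -/
theorem HasWeakDeriv.sq_le {m : ℤ} (hm : m ≠ 0) {u u₁ : ℝ → ℝ} (h : HasWeakDeriv u u₁)
    (h1 : MemL2r u₁) (h2 : MemL2r fun r => ((m : ℝ) / r) • u r) :
    ∀ᵐ r ∂radialMeasure, u r ^ 2 ≤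
      (∫ r, u₁ r ^ 2 ∂radialMeasure) + ∫ r, (((m : ℝ) / r) • u r) ^ 2 ∂radialMeasure := by
  obtain ⟨v, hv, huv⟩ := h.exists_hasACDeriv
  have hm1 : (1 : ℝ) ≤ (m : ℝ) ^ 2 := by
    have : 1 ≤ m ^ 2 := by have := sq_nonneg m; have := pow_ne_zero 2 hm; lia
    exact_mod_cast this
  have hm' : (m : ℝ) ≠ 0 := by exact_mod_cast hm
  have hpos := ae_restrict_mem (μ := volume) (measurableSet_Ioi (a := (0 : ℝ)))
  have i1 := (memL2r_iff.1 h1).2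
  have i2 := (memL2r_iff.1 h2).2
  have i3 : IntegrableOn (fun r => u₁ r * v r + v r * u₁ r) (Ioi 0) := by
    refine IntegrableOn.congr_fun_ae ((h1.integrableOn_mul h2).const_mul (2 * (m : ℝ)⁻¹)) ?_
    filter_upwards [huv, hpos] with r hr h0
    have h0 : (0 : ℝ) < r := h0
    simp only [smul_eq_mul]
    rw [← hr]
    field_simp
    ring
  have hF := hv.mul hv
  have hlim := hF.tendsto_zero_at_zero (i3.mono_set Ioc_subset_Ioi_self) (by
    refine IntegrableOn.congr_fun_ae (Integrable.const_mul (i2.mono_set Ioc_subset_Ioi_self)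
      (((m : ℝ) ^ 2)⁻¹)) ?_
    filter_upwards [ae_restrict_of_ae_restrict_of_subset Ioc_subset_Ioi_self huv,
      ae_restrict_mem measurableSet_Ioc] with r hr h0
    have h0 : (0 : ℝ) < r := h0.1
    simp only [smul_eq_mul]
    rw [← hr]
    field_simp)
  rw [ae_radialMeasure_iff]
  simp only [integral_radialMeasure]
  rw [← integral_add i1 i2]
  set B := ∫ r in Ioi (0 : ℝ), r * u₁ r ^ 2 + r * (((m : ℝ) / r) • u r) ^ 2 with hB
  filter_upwards [huv, hpos] with r hr h0
  have h0 : (0 : ℝ) < r := h0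
  have key : ∀ x, 0 < x → x < r → v r * v r - v x * v x ≤ B := by
    intro x hx hxr
    rw [← hF.integral_eq hx h0, intervalIntegral.integral_of_le hxr.le, hB]
    have hsub : Ioc x r ⊆ Ioi 0 := fun y hy => hx.trans hy.1
    refine (setIntegral_mono_ae_restrict (i3.mono_set hsub) ((i1.add i2).mono_set hsub) ?_).trans
      (setIntegral_mono_set (i1.add i2) ?_ hsub.eventuallyLE)
    · filter_upwards [ae_restrict_of_ae_restrict_of_subset hsub huv,
        ae_restrict_mem measurableSet_Ioc] with y hy hy0
      have hy0 : 0 < y := hsub hy0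
      simp only [Pi.add_apply, smul_eq_mul]
      rw [← hy]
      have e1 : y * ((m : ℝ) / y * u y) ^ 2 = (m : ℝ) ^ 2 * (u y ^ 2 / y) := by field_simp
      have e2 : 0 ≤ u y ^ 2 / y := by positivity
      have e3 : 0 ≤ y * (u₁ y - u y / y) ^ 2 := by positivity
      have e4 : y * (u₁ y - u y / y) ^ 2 = y * u₁ y ^ 2 - 2 * (u₁ y * u y) + u y ^ 2 / y := by
        field_simp
        ring
      rw [e1]
      nlinarith
    · filter_upwards [hpos] with y hy
      have hy : 0 < y := hy
      simp only [Pi.zero_apply, Pi.add_apply]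
      positivity
  have h5 : Tendsto (fun x => v r * v r - v x * v x) (𝓝[>] 0) (𝓝 (v r * v r - 0)) :=
    hlim.const_sub _
  rw [hr]
  have := le_of_tendsto h5 (b := B) (by
    filter_upwards [Ioo_mem_nhdsGT h0] with x hx using key x hx.1 hx.2)
  linarith [sq (v r)]

/-! ### First order equations with harmonic coefficients -/

theorem integrableOn_Ioi_of_intervalIntegral_bounded {Q : ℝ → ℝ} {C X : ℝ}
    (hQ : ∀ x y : ℝ, 0 < x → 0 < y → IntervalIntegrable Q volume x y)
    (h0 : ∀ᵐ r ∂volume.restrict (Ioi (0 : ℝ)), 0 ≤ Q r)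
    (hC : ∀ x y : ℝ, 0 < x → x ≤ 1 → 1 ≤ y → X ≤ y → ∫ r in x..y, Q r ≤ C) :
    IntegrableOn Q (Ioi 0) := by
  have hn : ∀ n : ℕ, (0 : ℝ) < 1 / ((n : ℝ) + 1) := fun n => by positivity
  have hn1 : ∀ n : ℕ, 1 / ((n : ℝ) + 1) ≤ 1 := fun n => by
    rw [div_le_one (by positivity)]; linarith [n.cast_nonneg (α := ℝ)]
  have hn2 : ∀ n : ℕ, (1 : ℝ) ≤ (n : ℝ) + 1 := fun n => by linarith [n.cast_nonneg (α := ℝ)]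
  have hcov : AECover (volume.restrict (Ioi (0 : ℝ))) atTop
      (fun n : ℕ => Ioc (1 / ((n : ℝ) + 1)) ((n : ℝ) + 1)) := by
    refine ⟨?_, fun n => measurableSet_Ioc⟩
    filter_upwards [ae_restrict_mem measurableSet_Ioi] with r hr
    have hr : 0 < r := hr
    obtain ⟨N, hN⟩ := exists_nat_ge (max r (1 / r))
    filter_upwards [eventually_ge_atTop N] with n hNn
    have hNn : (N : ℝ) ≤ n := by exact_mod_cast hNn
    have h1 : r ≤ n := ((le_max_left _ _).trans hN).trans hNn
    have h2 : 1 / r ≤ n := ((le_max_right _ _).trans hN).trans hNn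
    refine ⟨?_, by linarith⟩
    rw [div_lt_iff₀ (by positivity)]
    rw [div_le_iff₀ hr] at h2
    nlinarith
  refine hcov.integrable_of_integral_bounded_of_nonneg_ae C (fun n => ?_) h0 ?_
  · have h1 := hQ _ _ (hn n) (zero_lt_one.trans_le (hn2 n))
    rw [intervalIntegrable_iff_integrableOn_Ioc_of_le ((hn1 n).trans (hn2 n))] at h1
    exact h1.restrict
  · obtain ⟨N, hN⟩ := exists_nat_ge X
    filter_upwards [eventually_ge_atTop N] with n hNn
    have hNn : (N : ℝ) ≤ n := by exact_mod_cast hNn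
    have h2 := hC _ _ (hn n) (hn1 n) (hn2 n) (by linarith)
    rw [intervalIntegral.integral_of_le ((hn1 n).trans (hn2 n))] at h2
    rwa [Measure.restrict_restrict measurableSet_Ioc, inter_eq_left.2]
    exact fun r hr => (hn n).trans hr.1

theorem MemL2r.intervalIntegrable {g : ℝ → ℝ} (hg : MemL2r g) {x y : ℝ} (hx : 0 < x)
    (hy : 0 < y) : IntervalIntegrable (fun r => r * g r ^ 2) volume x y := by
  rw [intervalIntegrable_iff]
  exact (memL2r_iff.1 hg).2.mono_set (uIoc_subset_uIcc.trans (uIcc_subset_Ioi hx hy))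

theorem memL2r_of_le {f Q : ℝ → ℝ} (hf : AEStronglyMeasurable f (volume.restrict (Ioi (0 : ℝ))))
    (hQ : IntegrableOn Q (Ioi 0))
    (h : ∀ᵐ r ∂volume.restrict (Ioi (0 : ℝ)), r * f r ^ 2 ≤ Q r) : MemL2r f := by
  rw [memL2r_iff]
  refine ⟨hf, Integrable.mono' hQ (measurable_id.aestronglyMeasurable.mul (hf.pow 2)) ?_⟩
  filter_upwards [h, ae_restrict_mem measurableSet_Ioi] with r hr hr0
  have hr0 : 0 < r := hr0
  rw [Real.norm_of_nonneg (by positivity)]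
  exact hr

theorem HasACDeriv.exists_bound {y y₁ : ℝ → ℝ} (hy : HasACDeriv y y₁)
    (h0 : ∃ M, ∀ r, 0 < r → r ≤ 1 → |y r| ≤ M) (X : ℝ) :
    ∃ M, 0 ≤ M ∧ ∀ r, 0 < r → r ≤ X → |y r| ≤ M := by
  obtain ⟨M, hM⟩ := h0
  obtain ⟨N, hN⟩ := isCompact_Icc.exists_bound_of_continuousOn
    (hy.continuousOn.mono (show Icc 1 X ⊆ Ioi 0 from fun z hz => zero_lt_one.trans_le hz.1))
  have hM0 : 0 ≤ M := (abs_nonneg _).trans (hM 1 one_pos le_rfl)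
  refine ⟨max M N, le_max_of_le_left hM0, fun r hr hrX => ?_⟩
  rcases le_total r 1 with h | h
  · exact (hM r hr h).trans (le_max_left _ _)
  · exact (hN r ⟨h, hrX⟩).trans (le_max_right _ _)

/-- Square the equation and multiply by `r`. The cross term is the exact derivative of `b = (σ r² +
κ) y²` up to a multiple of `r y²`, which leaves `Q = r g² - b' - 2σ(κ - 1) r y²` with `Q = r y'² +
(r³ + κ²/r) y²`. For large `r` the last term is absorbed by `r³ y²`; for bounded `r` it is
controlled by the bound on `y`. The boundary term at infinity has a good sign when `σ = 1`; when `σ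
= -1` it needs `r y` bounded, hence `hinf`. -/
theorem memL2r_of_first_order {y y₁ g : ℝ → ℝ} {σ κ : ℝ} (hσ : σ = 1 ∨ σ = -1)
    (hy : HasACDeriv y y₁) (hg : MemL2r g)
    (heq : ∀ᵐ r ∂volume.restrict (Ioi (0 : ℝ)), y₁ r + (σ * r + κ / r) * y r = g r)
    (h0 : ∃ M, ∀ r, 0 < r → r ≤ 1 → |y r| ≤ M)
    (hinf : σ = 1 ∨ ∃ M, ∀ r, 1 ≤ r → |r * y r| ≤ M) :
    MemL2r y₁ ∧ MemL2r (fun r => r * y r) ∧ MemL2r (fun r => κ / r * y r) ∧ MemL2r y := by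
  have hσ2 : σ ^ 2 = 1 := by rcases hσ with rfl | rfl <;> norm_num
  have hσa : |σ| = 1 := by rcases hσ with rfl | rfl <;> norm_num
  set K := 2 * |κ - 1| with hK
  have hK0 : 0 ≤ K := by positivity
  -- Beyond `X` one has `2K ≤ r²`, so `K r y²` is at most half of `r³ y²`.
  set X := 1 + 2 * K with hX
  obtain ⟨M, hM0, hM⟩ := hy.exists_bound h0 X
  have hpos := ae_restrict_mem (μ := volume) (measurableSet_Ioi (a := (0 : ℝ)))
  set Q : ℝ → ℝ := fun r => r * y₁ r ^ 2 + (r ^ 3 + κ ^ 2 / r) * y r ^ 2 with hQdef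
  set P : ℝ → ℝ := fun r => r * g r ^ 2 with hP
  have hpoly : HasACDeriv (fun r => σ * r ^ 2 + κ) (fun r => σ * (2 * r)) := by
    refine hasACDeriv_of_hasDerivAt (fun r _ => ?_) (by fun_prop)
    simpa using ((hasDerivAt_pow 2 r).const_mul σ).add_const κ
  have hb := hpoly.mul (hy.mul hy)
  set b₁ : ℝ → ℝ := fun r => σ * (2 * r) * (y r * y r) +
    (σ * r ^ 2 + κ) * (y₁ r * y r + y r * y₁ r) with hb₁
  have hQeq : ∀ᵐ r ∂volume.restrict (Ioi (0 : ℝ)),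
      Q r = P r - b₁ r - 2 * σ * (κ - 1) * (r * y r ^ 2) := by
    filter_upwards [heq, hpos] with r hr hr0
    have hr0 : 0 < r := hr0
    simp only [hQdef, hP, hb₁]
    rw [← hr]
    field_simp
    linear_combination (- r ^ 4 * y r ^ 2) * hσ2
  have hQ0 : ∀ᵐ r ∂volume.restrict (Ioi (0 : ℝ)), 0 ≤ Q r := by
    filter_upwards [hpos] with r hr0
    have hr0 : 0 < r := hr0
    simp only [hQdef]
    positivity
  have hQle : ∀ᵐ r ∂volume.restrict (Ioi (0 : ℝ)),
      Q r ≤ 2 * P r - 2 * b₁ r + (Ioc 0 X).indicator (fun _ => 2 * K * X * M ^ 2) r := by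
    filter_upwards [hQeq, hpos] with r hr hr0
    have hr0 : 0 < r := hr0
    have h1 : -(2 * σ * (κ - 1) * (r * y r ^ 2)) ≤ K * (r * y r ^ 2) := by
      have h2 : |2 * σ * (κ - 1)| = K := by rw [abs_mul, abs_mul, hσa]; simp [hK]
      have h3 := neg_abs_le (2 * σ * (κ - 1))
      rw [h2] at h3
      have : 0 ≤ r * y r ^ 2 := by positivity
      nlinarith
    have h4 : r ^ 3 * y r ^ 2 ≤ Q r := by
      simp only [hQdef]
      have : 0 ≤ r * y₁ r ^ 2 := by positivity
      have : 0 ≤ κ ^ 2 / r * y r ^ 2 := by positivity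
      nlinarith
    have h5 : K * (r * y r ^ 2) ≤ Q r / 2 + (Ioc 0 X).indicator (fun _ => K * X * M ^ 2) r := by
      by_cases hrX : r ≤ X
      · rw [indicator_of_mem (show r ∈ Ioc 0 X from ⟨hr0, hrX⟩)]
        have h6 : y r ^ 2 ≤ M ^ 2 := sq_le_sq.2 (by rw [abs_of_nonneg hM0]; exact hM r hr0 hrX)
        have h7 : r * y r ^ 2 ≤ X * M ^ 2 := by gcongr
        have h8 : 0 ≤ r ^ 3 * y r ^ 2 := by positivity
        nlinarith
      · rw [indicator_of_notMem (fun h => hrX h.2), add_zero]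
        have h6 : 2 * K ≤ r ^ 2 := by nlinarith
        have h7 : 0 ≤ r * y r ^ 2 := by positivity
        nlinarith
    have h6 : (Ioc 0 X).indicator (fun _ => 2 * K * X * M ^ 2) r =
        2 * (Ioc 0 X).indicator (fun _ => K * X * M ^ 2) r := by
      by_cases h : r ∈ Ioc 0 X <;> simp [h]; ring
    rw [h6]
    linarith
  have hloc : ∀ x z : ℝ, 0 < x → 0 < z → IntervalIntegrable Q volume x z := by
    intro x z hx hz
    have h1 : ContinuousOn (fun r => 2 * σ * (κ - 1) * (r * y r ^ 2)) (Ioi 0) :=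
      continuousOn_const.mul (continuousOn_id.mul (hy.continuousOn.pow 2))
    refine (((hg.intervalIntegrable hx hz).sub (hb.intervalIntegrable hx hz)).sub
      (h1.mono (uIcc_subset_Ioi hx hz)).intervalIntegrable).congr_ae ?_
    filter_upwards [ae_restrict_of_ae_restrict_of_subset
      (uIoc_subset_uIcc.trans (uIcc_subset_Ioi hx hz)) hQeq] with r hr
    exact hr.symm
  have hbinf : ∃ N, ∀ r, 1 ≤ r → 1 + |κ| ≤ r → -((σ * r ^ 2 + κ) * (y r * y r)) ≤ N := by
    rcases hinf with rfl | ⟨N, hN⟩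
    · refine ⟨0, fun r hr1 hr2 => ?_⟩
      have h1 : 0 ≤ 1 * r ^ 2 + κ := by
        have := neg_abs_le κ
        nlinarith
      have := mul_nonneg h1 (mul_self_nonneg (y r))
      linarith
    · refine ⟨(1 + |κ|) * N ^ 2, fun r hr1 hr2 => ?_⟩
      have h1 : (r * y r) ^ 2 ≤ N ^ 2 := sq_le_sq.2 ((hN r hr1).trans (le_abs_self N))
      have h2 : -(σ * r ^ 2 + κ) ≤ (1 + |κ|) * r ^ 2 := by
        have h3 := neg_abs_le κ
        have h4 : -σ ≤ 1 := by rcases hσ with rfl | rfl <;> norm_num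
        have h5 : 0 ≤ |κ| := abs_nonneg κ
        have h6 : 1 ≤ r ^ 2 := by nlinarith
        nlinarith
      calc -((σ * r ^ 2 + κ) * (y r * y r)) = -(σ * r ^ 2 + κ) * (y r) ^ 2 := by ring
        _ ≤ (1 + |κ|) * r ^ 2 * (y r) ^ 2 := by gcongr
        _ = (1 + |κ|) * (r * y r) ^ 2 := by ring
        _ ≤ (1 + |κ|) * N ^ 2 := by gcongr
  obtain ⟨N, hN⟩ := hbinf
  have hPint := (memL2r_iff.1 hg).2
  have hind : IntegrableOn ((Ioc 0 X).indicator (fun _ => 2 * K * X * M ^ 2)) (Ioi (0 : ℝ)) := by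
    refine Integrable.integrableOn ?_
    rw [integrable_indicator_iff measurableSet_Ioc]
    exact integrableOn_const (by simp)
  have hQi : IntegrableOn Q (Ioi 0) := by
    refine integrableOn_Ioi_of_intervalIntegral_bounded (X := 1 + |κ|)
      (C := 2 * (∫ r in Ioi (0 : ℝ), P r) + (2 * ((1 + |κ|) * M ^ 2) + 2 * N) +
        ∫ r in Ioi (0 : ℝ), (Ioc 0 X).indicator (fun _ => 2 * K * X * M ^ 2) r) hloc hQ0 ?_
    intro x z hx hx1 hz1 hz2
    have hz : 0 < z := by linarith
    have hxz : x ≤ z := hx1.trans hz1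
    have hsub : Ioc x z ⊆ Ioi 0 := fun r hr => hx.trans hr.1
    have hiP := (hg.intervalIntegrable hx hz).const_mul 2
    have hib := (hb.intervalIntegrable hx hz).const_mul 2
    have hii : IntervalIntegrable ((Ioc 0 X).indicator (fun _ => 2 * K * X * M ^ 2)) volume x z := by
      rw [intervalIntegrable_iff_integrableOn_Ioc_of_le hxz]
      exact hind.mono_set hsub
    have h1 : ∫ r in x..z, Q r ≤ ∫ r in x..z, (2 * P r - 2 * b₁ r +
        (Ioc 0 X).indicator (fun _ => 2 * K * X * M ^ 2) r) := by
      refine intervalIntegral.integral_mono_ae_restrict hxz (hloc x z hx hz) ((hiP.sub hib).add hii) ?_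
      exact ae_restrict_of_ae_restrict_of_subset (fun r hr => hx.trans_le hr.1) hQle
    rw [intervalIntegral.integral_add (hiP.sub hib) hii, intervalIntegral.integral_sub hiP hib,
      intervalIntegral.integral_const_mul, intervalIntegral.integral_const_mul,
      hb.integral_eq hx hz] at h1
    have h2 : ∫ r in x..z, P r ≤ ∫ r in Ioi (0 : ℝ), P r := by
      rw [intervalIntegral.integral_of_le hxz]
      refine setIntegral_mono_set hPint ?_ hsub.eventuallyLE
      filter_upwards [hpos] with r hr
      have hr : 0 < r := hr
      simp only [hP, Pi.zero_apply]
      positivity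
    have h3 : ∫ r in x..z, (Ioc 0 X).indicator (fun _ => 2 * K * X * M ^ 2) r ≤
        ∫ r in Ioi (0 : ℝ), (Ioc 0 X).indicator (fun _ => 2 * K * X * M ^ 2) r := by
      rw [intervalIntegral.integral_of_le hxz]
      refine setIntegral_mono_set hind (ae_of_all _ fun r => ?_) hsub.eventuallyLE
      exact indicator_nonneg (fun _ _ => by positivity) r
    have h4 := hN z hz1 hz2
    have h5 : (σ * x ^ 2 + κ) * (y x * y x) ≤ (1 + |κ|) * M ^ 2 := by
      have h6 : y x ^ 2 ≤ M ^ 2 :=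
        sq_le_sq.2 (by rw [abs_of_nonneg hM0]; exact hM x hx (by linarith))
      have h7 : σ * x ^ 2 + κ ≤ 1 + |κ| := by
        have h8 := le_abs_self κ
        have h9 : x ^ 2 ≤ 1 := by nlinarith
        rcases hσ with rfl | rfl <;> nlinarith [sq_nonneg x]
      calc (σ * x ^ 2 + κ) * (y x * y x) = (σ * x ^ 2 + κ) * y x ^ 2 := by ring
        _ ≤ (1 + |κ|) * y x ^ 2 := by gcongr
        _ ≤ (1 + |κ|) * M ^ 2 := by gcongr
    linarith
  have hym := hy.aestronglyMeasurable
  have hy₁m : AEStronglyMeasurable y₁ (volume.restrict (Ioi (0 : ℝ))) := by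
    have h1 : AEStronglyMeasurable (fun r => g r - (σ * r + κ / r) * y r)
        (volume.restrict (Ioi (0 : ℝ))) := by
      refine (memL2r_iff.1 hg).1.sub (AEStronglyMeasurable.mul ?_ hym)
      exact Measurable.aestronglyMeasurable (by fun_prop)
    refine h1.congr ?_
    filter_upwards [heq] with r hr
    linarith
  refine ⟨memL2r_of_le hy₁m hQi ?_, memL2r_of_le ?_ hQi ?_, memL2r_of_le ?_ hQi ?_,
    memL2r_of_le hym (hQi.add (Integrable.integrableOn
      (f := (Ioc 0 X).indicator (fun _ => X * M ^ 2)) ?_)) ?_⟩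
  · filter_upwards [hpos] with r hr
    have hr : 0 < r := hr
    simp only [hQdef]
    have : 0 ≤ (r ^ 3 + κ ^ 2 / r) * y r ^ 2 := by positivity
    linarith
  · exact measurable_id.aestronglyMeasurable.mul hym
  · filter_upwards [hpos] with r hr
    have hr : 0 < r := hr
    simp only [hQdef]
    have h1 : 0 ≤ κ ^ 2 / r * y r ^ 2 := by positivity
    have h2 : 0 ≤ r * y₁ r ^ 2 := by positivity
    nlinarith
  · exact (Measurable.aestronglyMeasurable (by fun_prop)).mul hym
  · filter_upwards [hpos] with r hr
    have hr : 0 < r := hr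
    simp only [hQdef]
    have h1 : r * (κ / r * y r) ^ 2 = κ ^ 2 / r * y r ^ 2 := by field_simp
    have h2 : 0 ≤ r * y₁ r ^ 2 := by positivity
    have h3 : 0 ≤ r ^ 3 * y r ^ 2 := by positivity
    rw [h1]
    nlinarith
  · rw [integrable_indicator_iff measurableSet_Ioc]
    exact integrableOn_const (by simp)
  · filter_upwards [hpos, hQ0] with r hr hq
    have hr : 0 < r := hr
    simp only [Pi.add_apply]
    by_cases hrX : r ≤ X
    · rw [indicator_of_mem (show r ∈ Ioc 0 X from ⟨hr, hrX⟩)]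
      have h6 : y r ^ 2 ≤ M ^ 2 := sq_le_sq.2 (by rw [abs_of_nonneg hM0]; exact hM r hr hrX)
      have h7 : r * y r ^ 2 ≤ X * M ^ 2 := by gcongr
      linarith
    · rw [indicator_of_notMem (fun h => hrX h.2), add_zero]
      simp only [hQdef]
      have h1 : 0 ≤ κ ^ 2 / r * y r ^ 2 := by positivity
      have h2 : 0 ≤ r * y₁ r ^ 2 := by positivity
      have h3 : 1 ≤ r ^ 2 := by nlinarith
      have h4 : 0 ≤ r * y r ^ 2 := by positivity
      nlinarith

/-! ### Modes generated by a first order equation -/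

/-- If `u` solves `u' = (n/r - r) u + v`, then `r u` and `u/r` solve equations of the same type with
`n` replaced by `n + 1` and `n - 1` and data `r v` and `v/r`. Applying the first order estimate to
all three yields every weighted norm in the definition of the mode space. -/
theorem isModeJet_of_first_order {n : ℕ} {m : ℤ} (hm : m.natAbs = n) {u v v₁ : ℝ → ℝ}
    (hu : HasACDeriv u (fun r => ((n : ℝ) / r - r) * u r + v r)) (hv : HasACDeriv v v₁)
    (mv : MemL2r v) (mv₁ : MemL2r v₁) (mvdiv : MemL2r fun r => v r / r)
    (mvmul : MemL2r fun r => r * v r) (h0 : ∃ M, ∀ r, 0 < r → r ≤ 1 → |u r| ≤ M)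
    (h1 : 2 ≤ n → ∃ M, ∀ r, 0 < r → r ≤ 1 → |u r / r| ≤ M) :
    IsModeJet m u (fun r => ((n : ℝ) / r - r) * u r + v r)
      (fun r => (-(n : ℝ) / r ^ 2 - 1) * u r +
        ((n : ℝ) / r - r) * (((n : ℝ) / r - r) * u r + v r) + v₁ r) := by
  set u₁ : ℝ → ℝ := fun r => ((n : ℝ) / r - r) * u r + v r with hu₁
  have hinv : HasACDeriv (fun r : ℝ => r⁻¹) (fun r => -(r ^ 2)⁻¹) :=
    hasACDeriv_of_hasDerivAt (fun r hr => hasDerivAt_inv hr.ne')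
      (ContinuousOn.neg (ContinuousOn.inv₀ (by fun_prop) fun r hr => (pow_pos (mem_Ioi.1 hr) 2).ne'))
  have hcoef : HasACDeriv (fun r : ℝ => (n : ℝ) / r - r) (fun r => -(n : ℝ) / r ^ 2 - 1) := by
    have := (hinv.const_mul n).add (hasACDeriv_id.const_mul (-1))
    convert this using 2 <;> ring
  have hu₁' : HasACDeriv u₁ (fun r => (-(n : ℝ) / r ^ 2 - 1) * u r +
      ((n : ℝ) / r - r) * u₁ r + v₁ r) := (hcoef.mul hu).add hv
  obtain ⟨mu₁, mru, mnu, mu⟩ := memL2r_of_first_order (σ := 1) (κ := -n) (Or.inl rfl) hu mv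
    (ae_of_all _ fun r => by simp only [hu₁]; ring) h0 (Or.inl rfl)
  have hru := hasACDeriv_id.mul hu
  obtain ⟨mru₁, mrru, -, -⟩ := memL2r_of_first_order (σ := 1) (κ := -(n + 1)) (Or.inl rfl) hru mvmul
    ((ae_restrict_mem measurableSet_Ioi).mono fun r hr => by
      have hr : 0 < r := hr
      simp only [hu₁]; field_simp; ring) (by
      obtain ⟨M, hM⟩ := h0
      refine ⟨M, fun r hr hr1 => ?_⟩
      rw [abs_mul, abs_of_pos hr]
      have := hM r hr hr1
      nlinarith [abs_nonneg (u r)]) (Or.inl rfl)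
  -- Substituting the equation, the Hessian components are combinations of `v/r - u` and `n(n-1)
  -- u/r²` (and, for the radial one, of `u`, `r u'` and `v'`). The singular `u/r²` carries the
  -- factor `n(n-1)`, so it matters only for `n ≥ 2`.
  have mS : MemL2r (fun r => v r / r - u r) := MemLp.sub mvdiv mu
  have mT : MemL2r (fun r => (n : ℝ) * (n - 1) / r ^ 2 * u r) := by
    rcases Nat.lt_or_ge n 2 with hn | hn
    · have : (n : ℝ) * (n - 1) = 0 := by interval_cases n <;> norm_num
      simp only [this, zero_div, zero_mul]
      exact MemLp.zero'
    · have hdu := hinv.mul hu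
      obtain ⟨-, -, h3, -⟩ := memL2r_of_first_order (σ := 1) (κ := -(n - 1)) (Or.inl rfl) hdu mvdiv
        ((ae_restrict_mem measurableSet_Ioi).mono fun r hr => by
          have hr : 0 < r := hr
          simp only [hu₁]; field_simp; ring) (by
          obtain ⟨M, hM⟩ := h1 hn
          refine ⟨M, fun r hr hr1 => ?_⟩
          have := hM r hr hr1
          rwa [div_eq_inv_mul] at this) (Or.inl rfl)
      exact MemL2r.congr_pos (MemLp.const_mul h3 (-(n : ℝ))) fun r hr => by
        field_simp
  have mm : (m : ℝ) = n ∨ (m : ℝ) = -n := by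
    rcases Int.natAbs_eq m with h | h
    · left; rw [h, hm]; simp
    · right; rw [h, hm]; simp
  have mm2 : (m : ℝ) ^ 2 = (n : ℝ) ^ 2 := by rcases mm with h | h <;> rw [h]; ring
  have mTS : MemL2r (fun r => (n : ℝ) * (v r / r - u r) + (n : ℝ) * (n - 1) / r ^ 2 * u r) :=
    MemLp.add (MemLp.const_mul mS (n : ℝ)) mT
  refine ⟨hu.hasWeakDeriv, hu₁'.hasWeakDeriv, mu, mu₁, ?_, ?_, ?_, ?_, ?_⟩
  · rcases mm with h | h
    · exact MemL2r.congr_pos (MemLp.neg mnu) fun r hr => by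
        simp only [Pi.neg_apply, h, smul_eq_mul]; ring
    · exact mnu.congr_pos fun r hr => by simp only [h, smul_eq_mul]
  · have mr : MemL2r fun r => (u r + r * u₁ r) - u r :=
      MemLp.sub (mru₁.congr_pos (q := fun r => u r + r * u₁ r) fun r hr => by simp only [one_mul]) mu
    exact MemL2r.congr_pos (MemLp.add (MemLp.sub (MemLp.sub mTS mu) mr) mv₁) fun r hr => by
      simp only [Pi.add_apply, Pi.sub_apply, hu₁]
      field_simp
      ring
  · rcases mm with h | h
    · exact mTS.congr_pos fun r hr => by
        simp only [h, smul_eq_mul, hu₁]; field_simp; ring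
    · exact MemL2r.congr_pos (MemLp.neg mTS) fun r hr => by
        simp only [Pi.neg_apply, h, smul_eq_mul, hu₁]; field_simp; ring
  · exact MemL2r.congr_pos (MemLp.sub mS mT) fun r hr => by
      simp only [Pi.sub_apply, mm2, smul_eq_mul, hu₁]; field_simp; ring
  · exact mrru.congr_pos fun r hr => by simp only [smul_eq_mul]; ring

/-! ### The ground modes -/

theorem groundMode_pos (n : ℕ) {r : ℝ} (hr : 0 < r) : 0 < groundMode n r := by
  unfold groundMode
  have : (0 : ℝ) < n.factorial := by positivity
  positivity

theorem continuous_groundMode (n : ℕ) : Continuous (groundMode n) := by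
  unfold groundMode
  fun_prop

theorem groundMode_const_pos (n : ℕ) : (0 : ℝ) < √2 / √(n.factorial : ℝ) := by
  have : (0 : ℝ) < n.factorial := by positivity
  positivity

theorem groundMode_le (n : ℕ) {r : ℝ} (hr : 0 ≤ r) :
    groundMode n r ≤ √2 / √(n.factorial : ℝ) * r ^ n := by
  unfold groundMode
  have h := groundMode_const_pos n
  have : Real.exp (-r ^ 2 / 2) ≤ 1 := Real.exp_le_one_iff.2 (by nlinarith)
  exact mul_le_of_le_one_right (by positivity) this

theorem le_groundMode (n : ℕ) {r : ℝ} (hr : 0 ≤ r) (hr1 : r ≤ 1) :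
    √2 / √(n.factorial : ℝ) * Real.exp (-1) * r ^ n ≤ groundMode n r := by
  unfold groundMode
  have h := groundMode_const_pos n
  have : Real.exp (-1) ≤ Real.exp (-r ^ 2 / 2) := Real.exp_le_exp.2 (by nlinarith)
  rw [mul_right_comm]
  gcongr

theorem hasDerivAt_groundMode (n : ℕ) {r : ℝ} (hr : 0 < r) :
    HasDerivAt (groundMode n) (((n : ℝ) / r - r) * groundMode n r) r := by
  have h1 : HasDerivAt (fun r : ℝ => -r ^ 2 / 2) (-r) r := by
    have := ((hasDerivAt_pow 2 r).neg).div_const 2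
    exact this.congr_deriv (by norm_num; ring)
  have h2 := ((hasDerivAt_pow n r).const_mul (√2 / √(n.factorial : ℝ))).mul h1.exp
  refine h2.congr_deriv ?_
  unfold groundMode
  rcases n with _ | n
  · simp
    ring
  · simp only [Nat.cast_add, Nat.cast_one, Nat.add_sub_cancel]
    field_simp
    ring

theorem continuousOn_div_sub (c : ℝ) : ContinuousOn (fun r : ℝ => c / r - r) (Ioi 0) :=
  (continuousOn_const.div continuousOn_id fun _ hr => (mem_Ioi.1 hr).ne').sub continuousOn_id

theorem hasACDeriv_groundMode (n : ℕ) :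
    HasACDeriv (groundMode n) (fun r => ((n : ℝ) / r - r) * groundMode n r) :=
  hasACDeriv_of_hasDerivAt (fun _ hr => hasDerivAt_groundMode n hr)
    ((continuousOn_div_sub n).mul (continuous_groundMode n).continuousOn)

/-- The factorization `-Δ_m + r² - 2(n+1) = -(∂ + (n+1)/r - r)(∂ - n/r + r)` with `n = |m|`; here
`v` is the image of `u` under the right factor. -/
theorem isModeLaplacian_of_first_order {n : ℕ} {m : ℤ} (hm : m.natAbs = n) {u v f : ℝ → ℝ}
    (hu : HasACDeriv u (fun r => ((n : ℝ) / r - r) * u r + v r))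
    (hv : HasACDeriv v (fun r => -(((n : ℝ) + 1) / r - r) * v r - f r))
    (mv : MemL2r v) (mv₁ : MemL2r fun r => -(((n : ℝ) + 1) / r - r) * v r - f r)
    (mvdiv : MemL2r fun r => v r / r)
    (mvmul : MemL2r fun r => r * v r) (h0 : ∃ M, ∀ r, 0 < r → r ≤ 1 → |u r| ≤ M)
    (h1 : 2 ≤ n → ∃ M, ∀ r, 0 < r → r ≤ 1 → |u r / r| ≤ M) :
    IsModeLaplacian m u (fun r => (r ^ 2 - 2 * ((n : ℝ) + 1)) * u r - f r) := by
  refine ⟨_, _, isModeJet_of_first_order hm hu hv mv mv₁ mvdiv mvmul h0 h1, ?_⟩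
  have mm2 : (m : ℝ) ^ 2 = (n : ℝ) ^ 2 := by
    rw [← hm, Nat.cast_natAbs, Int.cast_abs, sq_abs]
  filter_upwards [ae_radialMeasure_pos] with r hr
  rw [mm2]
  simp only [smul_eq_mul]
  field_simp
  ring

theorem isModeLaplacian_groundMode {n : ℕ} {m : ℤ} (hm : m.natAbs = n) :
    IsModeLaplacian m (groundMode n) (fun r => (r ^ 2 - 2 * ((n : ℝ) + 1)) * groundMode n r) := by
  have hz : HasACDeriv (fun _ => 0) (fun _ => 0) :=
    hasACDeriv_of_hasDerivAt (fun r _ => hasDerivAt_const r 0) continuousOn_const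
  have mz : MemL2r (fun _ => (0 : ℝ)) := MemLp.zero'
  have hC := groundMode_const_pos n
  have := isModeLaplacian_of_first_order (f := fun _ => 0) (v := fun _ => 0) hm
    ((hasACDeriv_groundMode n).congr_pos fun r _ => by ring)
    (hz.congr_pos fun r _ => by ring) mz (mz.congr_pos fun r _ => by ring)
    (mz.congr_pos fun r _ => by ring) (mz.congr_pos fun r _ => by ring)
    ⟨√2 / √(n.factorial : ℝ), fun r hr hr1 => by
      rw [abs_of_pos (groundMode_pos n hr)]
      exact (groundMode_le n hr.le).trans (mul_le_of_le_one_right hC.le (pow_le_one₀ hr.le hr1))⟩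
    (fun hn => ⟨√2 / √(n.factorial : ℝ), fun r hr hr1 => by
      rw [abs_of_pos (div_pos (groundMode_pos n hr) hr), div_le_iff₀ hr]
      refine (groundMode_le n hr.le).trans (mul_le_mul_of_nonneg_left ?_ hC.le)
      exact pow_le_of_le_one hr.le hr1 (by lia)⟩)
  simpa using this

theorem IsModeLaplacian.mem {m : ℤ} {u g : ℝ → ℝ} (h : IsModeLaplacian m u g) : MemL2r u := by
  obtain ⟨_, _, hj, -⟩ := h
  exact hj.mem_zero

theorem memL2r_groundMode (n : ℕ) : MemL2r (groundMode n) :=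
  (isModeLaplacian_groundMode (m := n) (by simp)).mem

/-! ### Solving the inhomogeneous equation -/

theorem tendsto_intervalIntegral_zero {k : ℝ → ℝ} (hk : IntegrableOn k (Ioc 0 1)) :
    Tendsto (fun r => ∫ s in (1 : ℝ)..r, k s) (𝓝[>] 0) (𝓝 (-∫ s in Ioc (0 : ℝ) 1, k s)) := by
  have hI : IntervalIntegrable k volume 0 1 := by
    rwa [intervalIntegrable_iff_integrableOn_Ioc_of_le zero_le_one]
  have hcont := intervalIntegral.continuousOn_primitive_interval' hI
      (right_mem_uIcc : (1 : ℝ) ∈ uIcc 0 1)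
  have h := (hcont 0 left_mem_uIcc).tendsto
  rw [intervalIntegral.integral_symm, intervalIntegral.integral_of_le zero_le_one] at h
  refine h.mono_left ?_
  rw [← nhdsWithin_Ioc_eq_nhdsGT (zero_lt_one' ℝ), uIcc_of_le zero_le_one]
  exact nhdsWithin_mono _ Ioc_subset_Icc_self

/-- Young's inequality with weight `t`, a substitute for Cauchy–Schwarz: the bound is linear in `t`
when the local mass of `e` is of order `t²`. -/
theorem abs_integral_mul_le {f e : ℝ → ℝ} (hf : MemL2r f) (he : MemL2r e) {x y t B : ℝ}
    (hx : 0 < x) (hxy : x ≤ y) (ht : 0 < t) (hB : ∫ r in x..y, r * e r ^ 2 ≤ B * t ^ 2) :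
    |∫ r in x..y, r * (f r * e r)| ≤ ((∫ r in Ioi (0 : ℝ), r * f r ^ 2) + B) * t := by
  have hy : 0 < y := hx.trans_le hxy
  have hsub : Ioc x y ⊆ Ioi 0 := fun r hr => hx.trans hr.1
  have i1 := (hf.intervalIntegrable hx hy).const_mul t
  have i2 := (he.intervalIntegrable hx hy).const_mul (1 / t)
  have h1 : |∫ r in x..y, r * (f r * e r)| ≤
      ∫ r in x..y, (t * (r * f r ^ 2) + 1 / t * (r * e r ^ 2)) := by
    rw [← Real.norm_eq_abs]
    refine intervalIntegral.norm_integral_le_of_norm_le hxy (ae_of_all _ fun r hr => ?_) (i1.add i2)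
    have hr : 0 < r := hsub hr
    rw [Real.norm_eq_abs, abs_mul, abs_of_pos hr, abs_mul]
    have h2 : 0 ≤ (t * |f r| - |e r|) ^ 2 := sq_nonneg _
    have h3 : |f r| * |e r| ≤ t * f r ^ 2 + 1 / t * e r ^ 2 := by
      rw [← sq_abs (f r), ← sq_abs (e r), div_mul_eq_mul_div, one_mul, ← sub_le_iff_le_add',
        le_div_iff₀ ht]
      nlinarith [mul_nonneg (mul_nonneg ht.le (abs_nonneg (f r))) (abs_nonneg (e r))]
    calc r * (|f r| * |e r|) ≤ r * (t * f r ^ 2 + 1 / t * e r ^ 2) := by gcongr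
      _ = _ := by ring
  rw [intervalIntegral.integral_add i1 i2, intervalIntegral.integral_const_mul,
    intervalIntegral.integral_const_mul] at h1
  have h2 : ∫ r in x..y, r * f r ^ 2 ≤ ∫ r in Ioi (0 : ℝ), r * f r ^ 2 := by
    rw [intervalIntegral.integral_of_le hxy]
    refine setIntegral_mono_set (memL2r_iff.1 hf).2 ?_ hsub.eventuallyLE
    filter_upwards [ae_restrict_mem measurableSet_Ioi] with r hr
    have hr : 0 < r := hr
    simp only [Pi.zero_apply]
    positivity
  calc _ ≤ _ := h1
    _ ≤ t * (∫ r in Ioi (0 : ℝ), r * f r ^ 2) + 1 / t * (B * t ^ 2) := by gcongr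
    _ = _ := by field_simp

/-- The two first order factors are inverted in turn. Since `(r e v)' = -r f e`, take `v = -(r e)⁻¹
∫₀^r s f e ds`, then `u = e ∫₁^r v/e`. -/
theorem exists_isModeLaplacian {n : ℕ} {m : ℤ} (hm : m.natAbs = n) {f : ℝ → ℝ} (hf : MemL2r f)
    (horth : ∫ r, f r * groundMode n r ∂radialMeasure = 0) :
    ∃ u, IsModeLaplacian m u (fun r => (r ^ 2 - 2 * ((n : ℝ) + 1)) * u r - f r) := by
  set e := groundMode n with he
  set A := ∫ r in Ioi (0 : ℝ), r * f r ^ 2 with hA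
  have hA0 : 0 ≤ A := setIntegral_nonneg measurableSet_Ioi fun r hr =>
    mul_nonneg (le_of_lt hr) (sq_nonneg _)
  have me : MemL2r e := memL2r_groundMode n
  have he0 : ∀ {r : ℝ}, 0 < r → 0 < e r := fun hr => groundMode_pos n hr
  have hce := groundMode_const_pos n
  set c := √2 / √(n.factorial : ℝ) with hc
  set k : ℝ → ℝ := fun r => r * (f r * e r) with hk
  have ki : IntegrableOn k (Ioi 0) := hf.integrableOn_mul me
  rw [integral_radialMeasure] at horth
  have kint : ∀ x y : ℝ, 0 < x → 0 < y → IntervalIntegrable k volume x y := fun x y hx hy => by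
    rw [intervalIntegrable_iff]
    exact ki.mono_set (uIoc_subset_uIcc.trans (uIcc_subset_Ioi hx hy))
  set c₀ := ∫ s in Ioc (0 : ℝ) 1, k s with hc₀
  set I : ℝ → ℝ := fun r => (∫ s in (1 : ℝ)..r, k s) + c₀ with hI
  have hcst : HasACDeriv (fun _ => c₀) (fun _ => 0) :=
    hasACDeriv_of_hasDerivAt (fun r _ => hasDerivAt_const r c₀) continuousOn_const
  have hIac : HasACDeriv I k :=
    ((hasACDeriv_integral kint one_pos).add hcst).congr_pos fun r _ => add_zero _
  have hI0 : Tendsto I (𝓝[>] 0) (𝓝 0) := by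
    have := (tendsto_intervalIntegral_zero (ki.mono_set Ioc_subset_Ioi_self)).add_const c₀
    rwa [neg_add_cancel] at this
  have hIinf : Tendsto I atTop (𝓝 0) := by
    have := (intervalIntegral_tendsto_integral_Ioi 1 (ki.mono_set (Ioi_subset_Ioi zero_le_one))
      tendsto_id).add_const c₀
    -- Orthogonality to the ground mode enters here: the integral from the origin also tends to zero
    -- at infinity, which compensates for the growth of `(r e)⁻¹`.
    have h0 : (∫ x in Ioi (1 : ℝ), k x) + c₀ = 0 := by
      rw [← horth, ← Ioc_union_Ioi_eq_Ioi (zero_le_one' ℝ), setIntegral_union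
        (Ioc_disjoint_Ioi le_rfl) measurableSet_Ioi (ki.mono_set Ioc_subset_Ioi_self)
        (ki.mono_set (Ioi_subset_Ioi zero_le_one)), add_comm]
    rwa [h0] at this
  -- Near the origin `e` is comparable to `r^n`, so the mass of `e` on `(0, r)` is at most a
  -- constant times `(r e(r))²`. This is the bound that makes `v` bounded there.
  have hIb0 : ∀ r, 0 < r → r ≤ 1 → |I r| ≤ (A + Real.exp 1 ^ 2) * (r * e r) := by
    intro r hr hr1
    have hlow := le_groundMode n hr.le hr1
    rw [← hc, ← he] at hlow
    have key : ∀ x, 0 < x → x < r → |I r - I x| ≤ (A + Real.exp 1 ^ 2) * (r * e r) := by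
      intro x hx hxr
      rw [← hIac.integral_eq hx hr]
      refine abs_integral_mul_le hf me hx hxr.le (mul_pos hr (he0 hr)) ?_
      have h1 : ∫ s in x..r, s * e s ^ 2 ≤ ∫ s in x..r, c ^ 2 * r ^ (2 * n + 1) := by
        refine intervalIntegral.integral_mono_on hxr.le (me.intervalIntegrable hx hr)
          intervalIntegrable_const fun s hs => ?_
        have hs0 : 0 < s := hx.trans_le hs.1
        have h2 : e s ^ 2 ≤ (c * r ^ n) ^ 2 := by
          refine pow_le_pow_left₀ (he0 hs0).le ((groundMode_le n hs0.le).trans ?_) 2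
          have := hs.2
          gcongr
        calc s * e s ^ 2 ≤ r * (c * r ^ n) ^ 2 := by
              have := hs.2
              gcongr
          _ = _ := by ring
      rw [intervalIntegral.integral_const, smul_eq_mul] at h1
      have h3 : (c * Real.exp (-1) * r ^ n) ^ 2 ≤ e r ^ 2 := by gcongr
      have h4 : Real.exp 1 ^ 2 * Real.exp (-1) ^ 2 = 1 := by
        rw [← mul_pow, ← Real.exp_add]; simp
      calc ∫ s in x..r, s * e s ^ 2 ≤ (r - x) * (c ^ 2 * r ^ (2 * n + 1)) := h1
        _ ≤ r * (c ^ 2 * r ^ (2 * n + 1)) := by gcongr; linarith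
        _ = (Real.exp 1 ^ 2 * Real.exp (-1) ^ 2) * (r * (c ^ 2 * r ^ (2 * n + 1))) := by
            rw [h4, one_mul]
        _ = Real.exp 1 ^ 2 * (r ^ 2 * (c * Real.exp (-1) * r ^ n) ^ 2) := by ring
        _ ≤ Real.exp 1 ^ 2 * (r ^ 2 * e r ^ 2) := by gcongr
        _ = _ := by ring
    have hlim : Tendsto (fun x => |I r - I x|) (𝓝[>] 0) (𝓝 |I r - 0|) := (hI0.const_sub (I r)).abs
    rw [sub_zero] at hlim
    exact le_of_tendsto hlim (by
      filter_upwards [Ioo_mem_nhdsGT hr] with x hx using key x hx.1 hx.2)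
  -- For `s ≥ n + 1` one has `n/s ≤ s/2`, hence `s e² ≤ -(e²)'`, and the mass of `e` beyond `r` is
  -- at most `e(r)²`. This makes `r v` bounded at infinity.
  have hIbinf : ∀ r, (n : ℝ) + 1 ≤ r → |I r| ≤ (A + 1) * e r := by
    intro r hr
    have hn0 : (0 : ℝ) ≤ n := n.cast_nonneg
    have hr0 : 0 < r := by linarith
    have key : ∀ x, r < x → |I x - I r| ≤ (A + 1) * e r := by
      intro x hx
      have hx0 : 0 < x := hr0.trans hx
      rw [← hIac.integral_eq hr0 hx0]
      refine abs_integral_mul_le hf me hr0 hx.le (he0 hr0) ?_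
      have hsq := (hasACDeriv_groundMode n).mul (hasACDeriv_groundMode n)
      have h1 : ∫ s in r..x, s * e s ^ 2 ≤ ∫ s in r..x, -1 * (((n : ℝ) / s - s) * groundMode n s *
          groundMode n s + groundMode n s * (((n : ℝ) / s - s) * groundMode n s)) := by
        refine intervalIntegral.integral_mono_on hx.le (me.intervalIntegrable hr0 hx0)
          ((hsq.intervalIntegrable hr0 hx0).const_mul _) fun s hs => ?_
        have hs0 : 0 < s := hr0.trans_le hs.1
        rw [← he]
        have h2 : (n : ℝ) / s ≤ s / 2 := by
          rw [div_le_iff₀ hs0]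
          have : (n : ℝ) + 1 ≤ s := hr.trans hs.1
          nlinarith
        nlinarith [sq_nonneg (e s)]
      rw [intervalIntegral.integral_const_mul, hsq.integral_eq hr0 hx0] at h1
      nlinarith [mul_self_nonneg (groundMode n x)]
    have hlim : Tendsto (fun x => |I x - I r|) atTop (𝓝 |0 - I r|) := (hIinf.sub_const (I r)).abs
    rw [zero_sub, abs_neg] at hlim
    exact le_of_tendsto hlim (by
      filter_upwards [eventually_gt_atTop r] with x hx using key x hx)
  have hre : ∀ r, 0 < r → HasDerivAt (fun r => r * e r) (((n : ℝ) + 1 - r ^ 2) * e r) r := by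
    intro r hr
    refine ((hasDerivAt_id r).mul (hasDerivAt_groundMode n hr)).congr_deriv ?_
    simp only [id]
    rw [← he]
    field_simp
    ring
  have hq : HasACDeriv (fun r => (r * e r)⁻¹)
      (fun r => -((((n : ℝ) + 1) / r - r) * (r * e r)⁻¹)) := by
    refine hasACDeriv_of_hasDerivAt (fun r hr => ?_) ?_
    · refine ((hre r hr).inv (mul_pos hr (he0 hr)).ne').congr_deriv ?_
      have := (he0 hr).ne'
      field_simp
    · exact ((continuousOn_div_sub _).mul (ContinuousOn.inv₀
        (continuousOn_id.mul (continuous_groundMode n).continuousOn)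
        fun r hr => (mul_pos hr (he0 hr)).ne')).neg
  set v : ℝ → ℝ := fun r => -1 * ((r * e r)⁻¹ * I r) with hvdef
  have hv : HasACDeriv v (fun r => -(((n : ℝ) + 1) / r - r) * v r - f r) :=
    ((hq.mul hIac).const_mul (-1)).congr_pos fun r hr => by
      have := (he0 hr).ne'
      simp only [hvdef, hk]
      field_simp
      ring
  have hvabs : ∀ r, 0 < r → |v r| = |I r| / (r * e r) := fun r hr => by
    simp only [hvdef]
    rw [abs_mul, abs_mul, abs_inv, abs_of_pos (mul_pos hr (he0 hr)), abs_neg, abs_one, one_mul,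
      inv_mul_eq_div]
  have hvb : ∀ r, 0 < r → r ≤ 1 → |v r| ≤ A + Real.exp 1 ^ 2 := fun r hr hr1 => by
    rw [hvabs r hr, div_le_iff₀ (mul_pos hr (he0 hr))]
    exact hIb0 r hr hr1
  obtain ⟨mv₁, mvmul, mvdiv, mv⟩ := memL2r_of_first_order (σ := -1) (κ := n + 1) (Or.inr rfl) hv
    (g := fun r => -f r) (MemLp.neg hf) (ae_of_all _ fun r => by ring)
    ⟨_, hvb⟩ (Or.inr (by
      obtain ⟨N, hN⟩ := isCompact_Icc.exists_bound_of_continuousOn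
        ((continuousOn_id.mul hv.continuousOn).mono
          (show Icc 1 ((n : ℝ) + 1) ⊆ Ioi 0 from fun z hz => zero_lt_one.trans_le hz.1))
      refine ⟨max (A + 1) N, fun r hr => ?_⟩
      have hr0 : 0 < r := zero_lt_one.trans_le hr
      rcases le_total r ((n : ℝ) + 1) with h | h
      · exact (hN r ⟨hr, h⟩).trans (le_max_right _ _)
      · refine le_trans ?_ (le_max_left _ _)
        rw [abs_mul, hvabs r hr0, abs_of_pos hr0, ← mul_div_assoc, mul_div_mul_left _ _ hr0.ne',
          div_le_iff₀ (he0 hr0)]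
        exact hIbinf r h))
  have mvdiv' : MemL2r fun r => v r / r :=
    MemL2r.congr_pos (MemLp.const_mul mvdiv ((n : ℝ) + 1)⁻¹) fun r _ => by field_simp
  have hve : ContinuousOn (fun r => v r / e r) (Ioi 0) :=
    hv.continuousOn.div (continuous_groundMode n).continuousOn fun r hr => (he0 hr).ne'
  have hJ := hasACDeriv_integral (f := fun r => v r / e r)
    (fun x y hx hy => (hve.mono (uIcc_subset_Ioi hx hy)).intervalIntegrable) one_pos
  set J : ℝ → ℝ := fun x => ∫ r in (1 : ℝ)..x, v r / e r with hJdef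
  have hu : HasACDeriv (fun r => e r * J r)
      (fun r => ((n : ℝ) / r - r) * (e r * J r) + v r) :=
    ((hasACDeriv_groundMode n).mul hJ).congr_pos fun r hr => by
      have := (he0 hr).ne'
      rw [← he]
      field_simp
  set V := (A + Real.exp 1 ^ 2) / (c * Real.exp (-1)) with hV
  have hV0 : 0 ≤ V := by positivity
  have hve_le : ∀ s, 0 < s → s ≤ 1 → |v s / e s| ≤ V * (s ^ n)⁻¹ := by
    intro s hs hs1
    have h1 : 0 < c * Real.exp (-1) * s ^ n := by positivity
    rw [abs_div, abs_of_pos (he0 hs), hV, ← div_eq_mul_inv, div_div]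
    have := le_groundMode n hs.le hs1
    have h2 := hvb s hs hs1
    gcongr
  refine ⟨fun r => e r * J r, isModeLaplacian_of_first_order hm hu hv mv mv₁ mvdiv' mvmul ?_ ?_⟩
  · refine ⟨c * V, fun r hr hr1 => ?_⟩
    have h1 : |J r| ≤ V * (r ^ n)⁻¹ * |r - 1| := by
      rw [← Real.norm_eq_abs (J r)]
      refine intervalIntegral.norm_integral_le_of_norm_le_const fun s hs => ?_
      rw [uIoc_of_ge hr1] at hs
      have hs0 : 0 < s := hr.trans hs.1
      refine (hve_le s hs0 hs.2).trans ?_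
      have := hs.1.le
      gcongr
    have h2 : |r - 1| ≤ 1 := by rw [abs_le]; constructor <;> linarith
    rw [abs_mul, abs_of_pos (he0 hr)]
    calc e r * |J r| ≤ (c * r ^ n) * (V * (r ^ n)⁻¹ * 1) := by
          have := groundMode_le n hr.le
          refine mul_le_mul this (h1.trans (by gcongr)) (abs_nonneg _) (by positivity)
      _ = c * V := by field_simp
  · intro hn2
    refine ⟨c * V, fun r hr hr1 => ?_⟩
    have hinv : HasACDeriv (fun r : ℝ => r⁻¹) (fun r => -(r ^ 2)⁻¹) :=
      hasACDeriv_of_hasDerivAt (fun r hr => hasDerivAt_inv hr.ne')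
        (ContinuousOn.neg (ContinuousOn.inv₀ (by fun_prop)
          fun r hr => (pow_pos (mem_Ioi.1 hr) 2).ne'))
    -- Using `s⁻ⁿ ≤ r^{-(n-2)} s⁻²` under the integral gains one power of `r` over the supremum
    -- bound of the previous case, as required for `u/r` to be bounded.
    have h1 : |J r| ≤ V * (r ^ (n - 2))⁻¹ * r⁻¹ := by
      have h3 : |J r| = ‖∫ s in r..1, v s / e s‖ := by
        rw [intervalIntegral.integral_symm, norm_neg, Real.norm_eq_abs]
      rw [h3]
      have hi := (hinv.intervalIntegrable hr one_pos).const_mul (-(V * (r ^ (n - 2))⁻¹))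
      refine (intervalIntegral.norm_integral_le_of_norm_le hr1
        (ae_of_all _ fun s hs => ?_) hi).trans ?_
      · have hs0 : 0 < s := hr.trans hs.1
        refine (hve_le s hs0 hs.2).trans ?_
        have h4 : s ^ n = s ^ (n - 2) * s ^ 2 := by rw [← pow_add]; congr 1; lia
        rw [h4, mul_inv, neg_mul_neg, ← mul_assoc]
        have := hs.1.le
        gcongr
      · rw [intervalIntegral.integral_const_mul, hinv.integral_eq hr one_pos]
        have : 0 ≤ V * (r ^ (n - 2))⁻¹ := by positivity
        rw [inv_one]
        nlinarith
    rw [abs_div, abs_mul, abs_of_pos (he0 hr), abs_of_pos hr, div_le_iff₀ hr]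
    calc e r * |J r| ≤ (c * r ^ n) * (V * (r ^ (n - 2))⁻¹ * r⁻¹) := by
          have := groundMode_le n hr.le
          exact mul_le_mul this h1 (abs_nonneg _) (by positivity)
      _ = c * V * r := by
          have h4 : r ^ n = r ^ (n - 2) * r ^ 2 := by rw [← pow_add]; congr 1; lia
          rw [h4]
          field_simp

/-! ### Symmetric relations and Lyapunov–Schmidt reduction -/

section Abstract

variable {E : Type*} [NormedAddCommGroup E] [InnerProductSpace ℝ E]

local notation "⟪" x "," y "⟫" => inner ℝ x y

/-- Symmetry and surjectivity onto `Nᗮ` make the solution in `Nᗮ` unique, hence linear in the data.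
The resulting operator is symmetric and everywhere defined, so it is bounded by Hellinger–Toeplitz;
no compactness is used. -/
theorem exists_reduced_resolvent [CompleteSpace E] (T : Submodule ℝ (E × E))
    (hsymm : ∀ u f w h, (u, f) ∈ T → (w, h) ∈ T → ⟪f, w⟫ = ⟪u, h⟫)
    (N : Submodule ℝ E) [N.HasOrthogonalProjection] (hN : ∀ p ∈ N, (p, (0 : E)) ∈ T)
    (hsurj : ∀ f ∈ Nᗮ, ∃ u, (u, f) ∈ T) :
    ∃ G : E →L[ℝ] E, (∀ f, G f ∈ Nᗮ) ∧ (∀ f ∈ Nᗮ, (G f, f) ∈ T) ∧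
      ∀ u f, (u, f) ∈ T → f ∈ Nᗮ ∧ u - G f ∈ N := by
  have horth : ∀ u f, (u, f) ∈ T → f ∈ Nᗮ := fun u f h => by
    rw [Submodule.mem_orthogonal']
    intro p hp
    rw [hsymm u f p 0 h (hN p hp), inner_zero_right]
  have huniq : ∀ u ∈ Nᗮ, (u, (0 : E)) ∈ T → u = 0 := fun u hu h => by
    obtain ⟨w, hw⟩ := hsurj u hu
    have := hsymm w u u 0 hw h
    rwa [inner_zero_right, inner_self_eq_zero] at this
  have hex : ∀ f, ∃ u ∈ Nᗮ, (u, f - N.starProjection f) ∈ T := fun f => by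
    obtain ⟨u, hu⟩ := hsurj _ (N.sub_starProjection_mem_orthogonal f)
    refine ⟨u - N.starProjection u, N.sub_starProjection_mem_orthogonal u, ?_⟩
    simpa using T.sub_mem hu (hN _ (N.starProjection_apply_mem u))
  choose g hg1 hg2 using hex
  have hlin : ∀ u ∈ Nᗮ, ∀ f, (u, f - N.starProjection f) ∈ T → u = g f := fun u hu f h => by
    refine sub_eq_zero.1 (huniq _ (Nᗮ.sub_mem hu (hg1 f)) ?_)
    simpa using T.sub_mem h (hg2 f)
  let G₀ : E →ₗ[ℝ] E :=
    { toFun := g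
      map_add' := fun x y => (hlin _ (Nᗮ.add_mem (hg1 x) (hg1 y)) _ (by
        have := T.add_mem (hg2 x) (hg2 y)
        rw [map_add]
        convert this using 1
        ext <;> simp
        abel)).symm
      map_smul' := fun c x => (hlin _ (Nᗮ.smul_mem c (hg1 x)) _ (by
        have := T.smul_mem c (hg2 x)
        rw [map_smul, ← smul_sub]
        exact this)).symm }
  have hG₀ : G₀.IsSymmetric := fun x y => by
    have h1 := hsymm _ _ _ _ (hg2 x) (hg2 y)
    have h2 : ⟪N.starProjection x, g y⟫ = 0 :=
      (N.mem_orthogonal (g y)).1 (hg1 y) _ (N.starProjection_apply_mem x)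
    have h3 : ⟪g x, N.starProjection y⟫ = 0 :=
      (N.mem_orthogonal' (g x)).1 (hg1 x) _ (N.starProjection_apply_mem y)
    rw [inner_sub_left, inner_sub_right, h2, h3, sub_zero, sub_zero] at h1
    exact h1.symm
  have key : ∀ f ∈ Nᗮ, (g f, f) ∈ T := fun f hf => by
    have := hg2 f
    rwa [(Submodule.starProjection_apply_eq_zero_iff N).2 hf, sub_zero] at this
  refine ⟨⟨G₀, hG₀.continuous⟩, hg1, key, fun u f h => ⟨horth u f h, ?_⟩⟩
  have h1 := T.sub_mem (T.sub_mem h (key f (horth u f h))) (hN _ (N.starProjection_apply_mem u))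
  have h2 : u - g f - N.starProjection u ∈ Nᗮ := by
    rw [sub_right_comm]
    exact Nᗮ.sub_mem (N.sub_starProjection_mem_orthogonal u) (hg1 f)
  have h3 := huniq _ h2 (by simpa using h1)
  change u - g f ∈ N
  rw [sub_eq_zero.1 h3]
  exact N.starProjection_apply_mem u

theorem mem_orthogonal_span_pair {φ₁ φ₂ f : E} :
    f ∈ (Submodule.span ℝ {φ₁, φ₂})ᗮ ↔ ⟪φ₁, f⟫ = 0 ∧ ⟪φ₂, f⟫ = 0 := by
  rw [Submodule.mem_orthogonal]
  constructor
  · intro h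
    exact ⟨h _ (Submodule.subset_span (by simp)), h _ (Submodule.subset_span (by simp))⟩
  · rintro ⟨h1, h2⟩ p hp
    obtain ⟨a, b, rfl⟩ := Submodule.mem_span_pair.1 hp
    rw [inner_add_left, inner_smul_left, inner_smul_left, h1, h2]
    simp

theorem norm_sub_one_le_of_inverse {Z Y : E →L[ℝ] E} (hY : (1 + Z) * Y = 1) {t : ℝ}
    (hZ : ‖Z‖ ≤ t) (ht : t ≤ 1 / 2) : ‖Y - 1‖ ≤ 2 * t := by
  have h1 : Y - 1 = -(Z * Y) := by
    rw [add_mul, one_mul] at hY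
    rw [← hY]
    abel
  have h2 : ‖Y - 1‖ ≤ t * ‖Y‖ := by
    rw [h1, norm_neg]
    exact (norm_mul_le _ _).trans (by gcongr)
  have h3 : ‖Y‖ ≤ ‖Y - 1‖ + 1 := by
    have h4 : ‖(1 : E →L[ℝ] E)‖ ≤ 1 := ContinuousLinearMap.norm_id_le
    have h5 := norm_add_le (Y - 1) 1
    rw [sub_add_cancel] at h5
    linarith
  have ht0 : 0 ≤ t := (norm_nonneg Z).trans hZ
  nlinarith [norm_nonneg (Y - 1)]

/-- The kernel of `T + Z` when `T` has kernel spanned by `φ₁, φ₂`, and the reduced matrix of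
`Z` on `φ₁, φ₂` is singular with a nonzero off-diagonal entry. -/
theorem kernel_of_reduced_matrix (T : Submodule ℝ (E × E))
    (hsymm : ∀ u f w h, (u, f) ∈ T → (w, h) ∈ T → ⟪f, w⟫ = ⟪u, h⟫)
    {φ₁ φ₂ : E} (h11 : ⟪φ₁, φ₁⟫ = 1) (h12 : ⟪φ₁, φ₂⟫ = 0)
    (hT₁ : (φ₁, (0 : E)) ∈ T) (hT₂ : (φ₂, (0 : E)) ∈ T) {G Z Y : E →L[ℝ] E}
    (hG : ∀ f ∈ (Submodule.span ℝ {φ₁, φ₂})ᗮ, (G f, f) ∈ T)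
    (hG' : ∀ u f, (u, f) ∈ T → f ∈ (Submodule.span ℝ {φ₁, φ₂})ᗮ ∧
      u - G f ∈ Submodule.span ℝ {φ₁, φ₂})
    (hZ : ∀ x y, ⟪Z x, y⟫ = ⟪x, Z y⟫)
    (hY₁ : (1 + G * Z) * Y = 1) (hY₂ : Y * (1 + G * Z) = 1)
    (hdet : ⟪φ₁, Z (Y φ₁)⟫ * ⟪φ₂, Z (Y φ₂)⟫ - ⟪φ₁, Z (Y φ₂)⟫ * ⟪φ₂, Z (Y φ₁)⟫ = 0)
    (hoff : ⟪φ₁, Z (Y φ₂)⟫ ≠ 0) :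
    ∃ v : E, v ≠ 0 ∧ (v, -Z v) ∈ T ∧ (∀ w, (w, -Z w) ∈ T → ∃ c : ℝ, w = c • v) ∧
      ¬ ∃ w, (w, v - Z w) ∈ T := by
  -- The pair `(1, -t)` spans the kernel of the reduced matrix: the first row vanishes by the choice
  -- of `t`, the second by the determinant condition.
  set t := ⟪φ₁, Z (Y φ₁)⟫ / ⟪φ₁, Z (Y φ₂)⟫ with ht
  set p := φ₁ - t • φ₂ with hp
  set v := Y p with hv
  have hvp : v + G (Z v) = p := congrArg (fun A : E →L[ℝ] E => A p) hY₁
  have hvT : (v, -Z v) ∈ T := by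
    have h1 : -Z v ∈ (Submodule.span ℝ {φ₁, φ₂})ᗮ := by
      refine Submodule.neg_mem _ (mem_orthogonal_span_pair.2 ⟨?_, ?_⟩) <;>
        rw [hv, hp, map_sub, map_smul, map_sub, map_smul, inner_sub_right, inner_smul_right, ht]
      · field_simp
        ring
      · field_simp
        linarith
    have h2 := T.add_mem (T.sub_mem hT₁ (T.smul_mem t hT₂)) (hG _ h1)
    have h3 : v = p + G (-Z v) := by rw [map_neg, ← hvp]; abel
    rw [Prod.smul_mk, Prod.mk_sub_mk, Prod.mk_add_mk, ← hp, ← h3] at h2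
    simpa using h2
  have hv0 : v ≠ 0 := by
    intro h0
    rw [h0, map_zero, map_zero, add_zero] at hvp
    have h1 : ⟪φ₁, p⟫ = 1 := by
      rw [hp, inner_sub_right, inner_smul_right, h11, h12]
      ring
    rw [← hvp, inner_zero_right] at h1
    exact zero_ne_one h1
  refine ⟨v, hv0, hvT, ?_, ?_⟩
  · intro w hw
    obtain ⟨h1, h2⟩ := hG' _ _ hw
    obtain ⟨a, b, hab⟩ := Submodule.mem_span_pair.1 h2
    -- A kernel vector is `Y` applied to an element of the unperturbed kernel. The first row alone
    -- then fixes the ratio of the two coefficients, because the off-diagonal entry is nonzero.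
    have hwY : w = Y (a • φ₁ + b • φ₂) := by
      rw [hab, map_neg, sub_neg_eq_add]
      exact (congrArg (fun A : E →L[ℝ] E => A w) hY₂).symm
    rw [Submodule.neg_mem_iff, mem_orthogonal_span_pair] at h1
    have h3 := h1.1
    rw [hwY, map_add, map_smul, map_smul, map_add, map_smul, map_smul, inner_add_right,
      inner_smul_right, inner_smul_right] at h3
    refine ⟨a, ?_⟩
    have hb : b = -(a * t) := by
      rw [ht]
      field_simp
      linarith
    rw [hwY, hv, hp, hb, ← map_smul]
    congr 1
    module
  -- A preimage of `v` would give `⟪v, v⟫ = 0` by symmetry of `T + Z`.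
  · rintro ⟨w, hw⟩
    have h1 := hsymm _ _ _ _ hw hvT
    rw [inner_sub_left, hZ, inner_neg_right, sub_eq_neg_self, inner_self_eq_zero] at h1
    exact hv0 h1

/-! ### The reduced two by two determinant and the choice of the parameter. -/

theorem abs_mul_sub_mul_le {x y x' y' b δ : ℝ} (hδ : δ ≤ 1) (hx : |x' - x| ≤ δ)
    (hy : |y' - y| ≤ δ) (hxb : |x| ≤ b) (hyb : |y| ≤ b) :
    |x' * y' - x * y| ≤ (2 * b + 1) * δ := by
  have hδ0 : 0 ≤ δ := (abs_nonneg _).trans hx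
  have hb0 : 0 ≤ b := (abs_nonneg _).trans hxb
  have h1 : x' * y' - x * y = (x' - x) * y + x * (y' - y) + (x' - x) * (y' - y) := by ring
  rw [h1]
  calc _ ≤ |(x' - x) * y| + |x * (y' - y)| + |(x' - x) * (y' - y)| := abs_add_three _ _ _
    _ ≤ δ * b + b * δ + δ * 1 := by
        simp only [abs_mul]
        gcongr
        exact hy.trans hδ
    _ = _ := by ring

/-- By `αγ = β²` the unperturbed determinant is `s (σ - s)` with `σ = γ - α > 0`. It changes sign at
the simple root `σ`, and the perturbed one differs from it by at most `D' ε`. The constants depend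
only on `α, β, γ, D`, so they are uniform in the perturbed entries. -/
theorem exists_det_eq_zero {α β γ D : ℝ} (hβ : β ≠ 0) (hdet : α * γ = β ^ 2) (hs : 0 < γ - α)
    (hD : 0 < D) :
    ∃ ε₀ > 0, ∃ K : ℝ, ∀ ε, 0 < ε → ε < ε₀ → ∀ a₁₁ a₁₂ a₂₁ a₂₂ : ℝ → ℝ,
      (∀ s, |s - (γ - α)| ≤ 1 → ContinuousAt a₁₁ s ∧ ContinuousAt a₁₂ s ∧ ContinuousAt a₂₁ s ∧
        ContinuousAt a₂₂ s) →
      (∀ s, |s - (γ - α)| ≤ 1 → |a₁₁ s - (α + s)| ≤ D * ε ∧ |a₁₂ s - β| ≤ D * ε ∧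
        |a₂₁ s - β| ≤ D * ε ∧ |a₂₂ s - (γ - s)| ≤ D * ε) →
      ∃ s, |s - (γ - α)| ≤ K * ε ∧ |s - (γ - α)| ≤ 1 ∧
        a₁₁ s * a₂₂ s - a₁₂ s * a₂₁ s = 0 ∧ a₁₂ s ≠ 0 := by
  obtain ⟨σ, hσ⟩ : ∃ σ, σ = γ - α := ⟨_, rfl⟩
  rw [← hσ] at hs ⊢
  obtain ⟨b, hb⟩ : ∃ b, b = |α| + |β| + |γ| + σ + 1 := ⟨_, rfl⟩
  have hb0 : 0 < b := by rw [hb]; positivity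
  obtain ⟨D', hD'⟩ : ∃ D', D' = 2 * ((2 * b + 1) * D) := ⟨_, rfl⟩
  have hD'0 : 0 < D' := by rw [hD']; positivity
  -- Chosen so that `(σ/2)(K ε) = D' ε`: at distance `K ε` from the root the unperturbed determinant
  -- outweighs the error.
  obtain ⟨K, hK⟩ : ∃ K, K = 2 * D' / σ := ⟨_, rfl⟩
  have hK0 : 0 < K := by rw [hK]; positivity
  have hKσ : K * σ = 2 * D' := by rw [hK]; field_simp
  have hβ0 : 0 < |β| := abs_pos.2 hβ
  -- In order: the interval stays above `σ/2`; it stays within distance one of `σ`; the off-diagonal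
  -- entry stays nonzero; the error `D ε` is at most one, as the product estimate requires.
  refine ⟨min (min (σ / (2 * K)) (1 / K)) (min (|β| / D) (1 / D)), by positivity, K, ?_⟩
  intro ε hε hε₀ a₁₁ a₁₂ a₂₁ a₂₂ hcont hclose
  simp only [lt_min_iff] at hε₀
  obtain ⟨⟨hε1, hε2⟩, hε3, hε4⟩ := hε₀
  rw [lt_div_iff₀ (by positivity)] at hε1 hε2 hε3 hε4
  have hDε : D * ε ≤ 1 := by linarith
  have hKε : K * ε ≤ σ / 2 := by linarith
  have hKε1 : K * ε ≤ 1 := by linarith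
  have hKε0 : 0 < K * ε := by positivity
  obtain ⟨d, hd⟩ : ∃ d : ℝ → ℝ, d = fun s => a₁₁ s * a₂₂ s - a₁₂ s * a₂₁ s := ⟨_, rfl⟩
  have hdc : ∀ s, |s - σ| ≤ 1 → |d s - s * (σ - s)| ≤ D' * ε := by
    intro s h
    obtain ⟨e11, e12, e21, e22⟩ := hclose s h
    have hsb : |s| ≤ σ + 1 := by
      have := abs_sub_abs_le_abs_sub s σ
      rw [abs_of_pos hs] at this
      linarith
    have b11 : |α + s| ≤ b := by
      have := abs_add_le α s
      rw [hb]
      linarith [abs_nonneg γ]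
    have b22 : |γ - s| ≤ b := by
      have := abs_sub γ s
      rw [hb]
      linarith [abs_nonneg α]
    have b12 : |β| ≤ b := by
      rw [hb]
      linarith [abs_nonneg α, abs_nonneg γ]
    have p1 := abs_mul_sub_mul_le hDε e11 e22 b11 b22
    have p2 := abs_mul_sub_mul_le hDε e12 e21 b12 b12
    have h2 : d s - s * (σ - s) = (a₁₁ s * a₂₂ s - (α + s) * (γ - s)) -
        (a₁₂ s * a₂₁ s - β * β) := by
      rw [hd, hσ]
      linear_combination hdet
    rw [h2, hD']
    refine (abs_sub _ _).trans ?_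
    linarith
  have h5 : σ / 2 * (K * ε) = D' * ε := by linear_combination ε / 2 * hKσ
  have hd1 : 0 ≤ d (σ - K * ε) := by
    have h1 := hdc (σ - K * ε) (by
      rw [sub_sub_cancel_left, abs_neg, abs_of_pos hKε0]; exact hKε1)
    have h2 := (abs_le.1 h1).1
    have h4 : σ / 2 * (K * ε) ≤ (σ - K * ε) * (K * ε) := by gcongr; linarith
    have h6 : σ - (σ - K * ε) = K * ε := by ring
    rw [h6] at h2
    linarith
  have hd2 : d (σ + K * ε) ≤ 0 := by
    have h1 := hdc (σ + K * ε) (by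
      rw [add_sub_cancel_left, abs_of_pos hKε0]; exact hKε1)
    have h2 := (abs_le.1 h1).2
    have h3 : (σ + K * ε) * (σ - (σ + K * ε)) ≤ -(D' * ε) := by
      have := mul_pos hs hKε0
      nlinarith [mul_pos hKε0 hKε0]
    linarith
  have hc : ContinuousOn d (Icc (σ - K * ε) (σ + K * ε)) := by
    intro s hs'
    obtain ⟨c11, c12, c21, c22⟩ := hcont s (by
      rw [abs_le]
      constructor <;> linarith [hs'.1, hs'.2])
    rw [hd]
    exact ((c11.mul c22).sub (c12.mul c21)).continuousWithinAt
  obtain ⟨s, hsI, hds⟩ := intermediate_value_Icc' (by linarith) hc ⟨hd2, hd1⟩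
  have hsK : |s - σ| ≤ K * ε := by
    rw [abs_le]
    constructor <;> linarith [hsI.1, hsI.2]
  refine ⟨s, hsK, hsK.trans hKε1, by rw [hd] at hds; exact hds, fun h0 => ?_⟩
  have h1 := (hclose s (hsK.trans hKε1)).2.1
  rw [h0, zero_sub, abs_neg] at h1
  linarith

/-- The effective operator on the unperturbed kernel is `X (1 + ε G X)⁻¹`. A Neumann argument shows
that it differs from the leading part `L` of `X` by `O(ε)`. -/
theorem exists_perturbed_inverse [CompleteSpace E] {G X L : E →L[ℝ] E} {b C ε : ℝ} (hε : 0 < ε)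
    (hX : ‖X‖ ≤ b) (hXL : ‖X - L‖ ≤ C * ε) (hhalf : ‖G‖ * b * ε ≤ 1 / 2) :
    IsUnit (1 + G * (ε • X)) ∧
      ‖X * Ring.inverse (1 + G * (ε • X)) - L‖ ≤ (C + 2 * b ^ 2 * ‖G‖) * ε := by
  have hZ : ‖G * (ε • X)‖ ≤ ‖G‖ * b * ε := by
    calc ‖G * (ε • X)‖ ≤ ‖G‖ * ‖ε • X‖ := norm_mul_le _ _
      _ ≤ ‖G‖ * (ε * b) := by
          rw [norm_smul, Real.norm_of_nonneg hε.le]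
          gcongr
      _ = _ := by ring
  have hu : IsUnit (1 + G * (ε • X)) := by
    have h1 : ‖-(G * (ε • X))‖ < 1 := by
      rw [norm_neg]
      linarith
    have h2 := isUnit_one_sub_of_norm_lt_one h1
    rwa [sub_neg_eq_add] at h2
  refine ⟨hu, ?_⟩
  have h1 := norm_sub_one_le_of_inverse (Ring.mul_inverse_cancel _ hu) hZ hhalf
  have h2 : X * Ring.inverse (1 + G * (ε • X)) - L =
      X * (Ring.inverse (1 + G * (ε • X)) - 1) + (X - L) := by
    rw [mul_sub, mul_one]
    abel
  have hb0 : 0 ≤ b := (norm_nonneg _).trans hX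
  rw [h2]
  calc _ ≤ ‖X‖ * ‖Ring.inverse (1 + G * (ε • X)) - 1‖ + ‖X - L‖ :=
        (norm_add_le _ _).trans (by gcongr; exact norm_mul_le _ _)
    _ ≤ b * (2 * (‖G‖ * b * ε)) + C * ε := by gcongr
    _ = _ := by ring

theorem norm_eq_one_of_inner_self {φ : E} (h : ⟪φ, φ⟫ = 1) : ‖φ‖ = 1 := by
  rw [← sq_eq_sq₀ (norm_nonneg _) zero_le_one, ← real_inner_self_eq_norm_sq, h, one_pow]

theorem abs_inner_sub_le {A L : E →L[ℝ] E} {x y : E} (hx : ‖x‖ = 1) (hy : ‖y‖ = 1) {t c : ℝ}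
    (h : ‖A - L‖ ≤ t) (hc : ⟪x, L y⟫ = c) : |⟪x, A y⟫ - c| ≤ t := by
  rw [← hc, ← inner_sub_right]
  refine (abs_real_inner_le_norm _ _).trans ?_
  rw [hx, one_mul]
  have := (A - L).le_opNorm y
  rw [hy, mul_one] at this
  exact this.trans h

/-- `J` acts as `1` and `-1` on the two kernel vectors, so `s` moves the diagonal entries in
opposite directions. The thresholds `ε₀` and `K` are chosen before `R`, hence serve all remainders
of size `C ε`. -/
theorem exists_singular_parameter [CompleteSpace E] (T : Submodule ℝ (E × E))
    (hsymm : ∀ u f w h, (u, f) ∈ T → (w, h) ∈ T → ⟪f, w⟫ = ⟪u, h⟫)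
    {φ₁ φ₂ : E} (h11 : ⟪φ₁, φ₁⟫ = 1) (h22 : ⟪φ₂, φ₂⟫ = 1) (h12 : ⟪φ₁, φ₂⟫ = 0)
    (hT₁ : (φ₁, (0 : E)) ∈ T) (hT₂ : (φ₂, (0 : E)) ∈ T)
    (hsurj : ∀ f, ⟪φ₁, f⟫ = 0 → ⟪φ₂, f⟫ = 0 → ∃ u, (u, f) ∈ T)
    {X₀ J : E →L[ℝ] E} (hX₀ : ∀ x y, ⟪X₀ x, y⟫ = ⟪x, X₀ y⟫) (hJ : ∀ x y, ⟪J x, y⟫ = ⟪x, J y⟫)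
    {α β γ : ℝ} (hX11 : ⟪φ₁, X₀ φ₁⟫ = α) (hX12 : ⟪φ₁, X₀ φ₂⟫ = β) (hX22 : ⟪φ₂, X₀ φ₂⟫ = γ)
    (hJ₁ : J φ₁ = φ₁) (hJ₂ : J φ₂ = -φ₂) (hβ : β ≠ 0) (hdet : α * γ = β ^ 2) (hs : 0 < γ - α)
    (C : ℝ) (hC : 0 ≤ C) :
    ∃ ε₀ > 0, ∃ K : ℝ, ∀ ε, 0 < ε → ε < ε₀ → ∀ R : E →L[ℝ] E,
      (∀ x y, ⟪R x, y⟫ = ⟪x, R y⟫) → ‖R‖ ≤ C * ε → ∃ s : ℝ, |s - (γ - α)| ≤ K * ε ∧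
      ∃ v : E, v ≠ 0 ∧ (v, -(ε • (X₀ + s • J + R)) v) ∈ T ∧
        (∀ w, (w, -(ε • (X₀ + s • J + R)) w) ∈ T → ∃ c : ℝ, w = c • v) ∧
        ¬ ∃ w, (w, v - (ε • (X₀ + s • J + R)) w) ∈ T := by
  have : FiniteDimensional ℝ (Submodule.span ℝ {φ₁, φ₂}) :=
    FiniteDimensional.span_of_finite ℝ (Set.toFinite _)
  obtain ⟨G, -, hG, hG'⟩ := exists_reduced_resolvent T hsymm (Submodule.span ℝ {φ₁, φ₂}) (by
      intro p hp
      obtain ⟨a, b, rfl⟩ := Submodule.mem_span_pair.1 hp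
      simpa using T.add_mem (T.smul_mem a hT₁) (T.smul_mem b hT₂))
    (fun f hf => hsurj f (mem_orthogonal_span_pair.1 hf).1 (mem_orthogonal_span_pair.1 hf).2)
  have hn1 := norm_eq_one_of_inner_self h11
  have hn2 := norm_eq_one_of_inner_self h22
  obtain ⟨b, hb⟩ : ∃ b, b = ‖X₀‖ + (γ - α + 1) * ‖J‖ + C := ⟨_, rfl⟩
  have hb0 : 0 ≤ b := by rw [hb]; positivity
  obtain ⟨D, hD⟩ : ∃ D, D = C + 2 * b ^ 2 * ‖G‖ + 1 := ⟨_, rfl⟩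
  have hD0 : 0 < D := by rw [hD]; positivity
  obtain ⟨ε₁, hε₁, K, hK⟩ := exists_det_eq_zero hβ hdet hs hD0
  -- The last entry forces `‖G‖ b ε ≤ 1/2` for the Neumann argument; the summand `1` keeps the
  -- denominator positive.
  refine ⟨min ε₁ (min 1 (1 / (2 * (‖G‖ * b + 1)))), by positivity, K, ?_⟩
  intro ε hε hε₀ R hR hRn
  simp only [lt_min_iff] at hε₀
  obtain ⟨hεa, hεb, hεc⟩ := hε₀
  rw [lt_div_iff₀ (by positivity)] at hεc
  have hhalf : ‖G‖ * b * ε ≤ 1 / 2 := by linarith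
  have hRC : ‖R‖ ≤ C := hRn.trans (mul_le_of_le_one_right hC hεb.le)
  obtain ⟨X, hX⟩ : ∃ X : ℝ → E →L[ℝ] E, X = fun s => X₀ + s • J + R := ⟨_, rfl⟩
  have hXb : ∀ s, |s - (γ - α)| ≤ 1 → ‖X s‖ ≤ b := by
    intro s h
    have h1 : |s| ≤ γ - α + 1 := by
      have := abs_sub_abs_le_abs_sub s (γ - α)
      rw [abs_of_pos hs] at this
      linarith
    rw [hX, hb]
    calc ‖X₀ + s • J + R‖ ≤ ‖X₀‖ + ‖s • J‖ + ‖R‖ := norm_add₃_le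
      _ ≤ ‖X₀‖ + (γ - α + 1) * ‖J‖ + C := by
          rw [norm_smul, Real.norm_eq_abs]
          gcongr
  have hinv : ∀ s, |s - (γ - α)| ≤ 1 → IsUnit (1 + G * (ε • X s)) ∧
      ‖X s * Ring.inverse (1 + G * (ε • X s)) - (X₀ + s • J)‖ ≤ D * ε := by
    intro s h
    have h1 : ‖X s - (X₀ + s • J)‖ ≤ C * ε := by
      rw [hX]
      simpa using hRn
    obtain ⟨h2, h3⟩ := exists_perturbed_inverse hε (hXb s h) h1 hhalf
    refine ⟨h2, h3.trans ?_⟩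
    rw [hD]
    nlinarith
  obtain ⟨Y, hY⟩ : ∃ Y : ℝ → E →L[ℝ] E, Y = fun s => Ring.inverse (1 + G * (ε • X s)) := ⟨_, rfl⟩
  have hXc : Continuous X := by rw [hX]; fun_prop
  have hYc : ∀ s, |s - (γ - α)| ≤ 1 → ContinuousAt Y s := by
    intro s h
    obtain ⟨x, hx⟩ := (hinv s h).1
    have h1 : ContinuousAt Ring.inverse (1 + G * (ε • X s)) := by
      rw [← hx]
      exact NormedRing.inverse_continuousAt x
    have h2 : Continuous fun s => 1 + G * (ε • X s) := by fun_prop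
    rw [hY]
    exact ContinuousAt.comp (f := fun s => 1 + G * (ε • X s)) h1 h2.continuousAt
  have hXY : ∀ x y s, |s - (γ - α)| ≤ 1 → ContinuousAt (fun s => ⟪x, X s (Y s y)⟫) s :=
    fun x y s h => continuousAt_const.inner
      (hXc.continuousAt.clm_apply ((hYc s h).clm_apply continuousAt_const))
  have hX21 : ⟪φ₂, X₀ φ₁⟫ = β := by rw [← hX₀, real_inner_comm, hX12]
  have h21 : ⟪φ₂, φ₁⟫ = 0 := by rw [real_inner_comm, h12]
  obtain ⟨s, hsK, hs1, hds, hoff⟩ := hK ε hε hεa (fun s => ⟪φ₁, X s (Y s φ₁)⟫)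
    (fun s => ⟪φ₁, X s (Y s φ₂)⟫) (fun s => ⟪φ₂, X s (Y s φ₁)⟫) (fun s => ⟪φ₂, X s (Y s φ₂)⟫)
    (fun s h => ⟨hXY _ _ s h, hXY _ _ s h, hXY _ _ s h, hXY _ _ s h⟩)
    (fun s h => by
      have h1 := (hinv s h).2
      rw [hY]
      refine ⟨abs_inner_sub_le hn1 hn1 h1 ?_, abs_inner_sub_le hn1 hn2 h1 ?_,
        abs_inner_sub_le hn2 hn1 h1 ?_, abs_inner_sub_le hn2 hn2 h1 ?_⟩ <;>
      rw [add_apply, smul_apply, inner_add_right,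
        inner_smul_right]
      · rw [hJ₁, hX11, h11, mul_one]
      · rw [hJ₂, hX12, inner_neg_right, h12, neg_zero, mul_zero, add_zero]
      · rw [hJ₁, hX21, h21, mul_zero, add_zero]
      · rw [hJ₂, hX22, inner_neg_right, h22, mul_neg, mul_one, sub_eq_add_neg])
  refine ⟨s, hsK, ?_⟩
  have hsmul : ∀ x y, ⟪x, (ε • X s) (Y s y)⟫ = ε * ⟪x, X s (Y s y)⟫ := fun x y => by
    rw [smul_apply, inner_smul_right]
  have hXs : X₀ + s • J + R = X s := by rw [hX]
  have hsym : ∀ x y, ⟪(ε • X s) x, y⟫ = ⟪x, (ε • X s) y⟫ := by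
    intro x y
    rw [← hXs]
    simp only [smul_apply, add_apply, inner_smul_left,
      inner_smul_right, inner_add_left, inner_add_right, hX₀, hJ, hR]
    simp
  rw [hXs]
  refine kernel_of_reduced_matrix (Y := Y s) T hsymm h11 h12 hT₁ hT₂ hG hG' hsym ?_ ?_ ?_ ?_
  · rw [hY]
    exact Ring.mul_inverse_cancel _ (hinv s hs1).1
  · rw [hY]
    exact Ring.inverse_mul_cancel _ (hinv s hs1).1
  · simp only [hsmul]
    linear_combination ε ^ 2 * hds
  · rw [hsmul]
    exact mul_ne_zero hε.ne' hoff

end Abstract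

/-! ### Linear operations on modes -/

section Linear

variable {𝕜 𝕜' : Type*} [RCLike 𝕜] [RCLike 𝕜']

theorem LocallyIntegrableOn.clm_comp {u : ℝ → 𝕜} (ℓ : 𝕜 →L[ℝ] 𝕜')
    (h : LocallyIntegrableOn u (Ioi (0 : ℝ))) :
    LocallyIntegrableOn (fun r => ℓ (u r)) (Ioi (0 : ℝ)) := fun x hx => by
  obtain ⟨s, hs, hi⟩ := h x hx
  exact ⟨s, hs, ℓ.integrable_comp hi⟩

theorem HasWeakDeriv.map {u u₁ : ℝ → 𝕜} (ℓ : 𝕜 →L[ℝ] 𝕜') (h : HasWeakDeriv u u₁) :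
    HasWeakDeriv (fun r => ℓ (u r)) (fun r => ℓ (u₁ r)) := by
  refine ⟨LocallyIntegrableOn.clm_comp ℓ h.1, LocallyIntegrableOn.clm_comp ℓ h.2.1,
    fun φ hφ hc hs => ?_⟩
  have e := h.2.2 φ hφ hc hs
  have hd : Continuous (deriv φ) := hφ.continuous_deriv (by simp)
  simp only [← map_smul]
  rw [ℓ.integral_comp_comm (integrableOn_smul_of_hasCompactSupport hd hc.deriv
      (tsupport_deriv_subset.trans hs) h.1),
    ℓ.integral_comp_comm (integrableOn_smul_of_hasCompactSupport hφ.continuous hc hs h.2.1), e,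
    map_neg]

theorem HasWeakDeriv.add {u u₁ w w₁ : ℝ → 𝕜} (hu : HasWeakDeriv u u₁) (hw : HasWeakDeriv w w₁) :
    HasWeakDeriv (fun r => u r + w r) (fun r => u₁ r + w₁ r) := by
  refine ⟨hu.1.add hw.1, hu.2.1.add hw.2.1, fun φ hφ hc hs => ?_⟩
  have hd : Continuous (deriv φ) := hφ.continuous_deriv (by simp)
  have hs' := tsupport_deriv_subset.trans hs
  simp only [smul_add]
  rw [integral_add (integrableOn_smul_of_hasCompactSupport hd hc.deriv hs' hu.1)
      (integrableOn_smul_of_hasCompactSupport hd hc.deriv hs' hw.1),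
    integral_add (integrableOn_smul_of_hasCompactSupport hφ.continuous hc hs hu.2.1)
      (integrableOn_smul_of_hasCompactSupport hφ.continuous hc hs hw.2.1),
    hu.2.2 φ hφ hc hs, hw.2.2 φ hφ hc hs, neg_add]

theorem MemL2r.map {u : ℝ → 𝕜} (ℓ : 𝕜 →L[ℝ] 𝕜') (h : MemL2r u) : MemL2r (fun r => ℓ (u r)) :=
  ContinuousLinearMap.comp_memLp' ℓ h

theorem IsModeLaplacian.map {m : ℤ} {u g : ℝ → 𝕜} (ℓ : 𝕜 →L[ℝ] 𝕜') (h : IsModeLaplacian m u g) :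
    IsModeLaplacian m (fun r => ℓ (u r)) (fun r => ℓ (g r)) := by
  obtain ⟨u₁, u₂, hj, hg⟩ := h
  refine ⟨fun r => ℓ (u₁ r), fun r => ℓ (u₂ r), ⟨hj.weak_deriv.map ℓ, hj.weak_deriv_two.map ℓ,
    hj.mem_zero.map ℓ, hj.mem_grad_r.map ℓ, ?_, hj.mem_hess_rr.map ℓ, ?_, ?_, ?_⟩, ?_⟩
  · simpa only [map_smul] using hj.mem_grad_theta.map ℓ
  · simpa only [map_smul, map_sub] using hj.mem_hess_rtheta.map ℓ
  · simpa only [map_smul, map_sub] using hj.mem_hess_thetatheta.map ℓ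
  · simpa only [map_smul] using hj.mem_weight.map ℓ
  · filter_upwards [hg] with r hr
    rw [hr, map_sub, map_add, map_smul, map_smul]

theorem IsModeLaplacian.add {m : ℤ} {u g w h : ℝ → 𝕜} (hu : IsModeLaplacian m u g)
    (hw : IsModeLaplacian m w h) :
    IsModeLaplacian m (fun r => u r + w r) (fun r => g r + h r) := by
  obtain ⟨u₁, u₂, hj, hg⟩ := hu
  obtain ⟨w₁, w₂, hk, hh⟩ := hw
  refine ⟨fun r => u₁ r + w₁ r, fun r => u₂ r + w₂ r, ⟨hj.weak_deriv.add hk.weak_deriv,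
    hj.weak_deriv_two.add hk.weak_deriv_two, MemLp.add hj.mem_zero hk.mem_zero,
    MemLp.add hj.mem_grad_r hk.mem_grad_r, ?_, MemLp.add hj.mem_hess_rr hk.mem_hess_rr,
    ?_, ?_, ?_⟩, ?_⟩
  · change MemLp _ 2 radialMeasure
    convert MemLp.add hj.mem_grad_theta hk.mem_grad_theta using 1
    ext r
    simp only [Pi.add_apply, smul_add]
  · change MemLp _ 2 radialMeasure
    convert MemLp.add hj.mem_hess_rtheta hk.mem_hess_rtheta using 1
    ext r
    simp only [Pi.add_apply, ← smul_add]
    congr 1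
    module
  · change MemLp _ 2 radialMeasure
    convert MemLp.add hj.mem_hess_thetatheta hk.mem_hess_thetatheta using 1
    ext r
    simp only [Pi.add_apply]
    module
  · change MemLp _ 2 radialMeasure
    convert MemLp.add hj.mem_weight hk.mem_weight using 1
    ext r
    simp only [Pi.add_apply, smul_add]
  · filter_upwards [hg, hh] with r hr hr'
    rw [hr, hr']
    module

end Linear

theorem IsModeLaplacian.congr {m : ℤ} {u g w h : ℝ → ℝ} (hu : IsModeLaplacian m u g)
    (huw : ∀ᵐ r ∂radialMeasure, u r = w r) (hgh : ∀ᵐ r ∂radialMeasure, g r = h r) :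
    IsModeLaplacian m w h := by
  obtain ⟨u₁, u₂, hj, hg⟩ := hu
  have huw' := ae_radialMeasure_iff.1 huw
  refine ⟨u₁, u₂, ⟨hj.weak_deriv.congr huw' (ae_of_all _ fun _ => rfl), hj.weak_deriv_two,
    hj.mem_zero.congr huw', hj.mem_grad_r, hj.mem_grad_theta.congr ?_, hj.mem_hess_rr,
    hj.mem_hess_rtheta.congr ?_, hj.mem_hess_thetatheta.congr ?_, hj.mem_weight.congr ?_⟩, ?_⟩
  iterate 4
    filter_upwards [huw'] with r hr
    rw [hr]
  filter_upwards [huw, hg, hgh] with r h1 h2 h3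
  rw [← h3, h2, h1]

/-! ### The mode operators in `L²_r` -/

/-- The Hilbert space `L²_r` of real functions. -/
abbrev L2r : Type := Lp ℝ 2 radialMeasure

theorem inner_L2r (u w : L2r) : inner ℝ u w = ∫ r, u r * w r ∂radialMeasure := by
  rw [L2.inner_def]
  refine integral_congr_ae (ae_of_all _ fun r => ?_)
  simp [mul_comm]

/-- The class in `L²_r` of a square integrable function. -/
noncomputable def MemL2r.toL2r {u : ℝ → ℝ} (hu : MemL2r u) : L2r := MemLp.toLp u hu

theorem MemL2r.coeFn_toL2r {u : ℝ → ℝ} (hu : MemL2r u) : hu.toL2r =ᵐ[radialMeasure] u :=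
  MemLp.coeFn_toLp _

theorem inner_toL2r {u w : ℝ → ℝ} (hu : MemL2r u) (hw : MemL2r w) :
    inner ℝ (MemL2r.toL2r hu) (MemL2r.toL2r hw) = ∫ r, u r * w r ∂radialMeasure := by
  rw [inner_L2r]
  refine integral_congr_ae ?_
  filter_upwards [MemL2r.coeFn_toL2r hu, MemL2r.coeFn_toL2r hw] with r h1 h2
  rw [h1, h2]

theorem norm_sq_toL2r {u : ℝ → ℝ} (hu : MemL2r u) :
    ‖MemL2r.toL2r hu‖ ^ 2 = ∫ r, u r ^ 2 ∂radialMeasure := by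
  rw [← real_inner_self_eq_norm_sq, inner_toL2r]
  simp only [sq]

theorem eLpNorm_sq {u : ℝ → ℝ} (hu : MemL2r u) :
    eLpNorm u 2 radialMeasure ^ 2 = ENNReal.ofReal (∫ r, u r ^ 2 ∂radialMeasure) := by
  have h : ‖MemL2r.toL2r hu‖ = (eLpNorm u 2 radialMeasure).toReal := Lp.norm_toLp u hu
  rw [← norm_sq_toL2r hu, ENNReal.ofReal_pow (norm_nonneg _), h,
    ENNReal.ofReal_toReal (MemLp.eLpNorm_ne_top hu)]

theorem memL2r_coe (u : L2r) : MemL2r u := Lp.memLp u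

/-- The graph of `-Δ_m + r² - lam` in `L²_r`. -/
noncomputable def modeGraph (m : ℤ) (lam : ℝ) : Submodule ℝ (L2r × L2r) where
  carrier := {p | IsModeLaplacian m p.1 (fun r => (r ^ 2 - lam) * p.1 r - p.2 r)}
  zero_mem' := by
    -- The zero function is obtained as the image of a ground mode under the zero functional.
    refine ((isModeLaplacian_groundMode (m := m) rfl).map
      (0 : ℝ →L[ℝ] ℝ)).congr ?_ ?_
    · filter_upwards [Lp.coeFn_zero ℝ 2 radialMeasure] with r hr
      exact hr.symm
    · filter_upwards [Lp.coeFn_zero ℝ 2 radialMeasure] with r hr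
      change (0 : ℝ) = (r ^ 2 - lam) * (0 : L2r) r - (0 : L2r) r
      rw [hr, Pi.zero_apply, mul_zero, sub_zero]
  add_mem' := fun {p q} hp hq => by
    refine (IsModeLaplacian.add hp hq).congr ?_ ?_
    · filter_upwards [Lp.coeFn_add p.1 q.1] with r hr
      exact hr.symm
    · filter_upwards [Lp.coeFn_add p.1 q.1, Lp.coeFn_add p.2 q.2] with r hr hr'
      simp only [Prod.fst_add, Prod.snd_add, hr, hr', Pi.add_apply]
      ring
  smul_mem' := fun c p hp => by
    refine (IsModeLaplacian.map (c • ContinuousLinearMap.id ℝ ℝ) hp).congr ?_ ?_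
    · filter_upwards [Lp.coeFn_smul c p.1] with r hr
      exact hr.symm
    · filter_upwards [Lp.coeFn_smul c p.1, Lp.coeFn_smul c p.2] with r hr hr'
      simp only [Prod.smul_fst, Prod.smul_snd, hr, hr', Pi.smul_apply, smul_eq_mul,
        smul_apply, ContinuousLinearMap.id_apply]
      ring

theorem mem_modeGraph {m : ℤ} {lam : ℝ} {u f : L2r} : (u, f) ∈ modeGraph m lam ↔
    IsModeLaplacian m u (fun r => (r ^ 2 - lam) * u r - f r) := Iff.rfl

theorem modeGraph_symmetric {m : ℤ} {lam : ℝ} (u f w h : L2r) (hu : (u, f) ∈ modeGraph m lam)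
    (hw : (w, h) ∈ modeGraph m lam) : inner ℝ f w = inner ℝ u h := by
  rw [mem_modeGraph] at hu hw
  have e := hu.symmetric hw
  have i1 := MemLp.integrable_mul (p := 2) (q := 2) hu.memL2r (memL2r_coe w)
  have i2 := MemLp.integrable_mul (p := 2) (q := 2) (memL2r_coe u) hw.memL2r
  have i3 := MemLp.integrable_mul (p := 2) (q := 2) (memL2r_coe f) (memL2r_coe w)
  have i4 := MemLp.integrable_mul (p := 2) (q := 2) (memL2r_coe u) (memL2r_coe h)
  have e1 := integral_sub i3 i4
  have e2 := integral_sub i2 i1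
  simp only [Pi.mul_apply] at e1 e2
  have e3 : ∫ r, f r * w r - u r * h r ∂radialMeasure =
      ∫ r, u r * ((r ^ 2 - lam) * w r - h r) - ((r ^ 2 - lam) * u r - f r) * w r ∂radialMeasure := by
    congr 1
    ext r
    ring
  rw [inner_L2r, inner_L2r]
  linarith

/-- The class of the ground mode `e_{n,0}` in `L²_r`. -/
noncomputable def groundVec (n : ℕ) : L2r := MemL2r.toL2r (memL2r_groundMode n)

theorem coeFn_groundVec (n : ℕ) : groundVec n =ᵐ[radialMeasure] groundMode n :=
  MemL2r.coeFn_toL2r _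

theorem groundVec_mem_modeGraph {m : ℤ} {n : ℕ} (hm : m.natAbs = n) :
    (groundVec n, (0 : L2r)) ∈ modeGraph m (2 * ((n : ℝ) + 1)) := by
  refine (isModeLaplacian_groundMode hm).congr ?_ ?_
  · filter_upwards [coeFn_groundVec n] with r hr using hr.symm
  · filter_upwards [coeFn_groundVec n, Lp.coeFn_zero ℝ 2 radialMeasure] with r hr hr'
    rw [hr, hr', Pi.zero_apply, sub_zero]

theorem exists_mem_modeGraph {m : ℤ} {n : ℕ} (hm : m.natAbs = n) {f : L2r}
    (hf : inner ℝ (groundVec n) f = 0) : ∃ u : L2r, (u, f) ∈ modeGraph m (2 * ((n : ℝ) + 1)) := by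
  have h0 : ∫ r, f r * groundMode n r ∂radialMeasure = 0 := by
    rw [← hf, inner_L2r]
    refine integral_congr_ae ?_
    filter_upwards [coeFn_groundVec n] with r hr
    rw [hr, mul_comm]
  obtain ⟨u, hu⟩ := exists_isModeLaplacian hm (memL2r_coe f) h0
  refine ⟨MemL2r.toL2r hu.mem, hu.congr ?_ ?_⟩
  · filter_upwards [MemL2r.coeFn_toL2r hu.mem] with r hr using hr.symm
  · filter_upwards [MemL2r.coeFn_toL2r hu.mem] with r hr
    rw [hr]

/-- Test the equation against `u` and discard the nonnegative term `∫ r² u²`. -/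
theorem modeGraph_energy {m : ℤ} {lam : ℝ} {u f : L2r} (h : (u, f) ∈ modeGraph m lam) :
    ∃ u₁ : ℝ → ℝ, HasWeakDeriv (u : ℝ → ℝ) u₁ ∧ MemL2r u₁ ∧ MemL2r (fun r => ((m : ℝ) / r) • u r) ∧
      (∫ r, u₁ r ^ 2 ∂radialMeasure) + ∫ r, (((m : ℝ) / r) • u r) ^ 2 ∂radialMeasure ≤
        inner ℝ f u + lam * ‖u‖ ^ 2 := by
  obtain ⟨u₁, u₂, hj, hg⟩ := mem_modeGraph.1 h
  refine ⟨u₁, hj.weak_deriv, hj.mem_grad_r, hj.mem_grad_theta, ?_⟩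
  have e := hj.integral_laplacian_mul hj
  have hgL := (mem_modeGraph.1 h).memL2r
  have i1 := MemLp.integrable_mul (p := 2) (q := 2) hgL (memL2r_coe u)
  have i2 := MemLp.integrable_mul (p := 2) (q := 2) (memL2r_coe f) (memL2r_coe u)
  have i3 := MemLp.integrable_mul (p := 2) (q := 2) (memL2r_coe u) (memL2r_coe u)
  have e1 : ∫ r, ((r ^ 2 - lam) * u r - f r) * u r ∂radialMeasure =
      ∫ r, (u₂ r + (1 / r) • u₁ r - ((m : ℝ) ^ 2 / r ^ 2) • u r) * u r ∂radialMeasure :=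
    integral_congr_ae (by filter_upwards [hg] with r hr; rw [hr])
  rw [← e1] at e
  have e2 : -∫ r, ((r ^ 2 - lam) * u r - f r) * u r ∂radialMeasure ≤
      (∫ r, f r * u r ∂radialMeasure) + lam * ∫ r, u r * u r ∂radialMeasure := by
    have e3 := integral_add i2 (i3.const_mul lam)
    simp only [Pi.mul_apply] at e3
    rw [← integral_const_mul, ← e3, ← integral_neg]
    refine integral_mono i1.neg (i2.add (i3.const_mul lam)) fun r => ?_
    change -(((r ^ 2 - lam) * u r - f r) * u r) ≤ f r * u r + lam * (u r * u r)
    nlinarith [sq_nonneg (r * u r)]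
  rw [← real_inner_self_eq_norm_sq, inner_L2r, inner_L2r]
  simp only [sq] at e e2 ⊢
  linarith

theorem exists_mode_resolvent {m : ℤ} {n : ℕ} (hm : m.natAbs = n) :
    ∃ G : L2r →L[ℝ] L2r, (∀ f, inner ℝ (groundVec n) (G f) = 0) ∧
      ∀ f, inner ℝ (groundVec n) f = 0 → (G f, f) ∈ modeGraph m (2 * ((n : ℝ) + 1)) := by
  have hmem : ∀ f : L2r, f ∈ (Submodule.span ℝ {groundVec n})ᗮ ↔ inner ℝ (groundVec n) f = 0 :=
    fun f => Submodule.mem_orthogonal_singleton_iff_inner_right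
  obtain ⟨G, h1, h2, -⟩ := exists_reduced_resolvent (modeGraph m (2 * ((n : ℝ) + 1)))
    modeGraph_symmetric (Submodule.span ℝ {groundVec n}) (by
      intro p hp
      obtain ⟨a, rfl⟩ := Submodule.mem_span_singleton.1 hp
      simpa using (modeGraph m _).smul_mem a (groundVec_mem_modeGraph hm))
    (fun f hf => exists_mem_modeGraph hm ((hmem f).1 hf))
  exact ⟨G, fun f => (hmem _).1 (h1 f), fun f hf => h2 f ((hmem f).2 hf)⟩

/-- Multiplication by a bounded function. -/
theorem exists_mulOp {q : ℝ → ℝ} (hq : AEStronglyMeasurable q radialMeasure) {B : ℝ} (hB0 : 0 ≤ B)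
    (hB : ∀ᵐ r ∂radialMeasure, |q r| ≤ B) :
    ∃ M : L2r →L[ℝ] L2r, (∀ u : L2r, ∀ᵐ r ∂radialMeasure, M u r = q r * u r) ∧ ‖M‖ ≤ B ∧
      ∀ u w : L2r, inner ℝ (M u) w = inner ℝ u (M w) := by
  have hle : ∀ u : L2r, ∀ᵐ r ∂radialMeasure, ‖q r * u r‖ ≤ B * ‖u r‖ := fun u => by
    filter_upwards [hB] with r hr
    rw [norm_mul, Real.norm_eq_abs]
    gcongr
  have hmem : ∀ u : L2r, MemL2r fun r => q r * u r := fun u =>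
    MemLp.of_le_mul (memL2r_coe u) (hq.mul (memL2r_coe u).1) (hle u)
  let M₀ : L2r →ₗ[ℝ] L2r :=
    { toFun := fun u => MemL2r.toL2r (hmem u)
      map_add' := fun u w => by
        ext1
        filter_upwards [MemL2r.coeFn_toL2r (hmem (u + w)), MemL2r.coeFn_toL2r (hmem u),
          MemL2r.coeFn_toL2r (hmem w), Lp.coeFn_add u w, Lp.coeFn_add (MemL2r.toL2r (hmem u))
            (MemL2r.toL2r (hmem w))] with r h1 h2 h3 h4 h5
        rw [h1, h5, Pi.add_apply, h2, h3, h4, Pi.add_apply, mul_add]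
      map_smul' := fun c u => by
        ext1
        filter_upwards [MemL2r.coeFn_toL2r (hmem (c • u)), MemL2r.coeFn_toL2r (hmem u),
          Lp.coeFn_smul c u, Lp.coeFn_smul c (MemL2r.toL2r (hmem u))] with r h1 h2 h3 h4
        rw [h1, RingHom.id_apply, h4, Pi.smul_apply, h2, h3, Pi.smul_apply, smul_eq_mul,
          smul_eq_mul]
        ring }
  have hM₀ : ∀ u, ∀ᵐ r ∂radialMeasure, M₀ u r = q r * u r := fun u => MemL2r.coeFn_toL2r (hmem u)
  refine ⟨M₀.mkContinuous B fun u => Lp.norm_le_mul_norm_of_ae_le_mul ?_, hM₀,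
    M₀.mkContinuous_norm_le hB0 _, fun u w => ?_⟩
  · filter_upwards [hM₀ u, hle u] with r h1 h2
    rw [h1]
    exact h2
  · rw [inner_L2r, inner_L2r]
    refine integral_congr_ae ?_
    filter_upwards [hM₀ u, hM₀ w] with r h1 h2
    change M₀ u r * w r = u r * M₀ w r
    rw [h1, h2]
    ring

/-- In modes `m ≠ 0` the supremum and the `H¹_r` norm of a solution are bounded by the data. -/
theorem modeGraph_bound {m : ℤ} (hm : m ≠ 0) {lam B : ℝ} {u f : L2r}
    (h : (u, f) ∈ modeGraph m lam) (hB0 : 0 ≤ B)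
    (hB : ‖u‖ ^ 2 + inner ℝ f u + lam * ‖u‖ ^ 2 ≤ B ^ 2) :
    (∀ᵐ r ∂radialMeasure, |u r| ≤ B) ∧ ModeH1NormLE m (u : ℝ → ℝ) B := by
  obtain ⟨u₁, h1, h2, h3, h4⟩ := modeGraph_energy h
  have hu2 : ‖u‖ ^ 2 = ∫ r, u r ^ 2 ∂radialMeasure := by
    rw [← real_inner_self_eq_norm_sq, inner_L2r]
    simp only [sq]
  constructor
  · filter_upwards [h1.sq_le hm h2 h3] with r hr
    refine abs_le_of_sq_le_sq ?_ hB0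
    nlinarith [sq_nonneg ‖u‖]
  · refine ⟨u₁, h1, memL2r_coe u, h2, h3, ?_⟩
    rw [eLpNorm_sq (memL2r_coe u), eLpNorm_sq h2, eLpNorm_sq h3, ← ENNReal.ofReal_pow hB0,
      ← ENNReal.ofReal_add (by positivity) (by positivity),
      ← ENNReal.ofReal_add (by positivity) (by positivity)]
    refine ENNReal.ofReal_le_ofReal ?_
    linarith

theorem ModeH1NormLE.bounds {m : ℤ} (hm : m ≠ 0) {u : ℝ → ℝ} {B : ℝ} (hB0 : 0 ≤ B)
    (h : ModeH1NormLE m u B) :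
    (∀ᵐ r ∂radialMeasure, |u r| ≤ B) ∧ ∃ hu : MemL2r u, ‖MemL2r.toL2r hu‖ ≤ B := by
  obtain ⟨u₁, h1, h2, h3, h4, h5⟩ := h
  rw [eLpNorm_sq h2, eLpNorm_sq h3, eLpNorm_sq h4, ← ENNReal.ofReal_pow hB0,
      ← ENNReal.ofReal_add (by positivity) (by positivity),
      ← ENNReal.ofReal_add (by positivity) (by positivity),
      ENNReal.ofReal_le_ofReal_iff (by positivity)] at h5
  have p1 : 0 ≤ ∫ r, u r ^ 2 ∂radialMeasure := by positivity
  have p2 : 0 ≤ ∫ r, u₁ r ^ 2 ∂radialMeasure := by positivity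
  have p3 : 0 ≤ ∫ r, (((m : ℝ) / r) • u r) ^ 2 ∂radialMeasure := by positivity
  constructor
  · filter_upwards [h1.sq_le hm h3 h4] with r hr
    exact abs_le_of_sq_le_sq (by linarith) hB0
  · refine ⟨h2, le_of_sq_le_sq ?_ hB0⟩
    rw [norm_sq_toL2r]
    linarith

theorem ModeH1NormLE.mono {m : ℤ} {u : ℝ → ℝ} {B B' : ℝ} (h : ModeH1NormLE m u B) (hB : B ≤ B') :
    ModeH1NormLE m u B' := by
  obtain ⟨u₁, h1, h2, h3, h4, h5⟩ := h
  exact ⟨u₁, h1, h2, h3, h4, h5.trans (by gcongr)⟩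

/-! ### Integrals of products of ground modes -/

theorem integral_pow_mul_exp_neg_mul_sq (N : ℕ) {b : ℝ} (hb : 0 < b) :
    ∫ r in Ioi (0 : ℝ), r ^ (2 * N + 1) * Real.exp (-b * r ^ 2) =
      (N.factorial : ℝ) / (2 * b ^ (N + 1)) := by
  have h := integral_rpow_mul_exp_neg_mul_rpow (p := 2) (q := 2 * (N : ℝ) + 1) (b := b)
    (by norm_num) (by linarith [Nat.cast_nonneg (α := ℝ) N]) hb
  have e : (2 * (N : ℝ) + 1 + 1) / 2 = (N : ℝ) + 1 := by ring
  have e' : -(2 * (N : ℝ) + 1 + 1) / 2 = -((N + 1 : ℕ) : ℝ) := by push_cast; ring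
  rw [e, e', Real.Gamma_nat_eq_factorial, Real.rpow_neg hb.le, Real.rpow_natCast] at h
  rw [show (N.factorial : ℝ) / (2 * b ^ (N + 1)) = (b ^ (N + 1))⁻¹ * (1 / 2) * N.factorial by
    field_simp, ← h]
  refine setIntegral_congr_fun measurableSet_Ioi fun r hr => ?_
  have e1 : r ^ (2 * (N : ℝ) + 1) = r ^ (2 * N + 1) := by
    rw [← Real.rpow_natCast]
    push_cast
    rfl
  simp only [e1, Real.rpow_two]

theorem integral_groundMode_sq (n : ℕ) : ∫ r, groundMode n r ^ 2 ∂radialMeasure = 1 := by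
  rw [integral_radialMeasure]
  have e : ∀ r : ℝ, r * groundMode n r ^ 2 =
      2 / (n.factorial : ℝ) * (r ^ (2 * n + 1) * Real.exp (-1 * r ^ 2)) := fun r => by
    have h1 : Real.exp (-r ^ 2 / 2) ^ 2 = Real.exp (-1 * r ^ 2) := by
      rw [← Real.exp_nat_mul]
      congr 1
      push_cast
      ring
    rw [groundMode, mul_pow, mul_pow, div_pow, Real.sq_sqrt (by norm_num),
      Real.sq_sqrt (by positivity), h1]
    ring
  simp only [e]
  rw [integral_const_mul, integral_pow_mul_exp_neg_mul_sq n one_pos]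
  have := n.factorial_pos
  field_simp
  simp

/-- The product is a constant times `r^{2N} e^{-2r²}`; evenness of the total degree turns the Gamma
value into a factorial. -/
theorem integral_groundMode_mul {a b c d N : ℕ} (h : a + b + c + d = 2 * N) :
    ∫ r, groundMode a r * groundMode b r * (groundMode c r * groundMode d r) ∂radialMeasure =
      (N.factorial : ℝ) / (2 ^ N * (√(a.factorial : ℝ) * √(b.factorial : ℝ) *
        √(c.factorial : ℝ) * √(d.factorial : ℝ))) := by
  have ha : 0 < √(a.factorial : ℝ) := by positivity
  have hb : 0 < √(b.factorial : ℝ) := by positivity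
  have hc : 0 < √(c.factorial : ℝ) := by positivity
  have hd : 0 < √(d.factorial : ℝ) := by positivity
  rw [integral_radialMeasure]
  have e : ∀ r : ℝ, r * (groundMode a r * groundMode b r * (groundMode c r * groundMode d r)) =
      4 / (√(a.factorial : ℝ) * √(b.factorial : ℝ) * √(c.factorial : ℝ) * √(d.factorial : ℝ)) *
        (r ^ (2 * N + 1) * Real.exp (-2 * r ^ 2)) := fun r => by
    have h1 : Real.exp (-2 * r ^ 2) = Real.exp (-r ^ 2 / 2) ^ 4 := by
      rw [← Real.exp_nat_mul]
      congr 1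
      push_cast
      ring
    have h2 : (4 : ℝ) = √2 ^ 4 := by
      rw [show 4 = 2 * 2 from rfl, pow_mul, Real.sq_sqrt (by norm_num)]
      norm_num
    rw [h1, h2, ← h]
    simp only [groundMode]
    field_simp
    ring
  simp only [e]
  rw [integral_const_mul, integral_pow_mul_exp_neg_mul_sq N two_pos]
  field_simp
  ring

/-- `∫ e_{n,0}⁴ r dr`. -/
noncomputable def quarticWeight (n : ℕ) : ℝ :=
  ((2 * n).factorial : ℝ) / (4 ^ n * ((n.factorial : ℝ) * (n.factorial : ℝ)))

theorem quarticWeight_pos (n : ℕ) : 0 < quarticWeight n := by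
  unfold quarticWeight
  positivity

theorem integral_groundMode_quartic (n : ℕ) :
    ∫ r, groundMode n r ^ 2 * (groundMode n r * groundMode n r) ∂radialMeasure =
      quarticWeight n := by
  have h := integral_groundMode_mul (a := n) (b := n) (c := n) (d := n) (N := 2 * n) (by ring)
  simp only [sq]
  rw [h, quarticWeight, pow_mul, Real.mul_self_sqrt (by positivity), mul_assoc (n.factorial : ℝ),
    Real.mul_self_sqrt (by positivity)]
  norm_num

/-- This integral and the next two give the reduced matrix. With the factor `2` in front of `ψ²` and
the shift `w` from `ω`, the diagonal entries are `2w(2n+1)/(2(n+1)) - w = wn/(n+1)` and `2w - w =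
w`; the mixed integral is the off-diagonal entry, and its square is their product. -/
theorem integral_groundMode_succ (n : ℕ) :
    ∫ r, groundMode n r ^ 2 * (groundMode (n + 1) r * groundMode (n + 1) r) ∂radialMeasure =
      quarticWeight n * ((2 * n + 1) / (2 * (n + 1))) := by
  have h := integral_groundMode_mul (a := n) (b := n) (c := n + 1) (d := n + 1) (N := 2 * n + 1)
    (by ring)
  simp only [sq]
  rw [h, quarticWeight, Real.mul_self_sqrt (by positivity), mul_assoc (n.factorial : ℝ),
    Real.mul_self_sqrt (by positivity), Nat.factorial_succ, Nat.factorial_succ, pow_succ, pow_mul]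
  norm_num
  have := n.factorial_pos
  field_simp

theorem integral_groundMode_pred {n : ℕ} (hn : 1 ≤ n) :
    ∫ r, groundMode n r ^ 2 * (groundMode (n - 1) r * groundMode (n - 1) r) ∂radialMeasure =
      quarticWeight n := by
  obtain ⟨k, rfl⟩ := Nat.exists_eq_add_of_le' hn
  have h := integral_groundMode_mul (a := k + 1) (b := k + 1) (c := k) (d := k) (N := 2 * k + 1)
    (by ring)
  simp only [sq, Nat.add_sub_cancel]
  rw [h, quarticWeight, Real.mul_self_sqrt (by positivity), mul_assoc ((k + 1).factorial : ℝ),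
    Real.mul_self_sqrt (by positivity), show 2 * (k + 1) = (2 * k + 1) + 1 by ring,
    Nat.factorial_succ (2 * k + 1), Nat.factorial_succ k, pow_succ, pow_mul, pow_succ (4 : ℝ)]
  norm_num
  have := k.factorial_pos
  field_simp
  ring

theorem integral_groundMode_mixed {n : ℕ} (hn : 1 ≤ n) :
    ∫ r, groundMode n r ^ 2 * (groundMode (n + 1) r * groundMode (n - 1) r) ∂radialMeasure =
      quarticWeight n * √(n / (n + 1)) := by
  obtain ⟨k, rfl⟩ := Nat.exists_eq_add_of_le' hn
  have h := integral_groundMode_mul (a := k + 1) (b := k + 1) (c := k + 1 + 1) (d := k)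
    (N := 2 * (k + 1)) (by ring)
  have h1 : √((k + 1 + 1).factorial : ℝ) * √(k.factorial : ℝ) * √(((k + 1 : ℕ) : ℝ) / ((k + 1 : ℕ) + 1))
      = (k + 1).factorial := by
    rw [← Real.sqrt_mul (by positivity), ← Real.sqrt_mul (by positivity),
      Real.sqrt_eq_iff_mul_self_eq_of_pos (by positivity)]
    push_cast [Nat.factorial_succ]
    field_simp
  simp only [sq, Nat.add_sub_cancel]
  rw [h, quarticWeight, Real.mul_self_sqrt (by positivity), pow_mul]
  have hp : 0 < √((k + 1 + 1).factorial : ℝ) * √(k.factorial : ℝ) := by positivity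
  rw [mul_assoc ((k + 1).factorial : ℝ)]
  norm_num only
  rw [div_mul_eq_mul_div, div_eq_div_iff (by positivity) (by positivity)]
  calc _ = ((2 * (k + 1)).factorial : ℝ) * 4 ^ (k + 1) * (k + 1).factorial *
        (√((k + 1 + 1).factorial : ℝ) * √(k.factorial : ℝ) *
          √(((k + 1 : ℕ) : ℝ) / ((k + 1 : ℕ) + 1))) := by rw [h1]; ring
    _ = _ := by ring

theorem exists_groundMode_le (n : ℕ) : ∃ k : ℝ, 1 ≤ k ∧ ∀ r, 0 ≤ r → groundMode n r ≤ k := by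
  have hC := groundMode_const_pos n
  refine ⟨√2 / √(n.factorial : ℝ) * (n.factorial * Real.exp 1) + 1,
    le_add_of_nonneg_left (by positivity), fun r hr => le_add_of_le_of_nonneg ?_ zero_le_one⟩
  rw [groundMode, mul_assoc]
  refine mul_le_mul_of_nonneg_left ?_ hC.le
  have h1 : r ^ n ≤ n.factorial * Real.exp r := by
    have := Real.pow_div_factorial_le_exp r hr n
    rwa [div_le_iff₀' (by positivity)] at this
  calc r ^ n * Real.exp (-r ^ 2 / 2)
      ≤ n.factorial * Real.exp r * Real.exp (-r ^ 2 / 2) := by gcongr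
    _ = n.factorial * Real.exp (r + -r ^ 2 / 2) := by rw [mul_assoc, Real.exp_add]
    _ ≤ n.factorial * Real.exp 1 := by
      gcongr
      nlinarith [sq_nonneg (r - 1)]

theorem norm_groundVec (n : ℕ) : ‖groundVec n‖ = 1 := by
  have h : ‖groundVec n‖ ^ 2 = 1 := by
    rw [groundVec, norm_sq_toL2r, integral_groundMode_sq]
  nlinarith [norm_nonneg (groundVec n)]

/-! ### Existence of the primary branch -/

/-- Lyapunov–Schmidt for `T u = δ u - N u` with `u = a e + p`. The frequency shift `δ` is read off
from the component along `e`, which makes the right-hand side orthogonal to `e` when `p` is; then `p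
= G f` is a fixed point problem on the ball of radius `a`. -/
theorem exists_reduced_fixedPoint {E : Type*} [NormedAddCommGroup E] [InnerProductSpace ℝ E]
    [CompleteSpace E] (G : E →L[ℝ] E) {e : E} (he : ‖e‖ = 1) {N : E → E} {L a : ℝ} (ha : 0 < a)
    (hL : 0 ≤ L) (hN0 : N 0 = 0) (hN : ∀ u w, ‖N u - N w‖ ≤ L * ‖u - w‖) (hGL : 6 * ‖G‖ * L ≤ 1) :
    ∃ (p f : E) (δ : ℝ), p = G f ∧ f = δ • p - N (a • e + p) + (a * δ) • e ∧
      a * δ = inner ℝ e (N (a • e + p)) ∧ ‖f‖ ≤ 6 * a * L := by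
  have hball : ∀ p, ‖p‖ ≤ a → ‖N (a • e + p)‖ ≤ 2 * a * L := fun p hp => by
    have h := hN (a • e + p) 0
    rw [hN0, sub_zero, sub_zero] at h
    have h2 : ‖a • e + p‖ ≤ 2 * a := by
      refine (norm_add_le _ _).trans ?_
      rw [norm_smul, he, Real.norm_of_nonneg ha.le]
      linarith
    nlinarith
  have hin : ∀ u, |inner ℝ e u| ≤ ‖u‖ := fun u => by
    simpa [he] using abs_real_inner_le_norm e u
  obtain ⟨δ, hδ⟩ : ∃ δ : E → ℝ, ∀ p, δ p = inner ℝ e (N (a • e + p)) / a := ⟨_, fun _ => rfl⟩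
  have hδa : ∀ p, a * δ p = inner ℝ e (N (a • e + p)) := fun p => by
    rw [hδ]
    field_simp
  have hδ1 : ∀ p, ‖p‖ ≤ a → |δ p| ≤ 2 * L := fun p hp => by
    have h := (hin _).trans (hball p hp)
    rw [hδ, abs_div, abs_of_pos ha, div_le_iff₀ ha]
    linarith
  obtain ⟨F, hF⟩ : ∃ F : E → E, ∀ p, F p = δ p • p - N (a • e + p) + (a * δ p) • e :=
    ⟨_, fun _ => rfl⟩
  have hF1 : ∀ p, ‖p‖ ≤ a → ‖F p‖ ≤ 6 * a * L := fun p hp => by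
    have h1 := hδ1 p hp
    have h2 := hball p hp
    rw [hF]
    refine (norm_add_le _ _).trans ?_
    refine (add_le_add (norm_sub_le _ _) le_rfl).trans ?_
    rw [norm_smul, norm_smul, he, Real.norm_eq_abs, Real.norm_eq_abs, abs_mul, abs_of_pos ha]
    have h3 : |δ p| * ‖p‖ ≤ 2 * L * a := mul_le_mul h1 hp (norm_nonneg _) (by positivity)
    have h4 : a * |δ p| ≤ a * (2 * L) := by gcongr
    linarith
  have hF2 : ∀ p q, ‖p‖ ≤ a → ‖q‖ ≤ a → ‖F p - F q‖ ≤ 5 * L * ‖p - q‖ := fun p q hp hq => by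
    have h1 := hδ1 p hp
    have h2 : ‖N (a • e + p) - N (a • e + q)‖ ≤ L * ‖p - q‖ := by
      simpa using hN (a • e + p) (a • e + q)
    have h3 : a * |δ p - δ q| ≤ L * ‖p - q‖ := by
      calc a * |δ p - δ q| = |a * (δ p - δ q)| := by rw [abs_mul, abs_of_pos ha]
        _ = |inner ℝ e (N (a • e + p) - N (a • e + q))| := by
          rw [mul_sub, hδa, hδa, ← inner_sub_right]
        _ ≤ L * ‖p - q‖ := (hin _).trans h2
    have h4 : F p - F q = δ p • (p - q) + (δ p - δ q) • q - (N (a • e + p) - N (a • e + q)) +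
        (a * (δ p - δ q)) • e := by
      rw [hF, hF]
      module
    rw [h4]
    refine (norm_add_le _ _).trans ?_
    refine (add_le_add ((norm_sub_le _ _).trans (add_le_add (norm_add_le _ _) le_rfl)) le_rfl).trans
      ?_
    rw [norm_smul, norm_smul, norm_smul, he, Real.norm_eq_abs, Real.norm_eq_abs, Real.norm_eq_abs,
      abs_mul, abs_of_pos ha]
    have h5 : |δ p| * ‖p - q‖ ≤ 2 * L * ‖p - q‖ := by gcongr
    have h6 : |δ p - δ q| * ‖q‖ ≤ |δ p - δ q| * a := by gcongr
    linarith
  have hle : ∀ u : E, ‖G u‖ ≤ ‖G‖ * ‖u‖ := G.le_opNorm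
  have hmaps : MapsTo (fun p => G (F p)) (Metric.closedBall 0 a) (Metric.closedBall 0 a) := by
    intro p hp
    rw [mem_closedBall_zero_iff] at hp ⊢
    have h1 := hF1 p hp
    have h2 := hle (F p)
    have h3 : ‖G‖ * ‖F p‖ ≤ ‖G‖ * (6 * a * L) := by gcongr
    have h4 : (6 * ‖G‖ * L) * a ≤ 1 * a := by gcongr
    linarith
  have hK : ((5 / 6 : NNReal) : ℝ) = 5 / 6 := by norm_num
  -- The map before `G` is `5L`-Lipschitz and `6 ‖G‖ L ≤ 1`, whence the ratio `5/6`.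
  have hcon : ContractingWith (5 / 6 : NNReal) (hmaps.restrict (fun p => G (F p)) _ _) := by
    refine ⟨by rw [← NNReal.coe_lt_coe]; norm_num, LipschitzWith.of_dist_le_mul ?_⟩
    rw [hK]
    rintro ⟨p, hp⟩ ⟨q, hq⟩
    rw [mem_closedBall_zero_iff] at hp hq
    change dist (G (F p)) (G (F q)) ≤ 5 / 6 * dist p q
    rw [dist_eq_norm, dist_eq_norm, ← map_sub]
    have h1 := hF2 p q hp hq
    have h3 : ‖G‖ * ‖F p - F q‖ ≤ ‖G‖ * (5 * L * ‖p - q‖) := by gcongr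
    have h4 : (6 * ‖G‖ * L) * ‖p - q‖ ≤ 1 * ‖p - q‖ := by gcongr
    linarith [hle (F p - F q)]
  obtain ⟨p, hp, hfix, -⟩ := hcon.exists_fixedPoint' Metric.isClosed_closedBall.isComplete hmaps
    (Metric.mem_closedBall_self ha.le) (edist_ne_top _ _)
  exact ⟨p, F p, δ p, hfix.symm, hF p, hδa p, hF1 p (mem_closedBall_zero_iff.1 hp)⟩

/-- The cubic nonlinearity truncated at height `b`. -/
theorem exists_truncated_cube {b : ℝ} (hb : 0 ≤ b) :
    ∃ N : L2r → L2r, N 0 = 0 ∧ (∀ u w, ‖N u - N w‖ ≤ 3 * b ^ 2 * ‖u - w‖) ∧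
      ∀ u : L2r, (∀ᵐ r ∂radialMeasure, |u r| ≤ b) → ∀ᵐ r ∂radialMeasure, N u r = u r ^ 3 := by
  obtain ⟨χ, hχ⟩ : ∃ χ : ℝ → ℝ, ∀ x, χ x = (max (-b) (min b x)) ^ 3 := ⟨_, fun _ => rfl⟩
  have hχ0 : χ 0 = 0 := by
    rw [hχ, min_eq_right hb, max_eq_right (by linarith)]
    norm_num
  have hlip : LipschitzWith (⟨3 * b ^ 2, by positivity⟩ : NNReal) χ := by
    refine LipschitzWith.of_dist_le_mul fun x y => ?_
    change |χ x - χ y| ≤ 3 * b ^ 2 * |x - y|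
    rw [hχ, hχ]
    have h1 : |max (-b) (min b x) - max (-b) (min b y)| ≤ |x - y| :=
      (abs_max_sub_max_le_max _ _ _ _).trans (by
        rw [sub_self, abs_zero, max_eq_right (abs_nonneg _)]
        refine (abs_min_sub_min_le_max _ _ _ _).trans ?_
        rw [sub_self, abs_zero, max_eq_right (abs_nonneg _)])
    obtain ⟨s, hs⟩ : ∃ s, s = max (-b) (min b x) := ⟨_, rfl⟩
    obtain ⟨t, ht⟩ : ∃ t, t = max (-b) (min b y) := ⟨_, rfl⟩
    have hs1 : |s| ≤ b := by
      rw [hs]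
      exact abs_le.2 ⟨le_max_left _ _, max_le (by linarith) (min_le_left _ _)⟩
    have ht1 : |t| ≤ b := by
      rw [ht]
      exact abs_le.2 ⟨le_max_left _ _, max_le (by linarith) (min_le_left _ _)⟩
    rw [← hs, ← ht] at h1 ⊢
    have h2 : |s ^ 2 + s * t + t ^ 2| ≤ 3 * b ^ 2 := by
      have hs2 := sq_le_sq' (abs_le.1 hs1).1 (abs_le.1 hs1).2
      have ht2 := sq_le_sq' (abs_le.1 ht1).1 (abs_le.1 ht1).2
      rw [abs_le]
      constructor <;> nlinarith [sq_nonneg (s + t), sq_nonneg (s - t)]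
    rw [show s ^ 3 - t ^ 3 = (s ^ 2 + s * t + t ^ 2) * (s - t) by ring, abs_mul]
    exact mul_le_mul h2 h1 (abs_nonneg _) (by positivity)
  refine ⟨fun u => hlip.compLp hχ0 u, ?_, fun u w => hlip.norm_compLp_sub_le hχ0 u w,
    fun u hu => ?_⟩
  · ext1
    filter_upwards [hlip.coeFn_compLp hχ0 (0 : L2r), Lp.coeFn_zero ℝ 2 radialMeasure] with r h1 h2
    rw [h1, Function.comp_apply, h2, Pi.zero_apply, hχ0]
  · filter_upwards [hlip.coeFn_compLp hχ0 u, hu] with r h1 h2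
    rw [h1, Function.comp_apply, hχ, min_eq_right (abs_le.1 h2).2, max_eq_right (abs_le.1 h2).1]

theorem ModeH1NormLE.congr {m : ℤ} {u w : ℝ → ℝ} {B : ℝ} (h : ModeH1NormLE m u B)
    (huw : ∀ᵐ r ∂radialMeasure, u r = w r) : ModeH1NormLE m w B := by
  obtain ⟨u₁, h1, h2, h3, h4, h5⟩ := h
  have h' : (fun r => ((m : ℝ) / r) • u r) =ᵐ[radialMeasure] fun r => ((m : ℝ) / r) • w r := by
    filter_upwards [huw] with r hr
    rw [hr]
  refine ⟨u₁, h1.congr (ae_radialMeasure_iff.1 huw) (ae_of_all _ fun _ => rfl),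
    (memLp_congr_ae huw).1 h2, h3, (memLp_congr_ae h').1 h4, ?_⟩
  rwa [← eLpNorm_congr_ae huw, ← eLpNorm_congr_ae h']

theorem exists_vortexProfile {n : ℕ} (hn : 1 ≤ n) : ∃ C : ℝ, 1 ≤ C ∧ ∀ a : ℝ, 0 < a → C * a ^ 2 ≤ 1 →
    ∃ (ψ : ℝ → ℝ) (ω : ℝ), IsVortexProfile n ψ ω ∧
      ModeH1NormLE (n : ℤ) (fun r => ψ r - a * groundMode n r) (C * a ^ 3) := by
  obtain ⟨k, hk1, hk⟩ := exists_groundMode_le n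
  obtain ⟨G, hG1, hG2⟩ := exists_mode_resolvent (m := (n : ℤ)) (n := n) (by simp)
  obtain ⟨lam, hlam⟩ : ∃ lam : ℝ, lam = 2 * ((n : ℝ) + 1) := ⟨_, rfl⟩
  have hlam0 : 0 ≤ lam := by rw [hlam]; positivity
  rw [← hlam] at hG2
  have hg0 : 0 ≤ ‖G‖ := norm_nonneg G
  have hC1 : 1 ≤ (1 + ‖G‖) * (1 + lam) := by nlinarith
  have hCG : ‖G‖ ≤ (1 + ‖G‖) * (1 + lam) := by nlinarith
  have hk2 : 1 ≤ k ^ 2 := one_le_pow₀ hk1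
  -- Truncating at height `2ak` gives the Lipschitz constant `L = 12 k² a²`, so the data satisfy
  -- `‖f‖ ≤ 6aL = 72 k² a³`. The other factor pays for the reduced resolvent and the energy
  -- estimate.
  obtain ⟨C, hC⟩ : ∃ C : ℝ, C = 72 * k ^ 2 * ((1 + ‖G‖) * (1 + lam)) := ⟨_, rfl⟩
  have hC0 : 1 ≤ C := by nlinarith
  have hCG' : 72 * k ^ 2 * ‖G‖ ≤ C := by rw [hC]; gcongr
  refine ⟨C, hC0, fun a ha hCa => ?_⟩
  obtain ⟨N, hN0, hN1, hN2⟩ := exists_truncated_cube (b := 2 * a * k) (by positivity)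
  obtain ⟨p, f, δ, hpf, hf, hδ, hfn⟩ := exists_reduced_fixedPoint G (norm_groundVec n) (N := N)
    (L := 12 * k ^ 2 * a ^ 2) ha (by positivity) hN0
    (fun u w => (hN1 u w).trans_eq (by ring)) (by
      have : 72 * k ^ 2 * ‖G‖ * a ^ 2 ≤ C * a ^ 2 := by gcongr
      linarith)
  have hpe : inner ℝ (groundVec n) p = 0 := by rw [hpf, hG1]
  have hfe : inner ℝ (groundVec n) f = 0 := by
    rw [hf, inner_add_right, inner_sub_right, real_inner_smul_right, real_inner_smul_right, hpe,
      ← hδ, real_inner_self_eq_norm_sq, norm_groundVec]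
    ring
  have hmem : (p, f) ∈ modeGraph (n : ℤ) lam := by
    rw [hpf]
    exact hG2 f hfe
  have hfn' : ‖f‖ ≤ 72 * k ^ 2 * a ^ 3 := hfn.trans_eq (by ring)
  have hpn : ‖p‖ ≤ ‖G‖ * (72 * k ^ 2 * a ^ 3) := by
    rw [hpf]
    exact (G.le_opNorm f).trans (by gcongr)
  obtain ⟨hb, hH⟩ := modeGraph_bound (by omega) hmem (B := C * a ^ 3) (by positivity) (by
    obtain ⟨t, ht⟩ : ∃ t : ℝ, t = 72 * k ^ 2 * a ^ 3 := ⟨_, rfl⟩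
    have ht0 : 0 ≤ t := by rw [ht]; positivity
    rw [show C * a ^ 3 = (1 + ‖G‖) * (1 + lam) * t by rw [hC, ht]; ring]
    rw [← ht] at hfn' hpn
    have h1 : inner ℝ f p ≤ t * (‖G‖ * t) :=
      (real_inner_le_norm f p).trans (mul_le_mul hfn' hpn (norm_nonneg _) ht0)
    have h2 : ‖p‖ ^ 2 ≤ (‖G‖ * t) ^ 2 := by gcongr
    have h3 : lam * ‖p‖ ^ 2 ≤ lam * (‖G‖ * t) ^ 2 := by gcongr
    have h4 : ‖G‖ ^ 2 + ‖G‖ + lam * ‖G‖ ^ 2 ≤ ((1 + ‖G‖) * (1 + lam)) ^ 2 := by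
      have : 0 ≤ ‖G‖ * lam := by positivity
      have : 0 ≤ ‖G‖ ^ 2 * lam := by positivity
      have : 0 ≤ ‖G‖ ^ 2 * lam ^ 2 := by positivity
      have : 0 ≤ ‖G‖ * lam ^ 2 := by positivity
      nlinarith
    have h5 := mul_le_mul_of_nonneg_right h4 (sq_nonneg t)
    linarith)
  have hCa3 : C * a ^ 3 ≤ a := by
    have : C * a ^ 2 * a ≤ 1 * a := by gcongr
    linarith
  obtain ⟨w, hw⟩ : ∃ w : L2r, w = a • groundVec n + p := ⟨_, rfl⟩
  have hwr : ∀ᵐ r ∂radialMeasure, w r = a * groundMode n r + p r := by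
    rw [hw]
    filter_upwards [Lp.coeFn_add (a • groundVec n) p, Lp.coeFn_smul a (groundVec n),
      coeFn_groundVec n] with r h1 h2 h3
    rw [h1, Pi.add_apply, h2, Pi.smul_apply, h3, smul_eq_mul]
  -- The truncation is inactive: `|w| ≤ a k + C a³ ≤ 2 a k`, using `C a² ≤ 1` and `k ≥ 1`.
  have hwb : ∀ᵐ r ∂radialMeasure, |w r| ≤ 2 * a * k := by
    filter_upwards [hwr, hb, ae_radialMeasure_pos] with r h1 h2 h3
    rw [h1]
    refine (abs_add_le _ _).trans ?_
    rw [abs_mul, abs_of_pos ha, abs_of_pos (groundMode_pos n h3)]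
    have h4 : a * groundMode n r ≤ a * k := mul_le_mul_of_nonneg_left (hk r h3.le) ha.le
    nlinarith
  have hNw := hN2 w hwb
  have hwmem : (w, f) ∈ modeGraph (n : ℤ) lam := by
    have h1 := (modeGraph (n : ℤ) lam).smul_mem a (hlam ▸ groundVec_mem_modeGraph (m := (n : ℤ))
      (n := n) (by simp))
    have h2 := (modeGraph (n : ℤ) lam).add_mem h1 hmem
    simpa [hw] using h2
  have hfw : ∀ᵐ r ∂radialMeasure, f r = δ * w r - w r ^ 3 := by
    have h1 : f = δ • w - N w := by
      rw [hf, ← hw, hw]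
      module
    rw [h1]
    filter_upwards [Lp.coeFn_sub (δ • w) (N w), Lp.coeFn_smul δ w, hNw] with r h1 h2 h3
    rw [h1, Pi.sub_apply, h2, h3, Pi.smul_apply, smul_eq_mul]
  refine ⟨w, lam + δ, ⟨_, hwmem, ?_⟩, hH.congr ?_⟩
  · filter_upwards [hfw] with r hr
    simp only [hr]
    ring
  · filter_upwards [hwr] with r hr
    rw [hr]
    ring

theorem exists_primaryBranch {n : ℕ} (hn : 1 ≤ n) :
    ∃ (ψ : ℝ → ℝ → ℝ) (ω : ℝ → ℝ), IsPrimaryBranch n ψ ω := by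
  obtain ⟨C, hC, h⟩ := exists_vortexProfile hn
  choose! ψ ω h using h
  refine ⟨ψ, ω, 1 / C, by positivity, C, fun a ha ha1 => h a ha ?_⟩
  rw [lt_div_iff₀ (by positivity)] at ha1
  have : a ≤ 1 := by nlinarith
  nlinarith

/-! ### Expansion along a primary branch -/

/-- The uniform estimate on `ψ²` follows from the supremum bound on `ψ - a e`. Pairing the profile
equation with `e` removes the linear operator and isolates `ω`; the constant is uniform in the
profile. -/
theorem branch_expansion {n : ℕ} (hn : 1 ≤ n) {D : ℝ} (hD : 1 ≤ D) : ∃ K : ℝ,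
    ∀ (a : ℝ) (ψ : ℝ → ℝ) (ω : ℝ), 0 < a → 2 * D * a ^ 2 ≤ 1 → IsVortexProfile n ψ ω →
      ModeH1NormLE (n : ℤ) (fun r => ψ r - a * groundMode n r) (D * a ^ 3) →
      |ω - 2 * ((n : ℝ) + 1) - quarticWeight n * a ^ 2| ≤ K * a ^ 4 ∧
      AEStronglyMeasurable ψ radialMeasure ∧
      ∀ᵐ r ∂radialMeasure, |ψ r ^ 2 - a ^ 2 * groundMode n r ^ 2| ≤ K * a ^ 4 := by
  obtain ⟨k, hk1, hk⟩ := exists_groundMode_le n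
  have hk0 : ∀ᵐ r ∂radialMeasure, |groundMode n r ^ 2| ≤ k ^ 2 := by
    filter_upwards [ae_radialMeasure_pos] with r hr
    rw [abs_of_nonneg (sq_nonneg _)]
    exact pow_le_pow_left₀ (groundMode_pos n hr).le (hk r hr.le) 2
  obtain ⟨M, hM, hMk, hMs⟩ := exists_mulOp (q := fun r => groundMode n r ^ 2)
    ((continuous_groundMode n).pow 2).aestronglyMeasurable (by positivity) hk0
  have hMe : inner ℝ (M (groundVec n)) (groundVec n) = quarticWeight n := by
    rw [inner_L2r, ← integral_groundMode_quartic]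
    refine integral_congr_ae ?_
    filter_upwards [hM (groundVec n), coeFn_groundVec n] with r h1 h2
    rw [h1, h2]
    ring
  have hw := quarticWeight_pos n
  obtain ⟨C₁, hC₁⟩ : ∃ C₁ : ℝ, C₁ = D * (2 * k + D) := ⟨_, rfl⟩
  have hC₁0 : 0 ≤ C₁ := by rw [hC₁]; positivity
  obtain ⟨C₂, hC₂⟩ : ∃ C₂ : ℝ, C₂ = k ^ 2 * D + C₁ * (1 + D) + quarticWeight n * D := ⟨_, rfl⟩
  have hC₂0 : 0 ≤ C₂ := by rw [hC₂]; positivity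
  refine ⟨C₁ + 2 * C₂, fun a ψ ω ha haD hψ hH => ?_⟩
  have ha1 : a ≤ 1 := by nlinarith
  have ha2 : a ^ 2 ≤ 1 := pow_le_one₀ ha.le ha1
  obtain ⟨hq, hqm, hqn⟩ := hH.bounds (by omega) (by positivity)
  obtain ⟨g, hg, hge⟩ := hψ
  have hψm := hg.mem
  have hs : ∀ᵐ r ∂radialMeasure, |ψ r ^ 2 - a ^ 2 * groundMode n r ^ 2| ≤ C₁ * a ^ 4 := by
    filter_upwards [hq, ae_radialMeasure_pos] with r h1 h2
    have h3 : |ψ r + a * groundMode n r| ≤ a * (2 * k + D) := by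
      have h4 : a * groundMode n r ≤ a * k := mul_le_mul_of_nonneg_left (hk r h2.le) ha.le
      have h5 : 0 < a * groundMode n r := mul_pos ha (groundMode_pos n h2)
      have h6 : D * a ^ 3 ≤ a * D := by
        have : D * a * a ^ 2 ≤ D * a * 1 := by gcongr
        linarith
      rw [abs_le] at h1 ⊢
      constructor <;> linarith
    rw [show ψ r ^ 2 - a ^ 2 * groundMode n r ^ 2 =
      (ψ r - a * groundMode n r) * (ψ r + a * groundMode n r) by ring, abs_mul, hC₁]
    calc _ ≤ D * a ^ 3 * (a * (2 * k + D)) := mul_le_mul h1 h3 (abs_nonneg _) (by positivity)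
      _ = _ := by ring
  have hsm : AEStronglyMeasurable (fun r => ψ r ^ 2 - a ^ 2 * groundMode n r ^ 2) radialMeasure :=
    (hψm.1.pow 2).sub (((continuous_groundMode n).pow 2).const_mul _).aestronglyMeasurable
  obtain ⟨S, hS, hSk, -⟩ := exists_mulOp hsm (by positivity) hs
  obtain ⟨u, hu⟩ : ∃ u, u = MemL2r.toL2r hψm := ⟨_, rfl⟩
  obtain ⟨q, hqd⟩ : ∃ q, q = MemL2r.toL2r hqm := ⟨_, rfl⟩
  have hur : ∀ᵐ r ∂radialMeasure, u r = ψ r := by rw [hu]; exact MemL2r.coeFn_toL2r hψm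
  have huq : u = a • groundVec n + q := by
    ext1
    filter_upwards [hur, Lp.coeFn_add (a • groundVec n) q, Lp.coeFn_smul a (groundVec n),
      coeFn_groundVec n, MemL2r.coeFn_toL2r hqm] with r h0 h1 h2 h3 h4
    rw [h0, h1, Pi.add_apply, h2, Pi.smul_apply, h3, hqd, h4, smul_eq_mul]
    ring
  rw [← hqd] at hqn
  obtain ⟨f, hf⟩ : ∃ f, f = (ω - 2 * ((n : ℝ) + 1)) • u - (a ^ 2 • M u + S u) := ⟨_, rfl⟩
  have hmem : (u, f) ∈ modeGraph (n : ℤ) (2 * ((n : ℝ) + 1)) := by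
    refine hg.congr (by filter_upwards [hur] with r hr using hr.symm) ?_
    rw [hf]
    filter_upwards [hge, hur, Lp.coeFn_sub ((ω - 2 * ((n : ℝ) + 1)) • u) (a ^ 2 • M u + S u),
      Lp.coeFn_smul (ω - 2 * ((n : ℝ) + 1)) u, Lp.coeFn_add (a ^ 2 • M u) (S u),
      Lp.coeFn_smul (a ^ 2) (M u), hM u, hS u] with r h0 h1 h2 h3 h4 h5 h6 h7
    rw [h2, Pi.sub_apply, h3, Pi.smul_apply, h4, Pi.add_apply, h5, Pi.smul_apply, h6, h7, h1]
    simp only [smul_eq_mul]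
    linarith
  have hpair := modeGraph_symmetric u f (groundVec n) 0 hmem
    (groundVec_mem_modeGraph (m := (n : ℤ)) (n := n) (by simp))
  have hin : ∀ x : L2r, |inner ℝ x (groundVec n)| ≤ ‖x‖ := fun x => by
    simpa [norm_groundVec] using abs_real_inner_le_norm x (groundVec n)
  obtain ⟨η, hη⟩ : ∃ η, η = inner ℝ q (groundVec n) := ⟨_, rfl⟩
  obtain ⟨ζ, hζ⟩ : ∃ ζ, ζ = inner ℝ (M q) (groundVec n) := ⟨_, rfl⟩
  obtain ⟨ξ, hξ⟩ : ∃ ξ, ξ = inner ℝ (S u) (groundVec n) := ⟨_, rfl⟩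
  have hη1 : |η| ≤ D * a ^ 3 := by rw [hη]; exact (hin q).trans hqn
  have hζ1 : |ζ| ≤ k ^ 2 * (D * a ^ 3) := by
    rw [hζ]
    exact (hin _).trans ((M.le_opNorm q).trans (mul_le_mul hMk hqn (norm_nonneg _) (by positivity)))
  have hun : ‖u‖ ≤ (1 + D) * a := by
    rw [huq]
    refine (norm_add_le _ _).trans ?_
    rw [norm_smul, norm_groundVec, Real.norm_of_nonneg ha.le]
    have : D * a * a ^ 2 ≤ D * a * 1 := by gcongr
    linarith
  have hξ1 : |ξ| ≤ C₁ * a ^ 4 * ((1 + D) * a) := by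
    rw [hξ]
    exact (hin _).trans ((S.le_opNorm u).trans (mul_le_mul hSk hun (norm_nonneg _) (by positivity)))
  have hu1 : inner ℝ u (groundVec n) = a + η := by
    rw [huq, inner_add_left, real_inner_smul_left, real_inner_self_eq_norm_sq, norm_groundVec, hη]
    ring
  have hMu : inner ℝ (M u) (groundVec n) = a * quarticWeight n + ζ := by
    rw [huq, map_add, map_smul, inner_add_left, real_inner_smul_left, hMe, hζ]
  rw [inner_zero_right, hf, inner_sub_left, inner_add_left, real_inner_smul_left,
    real_inner_smul_left, hu1, hMu, ← hξ] at hpair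
  obtain ⟨τ, hτ⟩ : ∃ τ, τ = ω - 2 * ((n : ℝ) + 1) - quarticWeight n * a ^ 2 := ⟨_, rfl⟩
  have hkey : τ * (a + η) = a ^ 2 * ζ + ξ - quarticWeight n * a ^ 2 * η := by
    rw [hτ]
    linarith
  have hK1 : |a ^ 2 * ζ + ξ - quarticWeight n * a ^ 2 * η| ≤ C₂ * a ^ 5 := by
    have h1 : |a ^ 2 * ζ| ≤ a ^ 2 * (k ^ 2 * (D * a ^ 3)) := by
      rw [abs_mul, abs_of_pos (by positivity : 0 < a ^ 2)]
      gcongr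
    have h2 : |quarticWeight n * a ^ 2 * η| ≤ quarticWeight n * a ^ 2 * (D * a ^ 3) := by
      rw [abs_mul, abs_of_pos (by positivity : 0 < quarticWeight n * a ^ 2)]
      gcongr
    refine (abs_sub _ _).trans ((add_le_add (abs_add_le _ _) le_rfl).trans ?_)
    rw [hC₂]
    linarith
  -- Since `2 D a² ≤ 1`, the component of `ψ` along `e` is at least `a/2`, so one power of `a` can
  -- be divided out.
  have hτ1 : |τ| * (a / 2) ≤ C₂ * a ^ 5 := by
    refine le_trans ?_ hK1
    rw [← hkey, abs_mul]
    refine mul_le_mul_of_nonneg_left ?_ (abs_nonneg _)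
    have h1 : 2 * D * a ^ 2 * a ≤ 1 * a := by gcongr
    have h2 := (abs_le.1 hη1).1
    exact le_trans (by linarith) (le_abs_self _)
  refine ⟨?_, hψm.1, ?_⟩
  · rw [← hτ]
    have h1 : |τ| * a ≤ (2 * C₂ * a ^ 4) * a := by linarith
    have h2 := le_of_mul_le_mul_right h1 ha
    have h3 : 0 ≤ C₁ * a ^ 4 := by positivity
    linarith
  · filter_upwards [hs] with r hr
    have h3 : 0 ≤ C₂ * a ^ 4 := by positivity
    linarith

/-! ### Operators on pairs -/

section Pair

theorem norm_pair_le {H : Type*} [SeminormedAddCommGroup H] (v : WithLp 2 (H × H)) :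
    ‖v‖ ≤ ‖v.fst‖ + ‖v.snd‖ := by
  have h := WithLp.prod_norm_sq_eq_of_L2 v
  refine le_of_sq_le_sq ?_ (by positivity)
  nlinarith [norm_nonneg v.fst, norm_nonneg v.snd]

variable {H : Type*} [NormedAddCommGroup H] [InnerProductSpace ℝ H]

/-- The operator `(x, y) ↦ (A x + B y, B x + A y)` on pairs. -/
noncomputable def blockOp (A B : H →L[ℝ] H) : WithLp 2 (H × H) →L[ℝ] WithLp 2 (H × H) :=
  ((WithLp.prodContinuousLinearEquiv 2 ℝ H H).symm : (H × H) →L[ℝ] WithLp 2 (H × H)) ∘L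
    ((A ∘L WithLp.fstL 2 ℝ H H + B ∘L WithLp.sndL 2 ℝ H H).prod
      (B ∘L WithLp.fstL 2 ℝ H H + A ∘L WithLp.sndL 2 ℝ H H))

theorem blockOp_fst (A B : H →L[ℝ] H) (v : WithLp 2 (H × H)) :
    (blockOp A B v).fst = A v.fst + B v.snd := rfl

theorem blockOp_snd (A B : H →L[ℝ] H) (v : WithLp 2 (H × H)) :
    (blockOp A B v).snd = B v.fst + A v.snd := rfl

theorem blockOp_symmetric {A B : H →L[ℝ] H} (hA : ∀ x y, inner ℝ (A x) y = inner ℝ x (A y))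
    (hB : ∀ x y, inner ℝ (B x) y = inner ℝ x (B y)) (v w : WithLp 2 (H × H)) :
    inner ℝ (blockOp A B v) w = inner ℝ v (blockOp A B w) := by
  simp only [WithLp.prod_inner_apply, WithLp.ofLp_fst, WithLp.ofLp_snd, blockOp_fst, blockOp_snd,
    inner_add_left, inner_add_right, hA, hB]
  ring

theorem norm_blockOp_le (A B : H →L[ℝ] H) : ‖blockOp A B‖ ≤ 2 * (‖A‖ + ‖B‖) := by
  refine ContinuousLinearMap.opNorm_le_bound _ (by positivity) fun v => ?_
  refine (norm_pair_le _).trans ?_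
  rw [blockOp_fst, blockOp_snd]
  have h1 : ‖v.fst‖ ≤ ‖v‖ := WithLp.norm_fst_le _ v
  have h2 : ‖v.snd‖ ≤ ‖v‖ := WithLp.norm_snd_le _ v
  have h3 := (A.le_opNorm v.fst).trans (mul_le_mul_of_nonneg_left h1 (norm_nonneg A))
  have h4 := (A.le_opNorm v.snd).trans (mul_le_mul_of_nonneg_left h2 (norm_nonneg A))
  have h5 := (B.le_opNorm v.fst).trans (mul_le_mul_of_nonneg_left h1 (norm_nonneg B))
  have h6 := (B.le_opNorm v.snd).trans (mul_le_mul_of_nonneg_left h2 (norm_nonneg B))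
  linarith [norm_add_le (A v.fst) (B v.snd), norm_add_le (B v.fst) (A v.snd)]

variable (H) in
/-- The reflection `(x, y) ↦ (x, -y)` on pairs. -/
noncomputable def pairReflection : WithLp 2 (H × H) →L[ℝ] WithLp 2 (H × H) :=
  ((WithLp.prodContinuousLinearEquiv 2 ℝ H H).symm : (H × H) →L[ℝ] WithLp 2 (H × H)) ∘L
    ((WithLp.fstL 2 ℝ H H).prod (-WithLp.sndL 2 ℝ H H))

theorem pairReflection_fst (v : WithLp 2 (H × H)) : (pairReflection H v).fst = v.fst := rfl

theorem pairReflection_snd (v : WithLp 2 (H × H)) : (pairReflection H v).snd = -v.snd := rfl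

end Pair

/-- The graph of the decoupled pair of mode operators. -/
noncomputable def pairGraph (m m' : ℤ) (lam lam' : ℝ) :
    Submodule ℝ (WithLp 2 (L2r × L2r) × WithLp 2 (L2r × L2r)) :=
  (modeGraph m lam).comap (LinearMap.prodMap (WithLp.fstₗ 2 ℝ L2r L2r) (WithLp.fstₗ 2 ℝ L2r L2r)) ⊓
    (modeGraph m' lam').comap
      (LinearMap.prodMap (WithLp.sndₗ 2 ℝ L2r L2r) (WithLp.sndₗ 2 ℝ L2r L2r))

theorem mem_pairGraph {m m' : ℤ} {lam lam' : ℝ} {u f : WithLp 2 (L2r × L2r)} :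
    (u, f) ∈ pairGraph m m' lam lam' ↔
      (u.fst, f.fst) ∈ modeGraph m lam ∧ (u.snd, f.snd) ∈ modeGraph m' lam' := Iff.rfl

theorem pairGraph_symmetric {m m' : ℤ} {lam lam' : ℝ} (u f w h : WithLp 2 (L2r × L2r))
    (hu : (u, f) ∈ pairGraph m m' lam lam') (hw : (w, h) ∈ pairGraph m m' lam lam') :
    inner ℝ f w = inner ℝ u h := by
  rw [mem_pairGraph] at hu hw
  rw [WithLp.prod_inner_apply, WithLp.prod_inner_apply]
  exact congrArg₂ (· + ·) (modeGraph_symmetric _ _ _ _ hu.1 hw.1)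
    (modeGraph_symmetric _ _ _ _ hu.2 hw.2)

/-- The graph of the real block of the Hessian in the modes `n + 1` and `1 - n`: the pair `(x, y)`
belongs to the domain and is mapped to `(f, g)`. -/
def RealHessian (n : ℕ) (ψ : ℝ → ℝ) (ω Ω : ℝ) (x y f g : ℝ → ℝ) : Prop :=
  IsModeLaplacian ((n : ℤ) + 1) x
      (fun r => (r ^ 2 - ω + 2 * ψ r ^ 2 - Ω) * x r + ψ r ^ 2 * y r - f r) ∧
    IsModeLaplacian (1 - (n : ℤ)) y
      (fun r => (r ^ 2 - ω + 2 * ψ r ^ 2 + Ω) * y r + ψ r ^ 2 * x r - g r)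

/-! ### The real Hessian block as a bounded perturbation of the decoupled pair. -/

theorem coeFn_smul_add (c : ℝ) (u w : L2r) :
    ∀ᵐ r ∂radialMeasure, (c • u + w : L2r) r = c * u r + w r := by
  filter_upwards [Lp.coeFn_add (c • u) w, Lp.coeFn_smul c u] with r h1 h2
  rw [h1, Pi.add_apply, h2, Pi.smul_apply, smul_eq_mul]

/-- One row of the coupled system, rewritten as an unperturbed mode equation with every
`ε`-dependent term moved into the data. `E` is the leading part of `ψ²/ε`, `q` its remainder, and `c
+ t` the rescaled shift of the spectral parameter. -/
theorem mode_equation_iff {m : ℤ} {lam lam' ε c t : ℝ} {E q p : ℝ → ℝ} {M Q : L2r →L[ℝ] L2r}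
    (hM : ∀ u : L2r, ∀ᵐ r ∂radialMeasure, M u r = E r * u r)
    (hQ : ∀ u : L2r, ∀ᵐ r ∂radialMeasure, Q u r = q r * u r)
    (hp : ∀ᵐ r ∂radialMeasure, p r = ε * (E r + q r)) (hl : lam' = lam + ε * (c + t))
    (x y f : L2r) :
    (x, f - ε • (((2 : ℝ) • M x + M y) - c • x + ((2 : ℝ) • Q x + Q y) - t • x)) ∈
        modeGraph m lam ↔
      IsModeLaplacian m x (fun r => (r ^ 2 - lam' + 2 * p r) * x r + p r * y r - f r) := by
  have e : f - ε • (((2 : ℝ) • M x + M y) - c • x + ((2 : ℝ) • Q x + Q y) - t • x) =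
      (-(2 * ε)) • M x + ((-ε) • M y + ((-(2 * ε)) • Q x + ((-ε) • Q y +
        ((ε * (c + t)) • x + f)))) := by
    module
  have hae : ∀ᵐ r ∂radialMeasure, (r ^ 2 - lam) * x r -
      (f - ε • (((2 : ℝ) • M x + M y) - c • x + ((2 : ℝ) • Q x + Q y) - t • x) : L2r) r =
        (r ^ 2 - lam' + 2 * p r) * x r + p r * y r - f r := by
    rw [e]
    filter_upwards [hM x, hM y, hQ x, hQ y, hp, coeFn_smul_add (ε * (c + t)) x f,
      coeFn_smul_add (-ε) (Q y) ((ε * (c + t)) • x + f),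
      coeFn_smul_add (-(2 * ε)) (Q x) ((-ε) • Q y + ((ε * (c + t)) • x + f)),
      coeFn_smul_add (-ε) (M y) ((-(2 * ε)) • Q x + ((-ε) • Q y + ((ε * (c + t)) • x + f))),
      coeFn_smul_add (-(2 * ε)) (M x) ((-ε) • M y + ((-(2 * ε)) • Q x + ((-ε) • Q y +
        ((ε * (c + t)) • x + f))))] with r h1 h2 h3 h4 h5 h6 h7 h8 h9 h10
    rw [h10, h9, h8, h7, h6, h1, h2, h3, h4, h5, hl]
    ring
  rw [mem_modeGraph]
  exact ⟨fun h => h.congr (ae_of_all _ fun _ => rfl) hae,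
    fun h => h.congr (ae_of_all _ fun _ => rfl) (hae.mono fun _ hr => hr.symm)⟩

theorem inner_mulOp_groundVec {E : ℝ → ℝ} {M : L2r →L[ℝ] L2r}
    (hM : ∀ u : L2r, ∀ᵐ r ∂radialMeasure, M u r = E r * u r) (j k : ℕ) :
    inner ℝ (groundVec j) (M (groundVec k)) =
      ∫ r, E r * (groundMode j r * groundMode k r) ∂radialMeasure := by
  rw [inner_L2r]
  refine integral_congr_ae ?_
  filter_upwards [hM (groundVec k), coeFn_groundVec j, coeFn_groundVec k] with r h1 h2 h3
  rw [h1, h2, h3]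
  ring

/-- The abstract reduction applied to the modes `n + 1` and `1 - n`. The kernel vectors are
`(e_{n+1,0}, 0)` and `(0, e_{n-1,0})`; the leading perturbation consists of multiplication by
`e_{n,0}²` and the frequency shift `w`, and `Ω = 2 - ε s` contributes `s` times the reflection. -/
theorem exists_realHessian_kernel {n : ℕ} (hn : 1 ≤ n) {C : ℝ} (hC : 0 ≤ C) :
    ∃ ε₀ > 0, ∃ K : ℝ, ∀ ε, 0 < ε → ε < ε₀ → ∀ (ψ : ℝ → ℝ) (ω : ℝ),
      AEStronglyMeasurable ψ radialMeasure →
      |ω - 2 * ((n : ℝ) + 1) - quarticWeight n * ε| ≤ C * ε ^ 2 →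
      (∀ᵐ r ∂radialMeasure, |ψ r ^ 2 - ε * groundMode n r ^ 2| ≤ C * ε ^ 2) →
      ∃ s : ℝ, |s - quarticWeight n / (n + 1)| ≤ K * ε ∧ ∃ x y : L2r, ¬(x = 0 ∧ y = 0) ∧
        RealHessian n ψ ω (2 - ε * s) x y 0 0 ∧
        (∀ x' y' : L2r, RealHessian n ψ ω (2 - ε * s) x' y' 0 0 →
          ∃ c : ℝ, x' = c • x ∧ y' = c • y) ∧
        ¬ ∃ x' y' : L2r, RealHessian n ψ ω (2 - ε * s) x' y' x y := by
  obtain ⟨k, hk1, hk⟩ := exists_groundMode_le n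
  have hk0 : ∀ᵐ r ∂radialMeasure, |groundMode n r ^ 2| ≤ k ^ 2 := by
    filter_upwards [ae_radialMeasure_pos] with r hr
    rw [abs_of_nonneg (sq_nonneg _)]
    exact pow_le_pow_left₀ (groundMode_pos n hr).le (hk r hr.le) 2
  obtain ⟨M, hM, -, hMs⟩ := exists_mulOp (q := fun r => groundMode n r ^ 2)
    ((continuous_groundMode n).pow 2).aestronglyMeasurable (by positivity) hk0
  obtain ⟨w, hw⟩ : ∃ w, w = quarticWeight n := ⟨_, rfl⟩
  have hw0 : 0 < w := hw ▸ quarticWeight_pos n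
  have hn0 : (0 : ℝ) < n := by exact_mod_cast hn
  obtain ⟨φ₁, hφ₁⟩ : ∃ φ₁ : WithLp 2 (L2r × L2r), φ₁ = WithLp.toLp 2 (groundVec (n + 1), 0) :=
    ⟨_, rfl⟩
  obtain ⟨φ₂, hφ₂⟩ : ∃ φ₂ : WithLp 2 (L2r × L2r), φ₂ = WithLp.toLp 2 (0, groundVec (n - 1)) :=
    ⟨_, rfl⟩
  have hcast : (((n - 1 : ℕ) : ℝ) + 1) = n := by
    rw [Nat.cast_sub hn]
    simp
  have key := exists_singular_parameter
    (pairGraph ((n : ℤ) + 1) (1 - (n : ℤ)) (2 * (((n + 1 : ℕ) : ℝ) + 1))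
      (2 * (((n - 1 : ℕ) : ℝ) + 1))) pairGraph_symmetric (φ₁ := φ₁) (φ₂ := φ₂)
    (by simp [hφ₁, norm_groundVec])
    (by simp [hφ₂, norm_groundVec])
    (by simp [hφ₁, hφ₂, WithLp.prod_inner_apply])
    (by
      rw [hφ₁]
      exact mem_pairGraph.2 ⟨groundVec_mem_modeGraph (by omega), (modeGraph _ _).zero_mem⟩)
    (by
      rw [hφ₂]
      exact mem_pairGraph.2 ⟨(modeGraph _ _).zero_mem, groundVec_mem_modeGraph (by omega)⟩)
    (fun f h1 h2 => by
      rw [hφ₁, WithLp.prod_inner_apply] at h1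
      rw [hφ₂, WithLp.prod_inner_apply] at h2
      simp only [WithLp.ofLp_fst, WithLp.ofLp_snd, inner_zero_left, add_zero, zero_add] at h1 h2
      obtain ⟨x, hx⟩ := exists_mem_modeGraph (m := (n : ℤ) + 1) (n := n + 1) (by omega) h1
      obtain ⟨y, hy⟩ := exists_mem_modeGraph (m := 1 - (n : ℤ)) (n := n - 1) (by omega) h2
      exact ⟨WithLp.toLp 2 (x, y), hx, hy⟩)
    (X₀ := blockOp ((2 : ℝ) • M - w • ContinuousLinearMap.id ℝ L2r) M)
    (J := pairReflection L2r)
    (blockOp_symmetric (fun x y => by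
      simp only [sub_apply, smul_apply, ContinuousLinearMap.id_apply, inner_sub_left,
        inner_sub_right, real_inner_smul_left, real_inner_smul_right, hMs]) hMs)
    (fun x y => by
      simp only [WithLp.prod_inner_apply, WithLp.ofLp_fst, WithLp.ofLp_snd, pairReflection_fst,
        pairReflection_snd, inner_neg_left, inner_neg_right])
    (α := w * n / (n + 1)) (β := w * √(n / (n + 1))) (γ := w)
    (by
      rw [WithLp.prod_inner_apply]
      simp only [WithLp.ofLp_fst, WithLp.ofLp_snd, blockOp_fst, blockOp_snd, hφ₁, WithLp.toLp_fst,
        WithLp.toLp_snd, inner_zero_left, add_zero, map_zero, sub_apply, smul_apply,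
        ContinuousLinearMap.id_apply, inner_sub_right, real_inner_smul_right,
        real_inner_self_eq_norm_sq, norm_groundVec]
      rw [inner_mulOp_groundVec hM, integral_groundMode_succ, ← hw]
      field_simp
      ring)
    (by
      rw [WithLp.prod_inner_apply]
      simp only [WithLp.ofLp_fst, WithLp.ofLp_snd, blockOp_fst, blockOp_snd, hφ₁, hφ₂,
        WithLp.toLp_fst, WithLp.toLp_snd, inner_zero_left, add_zero, zero_add, map_zero]
      rw [inner_mulOp_groundVec hM, integral_groundMode_mixed hn, ← hw])
    (by
      rw [WithLp.prod_inner_apply]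
      simp only [WithLp.ofLp_fst, WithLp.ofLp_snd, blockOp_fst, blockOp_snd, hφ₂, WithLp.toLp_fst,
        WithLp.toLp_snd, inner_zero_left, zero_add, map_zero, sub_apply, smul_apply,
        ContinuousLinearMap.id_apply, inner_sub_right, real_inner_smul_right,
        real_inner_self_eq_norm_sq, norm_groundVec]
      rw [inner_mulOp_groundVec hM, integral_groundMode_pred hn, ← hw]
      ring)
    (by
      refine WithLp.ofLp_injective 2 (Prod.ext ?_ ?_)
      · rfl
      · change -φ₁.snd = φ₁.snd
        rw [hφ₁]
        exact neg_zero)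
    (by
      refine WithLp.ofLp_injective 2 (Prod.ext ?_ ?_)
      · change φ₂.fst = -φ₂.fst
        rw [hφ₂]
        exact neg_zero.symm
      · rfl)
    (by positivity)
    (by
      rw [mul_pow, Real.sq_sqrt (by positivity)]
      ring)
    (by
      have : w - w * n / (n + 1) = w / (n + 1) := by field_simp; ring
      rw [this]
      positivity)
    -- The remainder block has diagonal part of norm at most `3Cε` and off-diagonal part at most
    -- `Cε`; `norm_blockOp_le` doubles their sum.
    (8 * C) (by positivity)
  obtain ⟨ε₀, hε₀, K, hK⟩ := key
  refine ⟨ε₀, hε₀, K, fun ε hε hεε ψ ω hψ hω hψe => ?_⟩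
  have hqb : ∀ᵐ r ∂radialMeasure, |(ψ r ^ 2 - ε * groundMode n r ^ 2) / ε| ≤ C * ε := by
    filter_upwards [hψe] with r hr
    rw [abs_div, abs_of_pos hε, div_le_iff₀ hε]
    linarith
  obtain ⟨Q, hQ, hQn, hQs⟩ := exists_mulOp
    (q := fun r => (ψ r ^ 2 - ε * groundMode n r ^ 2) / ε) (by
      simp only [div_eq_mul_inv]
      exact ((hψ.pow 2).sub
        (((continuous_groundMode n).pow 2).const_mul _).aestronglyMeasurable).mul_const _)
    (by positivity) hqb
  obtain ⟨c, hc⟩ : ∃ c, c = (ω - 2 * ((n : ℝ) + 1) - w * ε) / ε := ⟨_, rfl⟩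
  have hcb : |c| ≤ C * ε := by
    rw [hc, abs_div, abs_of_pos hε, div_le_iff₀ hε, hw]
    linarith
  have hωc : ω = 2 * ((n : ℝ) + 1) + ε * (w + c) := by
    rw [hc]
    field_simp
    ring
  have hp : ∀ᵐ r ∂radialMeasure, ψ r ^ 2 =
      ε * (groundMode n r ^ 2 + (ψ r ^ 2 - ε * groundMode n r ^ 2) / ε) := ae_of_all _ fun r => by
    field_simp
    ring
  obtain ⟨s, hs, v, hv0, hv, hker, hran⟩ := hK ε hε hεε
    (blockOp ((2 : ℝ) • Q - c • ContinuousLinearMap.id ℝ L2r) Q)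
    (blockOp_symmetric (fun x y => by
      simp only [sub_apply, smul_apply, ContinuousLinearMap.id_apply, inner_sub_left,
        inner_sub_right, real_inner_smul_left, real_inner_smul_right, hQs]) hQs)
    (by
      refine (norm_blockOp_le _ _).trans ?_
      have h1 : ‖(2 : ℝ) • Q - c • ContinuousLinearMap.id ℝ L2r‖ ≤ 2 * (C * ε) + C * ε := by
        refine (norm_sub_le _ _).trans ?_
        rw [norm_smul, norm_smul, Real.norm_eq_abs, Real.norm_eq_abs, abs_two]
        have h2 : |c| * ‖ContinuousLinearMap.id ℝ L2r‖ ≤ C * ε * 1 :=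
          mul_le_mul hcb ContinuousLinearMap.norm_id_le (norm_nonneg _) (by positivity)
        linarith
      linarith)
  have hiff : ∀ u f : WithLp 2 (L2r × L2r),
      (u, f - (ε • (blockOp ((2 : ℝ) • M - w • ContinuousLinearMap.id ℝ L2r) M +
        s • pairReflection L2r +
        blockOp ((2 : ℝ) • Q - c • ContinuousLinearMap.id ℝ L2r) Q)) u) ∈
        pairGraph ((n : ℤ) + 1) (1 - (n : ℤ)) (2 * (((n + 1 : ℕ) : ℝ) + 1))
          (2 * (((n - 1 : ℕ) : ℝ) + 1)) ↔
      RealHessian n ψ ω (2 - ε * s) u.fst u.snd f.fst f.snd := by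
    intro u f
    rw [mem_pairGraph, RealHessian]
    refine and_congr ?_ ?_
    · have h := mode_equation_iff (m := (n : ℤ) + 1) (lam := 2 * (((n + 1 : ℕ) : ℝ) + 1))
        (lam' := ω + (2 - ε * s)) (c := w) (t := c - s) hM hQ hp
        (by rw [hωc]; push_cast; ring) u.fst u.snd f.fst
      convert h using 3
      · change f.fst - ε • (((2 : ℝ) • M u.fst - w • u.fst + M u.snd) + s • u.fst +
          ((2 : ℝ) • Q u.fst - c • u.fst + Q u.snd)) = _
        module
      · rw [sub_add_eq_sub_sub]
        ring
    · have h := mode_equation_iff (m := 1 - (n : ℤ)) (lam := 2 * (((n - 1 : ℕ) : ℝ) + 1))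
        (lam' := ω - (2 - ε * s)) (c := w) (t := c + s) hM hQ hp
        (by rw [hωc, hcast]; ring) u.snd u.fst f.snd
      convert h using 3
      · change f.snd - ε • ((M u.fst + ((2 : ℝ) • M u.snd - w • u.snd)) + s • (-u.snd) +
          (Q u.fst + ((2 : ℝ) • Q u.snd - c • u.snd))) = _
        module
      · ring
  -- The representative of the zero class is only almost everywhere zero, so the two forms of the
  -- homogeneous equation must be identified.
  have hzero : ∀ x y : ℝ → ℝ, RealHessian n ψ ω (2 - ε * s) x y (0 : L2r) (0 : L2r) ↔
      RealHessian n ψ ω (2 - ε * s) x y 0 0 := by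
    intro x y
    have h0 := Lp.coeFn_zero ℝ 2 radialMeasure
    constructor
    · rintro ⟨h1, h2⟩
      exact ⟨h1.congr (ae_of_all _ fun _ => rfl) (by filter_upwards [h0] with r hr; rw [hr]),
        h2.congr (ae_of_all _ fun _ => rfl) (by filter_upwards [h0] with r hr; rw [hr])⟩
    · rintro ⟨h1, h2⟩
      exact ⟨h1.congr (ae_of_all _ fun _ => rfl) (by filter_upwards [h0] with r hr; rw [hr]),
        h2.congr (ae_of_all _ fun _ => rfl) (by filter_upwards [h0] with r hr; rw [hr])⟩
  rw [← zero_sub] at hv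
  refine ⟨s, ?_, v.fst, v.snd, fun h => hv0 (WithLp.ofLp_injective 2 (Prod.ext h.1 h.2)),
    (hzero _ _).1 ((hiff v 0).1 hv), fun x' y' h => ?_, ?_⟩
  · have : w - w * n / (n + 1) = quarticWeight n / (n + 1) := by
      rw [← hw]
      field_simp
      ring
    rwa [← this]
  · obtain ⟨d, hd⟩ := hker (WithLp.toLp 2 (x', y')) (by
      rw [← zero_sub]
      exact (hiff _ 0).2 ((hzero _ _).2 h))
    exact ⟨d, congrArg WithLp.fst hd, congrArg WithLp.snd hd⟩
  · rintro ⟨x', y', h⟩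
    exact hran ⟨WithLp.toLp 2 (x', y'), (hiff _ v).2 h⟩

/-! ### The complex Hessian block -/

/-- A real linear functional maps the complex Hessian block to the real one. -/
theorem HessianBlock.map {n : ℕ} {ψ : ℝ → ℝ} {ω Ω : ℝ} {v f : ℝ → ℂ × ℂ}
    (h : HessianBlock n ((n : ℤ) + 1) ψ ω Ω v f) (ℓ : ℂ →L[ℝ] ℝ) :
    RealHessian n ψ ω Ω (fun r => ℓ (v r).1) (fun r => ℓ (v r).2) (fun r => ℓ (f r).1)
      (fun r => ℓ (f r).2) := by
  obtain ⟨g, k, hg, hk, he⟩ := h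
  rw [show (n : ℤ) + 1 - 2 * (n : ℤ) = 1 - (n : ℤ) by ring] at hk
  have e : (((n : ℤ) + 1 : ℤ) : ℝ) - n = 1 := by push_cast; ring
  rw [e, mul_one] at he
  refine ⟨(hg.map ℓ).congr (ae_of_all _ fun _ => rfl) ?_,
    (hk.map ℓ).congr (ae_of_all _ fun _ => rfl) ?_⟩
  · filter_upwards [he] with r hr
    rw [hr.1]
    simp only [map_add, map_sub, map_neg, map_smul, smul_eq_mul]
    ring
  · filter_upwards [he] with r hr
    rw [hr.2]
    simp only [map_add, map_neg, map_smul, smul_eq_mul]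
    ring

theorem RealHessian.hessianBlock {n : ℕ} {ψ : ℝ → ℝ} {ω Ω : ℝ} {x y f g : ℝ → ℝ}
    (h : RealHessian n ψ ω Ω x y f g) :
    HessianBlock n ((n : ℤ) + 1) ψ ω Ω (fun r => ((x r : ℂ), (y r : ℂ)))
      (fun r => ((f r : ℂ), (g r : ℂ))) := by
  have e : (((n : ℤ) + 1 : ℤ) : ℝ) - n = 1 := by push_cast; ring
  have h2 := h.2
  rw [show 1 - (n : ℤ) = (n : ℤ) + 1 - 2 * (n : ℤ) by ring] at h2
  refine ⟨_, _, h.1.map Complex.ofRealCLM, h2.map Complex.ofRealCLM, ae_of_all _ fun r => ?_⟩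
  rw [e, mul_one]
  simp only [Complex.ofRealCLM_apply, Complex.real_smul]
  push_cast
  constructor <;> ring

theorem RealHessian.congr {n : ℕ} {ψ : ℝ → ℝ} {ω Ω : ℝ} {x y f g x' y' f' g' : ℝ → ℝ}
    (h : RealHessian n ψ ω Ω x y f g) (hx : ∀ᵐ r ∂radialMeasure, x r = x' r)
    (hy : ∀ᵐ r ∂radialMeasure, y r = y' r) (hf : ∀ᵐ r ∂radialMeasure, f r = f' r)
    (hg : ∀ᵐ r ∂radialMeasure, g r = g' r) : RealHessian n ψ ω Ω x' y' f' g' := by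
  refine ⟨h.1.congr hx ?_, h.2.congr hy ?_⟩
  · filter_upwards [hx, hy, hf] with r h1 h2 h3
    rw [h1, h2, h3]
  · filter_upwards [hx, hy, hg] with r h1 h2 h3
    rw [h1, h2, h3]

theorem RealHessian.exists_L2r {n : ℕ} {ψ : ℝ → ℝ} {ω Ω : ℝ} {x y f g : ℝ → ℝ}
    (h : RealHessian n ψ ω Ω x y f g) : ∃ X Y : L2r, (∀ᵐ r ∂radialMeasure, X r = x r) ∧
      (∀ᵐ r ∂radialMeasure, Y r = y r) ∧ RealHessian n ψ ω Ω X Y f g := by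
  have hX := MemL2r.coeFn_toL2r h.1.mem
  have hY := MemL2r.coeFn_toL2r h.2.mem
  exact ⟨_, _, hX, hY, h.congr (hX.mono fun _ hr => hr.symm) (hY.mono fun _ hr => hr.symm)
    (ae_of_all _ fun _ => rfl) (ae_of_all _ fun _ => rfl)⟩

/-- The coefficients are real, so real and imaginary parts of a complex kernel vector are separately
real multiples of `(x, y)`, and the real part of a complex preimage of `(x, y)` would be a real
preimage. -/
theorem hasSimpleZeroEigenvalue_of_real {n : ℕ} {ψ : ℝ → ℝ} {ω Ω : ℝ} {x y : L2r}
    (h0 : ¬(x = 0 ∧ y = 0)) (h : RealHessian n ψ ω Ω x y 0 0)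
    (hker : ∀ x' y' : L2r, RealHessian n ψ ω Ω x' y' 0 0 → ∃ c : ℝ, x' = c • x ∧ y' = c • y)
    (hran : ¬ ∃ x' y' : L2r, RealHessian n ψ ω Ω x' y' x y) :
    HasSimpleZeroEigenvalue (HessianBlock n ((n : ℤ) + 1) ψ ω Ω) := by
  refine ⟨fun r => ((x r : ℂ), (y r : ℂ)), ?_, fun hv => h0 ?_, fun w hw => ?_, ?_⟩
  · have := h.hessianBlock
    simp only [Pi.zero_apply, Complex.ofReal_zero] at this
    exact this
  · constructor
    · ext1
      filter_upwards [hv, Lp.coeFn_zero ℝ 2 radialMeasure] with r h1 h2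
      rw [h2]
      simpa using congrArg Prod.fst h1
    · ext1
      filter_upwards [hv, Lp.coeFn_zero ℝ 2 radialMeasure] with r h1 h2
      rw [h2]
      simpa using congrArg Prod.snd h1
  · have hmap : ∀ ℓ : ℂ →L[ℝ] ℝ, ∃ c : ℝ, ∀ᵐ r ∂radialMeasure,
        ℓ (w r).1 = c * x r ∧ ℓ (w r).2 = c * y r := fun ℓ => by
      have h1 := hw.map ℓ
      obtain ⟨X, Y, hX, hY, hXY⟩ := h1.exists_L2r
      obtain ⟨c, rfl, rfl⟩ := hker X Y (hXY.congr (ae_of_all _ fun _ => rfl)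
        (ae_of_all _ fun _ => rfl) (ae_of_all _ fun r => map_zero ℓ)
        (ae_of_all _ fun r => map_zero ℓ))
      refine ⟨c, ?_⟩
      filter_upwards [hX, hY, Lp.coeFn_smul c x, Lp.coeFn_smul c y] with r e1 e2 e3 e4
      rw [← e1, ← e2, e3, e4]
      exact ⟨rfl, rfl⟩
    obtain ⟨c, hc⟩ := hmap Complex.reCLM
    obtain ⟨d, hd⟩ := hmap Complex.imCLM
    refine ⟨⟨c, d⟩, ?_⟩
    filter_upwards [hc, hd] with r h1 h2
    refine Prod.ext (Complex.ext ?_ ?_) (Complex.ext ?_ ?_)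
    · simpa using h1.1
    · simpa using h2.1
    · simpa using h1.2
    · simpa using h2.2
  · rintro ⟨w, hw⟩
    obtain ⟨X, Y, -, -, hXY⟩ := (hw.map Complex.reCLM).exists_L2r
    exact hran ⟨X, Y, hXY⟩

/-! ### The bifurcation along a given primary branch. -/

theorem quarticWeight_div (n : ℕ) : quarticWeight n / (n + 1) =
    ((2 * n).factorial : ℝ) / (4 ^ n * (n.factorial : ℝ) * ((n + 1).factorial : ℝ)) := by
  have := n.factorial_pos
  rw [quarticWeight, Nat.factorial_succ]
  push_cast
  field_simp

theorem IsPrimaryBranch.exists_bifurcation {n : ℕ} (hn : 1 ≤ n) {ψ : ℝ → ℝ → ℝ} {ω : ℝ → ℝ}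
    (h : IsPrimaryBranch n ψ ω) : ∃ a₀ > 0, ∃ (Ω : ℝ → ℝ) (C : ℝ), ∀ a : ℝ, 0 < a → a < a₀ →
      Ω a < 2 ∧ |Ω a - (2 - quarticWeight n / (n + 1) * a ^ 2)| ≤ C * a ^ 4 ∧
        HasSimpleZeroEigenvalue (HessianBlock n ((n : ℤ) + 1) (ψ a) (ω a) (Ω a)) := by
  obtain ⟨a₁, ha₁, D, hD⟩ := h
  obtain ⟨K, hK⟩ := branch_expansion hn (le_max_right D 1)
  obtain ⟨ε₀, hε₀, K', hK'⟩ := exists_realHessian_kernel hn (abs_nonneg K)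
  obtain ⟨E, hE⟩ : ∃ E : ℝ, E = max D 1 := ⟨_, rfl⟩
  have hE1 : 1 ≤ E := hE ▸ le_max_right D 1
  obtain ⟨κ, hκ⟩ : ∃ κ, κ = quarticWeight n / (n + 1) := ⟨_, rfl⟩
  have hκ0 : 0 < κ := by
    rw [hκ]
    exact div_pos (quarticWeight_pos n) (by positivity)
  rw [← hκ] at hK'
  have hlim : ∀ c d : ℝ, 0 < d → ∀ᶠ a : ℝ in 𝓝 0, c * a ^ 2 < d := fun c d hd => by
    have h1 : Tendsto (fun a : ℝ => c * a ^ 2) (𝓝 0) (𝓝 (c * 0 ^ 2)) :=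
      (continuous_const.mul (continuous_id.pow 2)).tendsto 0
    rw [zero_pow two_ne_zero, mul_zero] at h1
    exact h1.eventually_lt_const hd
  -- Three smallness conditions: `a²` below the threshold of the reduction, the requirement of the
  -- branch expansion, and `|K'| a² < κ`, which keeps `s > 0` and hence `Ω < 2`.
  obtain ⟨a₂, ha₂, hs⟩ := Metric.eventually_nhds_iff.1 (((hlim 1 ε₀ hε₀).and
    (hlim (2 * E) 1 one_pos)).and (hlim (|K'|) κ hκ0))
  have key : ∀ a : ℝ, 0 < a → a < min a₁ a₂ → ∃ Ω : ℝ, Ω < 2 ∧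
      |Ω - (2 - κ * a ^ 2)| ≤ |K'| * a ^ 4 ∧
      HasSimpleZeroEigenvalue (HessianBlock n ((n : ℤ) + 1) (ψ a) (ω a) Ω) := by
    intro a ha haa
    obtain ⟨⟨h1, h2⟩, h3⟩ := hs (y := a) (by
      rw [dist_zero_right, Real.norm_of_nonneg ha.le]
      exact haa.trans_le (min_le_right _ _))
    obtain ⟨hV, hH⟩ := hD a ha (haa.trans_le (min_le_left _ _))
    obtain ⟨hω, hm, hψ⟩ := hK a (ψ a) (ω a) ha (hE ▸ h2.le) hV
      (hH.mono (mul_le_mul_of_nonneg_right (le_max_left D 1) (by positivity)))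
    have h4 : K * a ^ 4 ≤ |K| * (a ^ 2) ^ 2 := by
      rw [← pow_mul]
      exact mul_le_mul_of_nonneg_right (le_abs_self K) (by positivity)
    obtain ⟨s, hs1, x, y, h0, hxy, hker, hran⟩ := hK' (a ^ 2) (by positivity) (by linarith) (ψ a)
      (ω a) hm (hω.trans h4) (hψ.mono fun r hr => hr.trans h4)
    have hs2 : |s - κ| ≤ |K'| * a ^ 2 :=
      hs1.trans (mul_le_mul_of_nonneg_right (le_abs_self K') (by positivity))
    have hs0 : 0 < s := by linarith [(abs_le.1 hs2).1]
    refine ⟨2 - a ^ 2 * s, ?_, ?_, hasSimpleZeroEigenvalue_of_real h0 hxy hker hran⟩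
    · have : 0 < a ^ 2 * s := by positivity
      linarith
    · rw [show 2 - a ^ 2 * s - (2 - κ * a ^ 2) = -(a ^ 2 * (s - κ)) by ring, abs_neg, abs_mul,
        abs_of_pos (by positivity : 0 < a ^ 2)]
      calc a ^ 2 * |s - κ| ≤ a ^ 2 * (|K'| * a ^ 2) := by gcongr
        _ = _ := by ring
  choose! Ω hΩ using key
  rw [← hκ]
  exact ⟨min a₁ a₂, lt_min ha₁ ha₂, Ω, |K'|, hΩ⟩

end VortexGP

theorem mainTheorem5 (m₀ : ℕ) (hm₀ : 1 ≤ m₀) :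
    (∃ (ψ : ℝ → ℝ → ℝ) (ω : ℝ → ℝ), VortexGP.IsPrimaryBranch m₀ ψ ω) ∧
    ∀ (ψ : ℝ → ℝ → ℝ) (ω : ℝ → ℝ), VortexGP.IsPrimaryBranch m₀ ψ ω →
      ∃ a₀ > 0, ∃ (Ω : ℝ → ℝ) (C : ℝ), ∀ a : ℝ, 0 < a → a < a₀ →
        Ω a < 2 ∧
        |Ω a - (2 - ((2 * m₀).factorial : ℝ) /
            (4 ^ m₀ * (m₀.factorial : ℝ) * ((m₀ + 1).factorial : ℝ)) * a ^ 2)|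
          ≤ C * a ^ 4 ∧
        VortexGP.HasSimpleZeroEigenvalue
          (VortexGP.HessianBlock m₀ ((m₀ : ℤ) + 1) (ψ a) (ω a) (Ω a)) := by
  refine ⟨VortexGP.exists_primaryBranch hm₀, fun ψ ω h => ?_⟩
  rw [← VortexGP.quarticWeight_div]
  exact h.exists_bifurcation hm₀
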